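/- **Conventions.** All gradings are by a totally ordered abelian group $\Gamma$. A *graded field* $F=\bigoplus_{\gamma}F_\gamma$ is a nonzero commutative graded ring in which every nonzero homogeneous element is invertible. A *graded central division algebra* $D$ over $F$ is a graded $F$-algebra with center $F$, finitely generated as an $F$-module, in which every nonzero homogeneous element is invertible; $\deg(D)$ is defined by $\deg(D)^2=[D:F]$. Put $\Gamma_D=\{\gamma : D_\gamma\neq 0\}$ and $\Gamma_F=\{\gamma: F_\gamma\ne 0\}$. $D$ is *semiramified* if $D_0$ is a field and $[D_0:F_0]=|\Gamma_D/\Gamma_F|=\deg(D)$; then $D_0/F_0$ is Galois, and conjugation by homogeneous elements induces an isomorphism $\theta:\Gamma_D/\Gamma_F\to G:=\mathrm{Gal}(D_0/F_0)$. A group is *elementary abelian* if it is abelian and killed by some prime number (the trivial group is allowed), and a field extension is elementary abelian if it is Galois with elementary abelian Galois group. $D$ is an *elementary abelian graded crossed product* if it has a maximal graded subfield $K\supseteq F$ such that $\mathrm{Frac}(K)/\mathrm{Frac}(F)$ is an elementary abelian extension. **The cocycle $d$.** Let $D$ be semiramified. Choose a basis $(\delta_i+\Gamma_F)_{1\le i\le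 r}$ of the finite abelian group $\Gamma_D/\Gamma_F$, and let $q_i$ be the order of $\delta_i+\Gamma_F$; choose homogeneous units $z_i\in D^*$ of degree $\delta_i$ and $x_i\in F^*$ of degree $q_i\delta_i$. For $\sigma\in G$ let $m(\sigma)=(m_1,\dots,m_r)$, $0\le m_i<q_i$, be the tuple with $\theta(\sum_i m_i\delta_i+\Gamma_F)=\sigma$, and let $z^{m(\sigma)}=z_1^{m_1}\cdots z_r^{m_r}$. For $\sigma,\tau\in G$ write $m_i(\sigma)+m_i(\tau)=m_i(\sigma\tau)+t_iq_i$. Then $$d(\sigma,\tau)=z^{m(\sigma)}z^{m(\tau)}\bigl(z^{m(\sigma\tau)}\bigr)^{-1}\prod_i x_i^{-t_i}$$ defines a $2$-cocycle $d\in Z^2(G,D_0^*)$. Let $(D_0/F_0,G,d)=\bigoplus_{\sigma\in G}D_0u_\sigma$ be the crossed product algebra over $F_0$ given by $u_\sigma a=\sigma(a)u_\sigma$ for $a\in D_0$ and $u_\sigma u_\tau=d(\sigma,\tau)u_{\sigma\tau}$. **Brauer groups.** For a finite abelian Galois extension $K/k$ of fields, $\mathrm{Br}(K/k)$ is the kernel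 of $\mathrm{Br}(k)\to\mathrm{Br}(K)$, and $\mathrm{Dec}(K/k)$ is its subgroup generated by the groups $\mathrm{Br}(L/k)$, where $L$ ranges over the cyclic extensions of $k$ contained in $K$. For a field $k\subseteq M\subseteq K$ there is a canonical homomorphism $\mathrm{Br}(M/k)/\mathrm{Dec}(M/k)\to\mathrm{Br}(K/k)/\mathrm{Dec}(K/k)$. **Theorem 2.15.** Let $F$ be a graded field, let $D$ be a semiramified graded (central) division algebra over $F$, and let $d$ be the cocycle above, for any choice of $(\delta_i)$, $(z_i)$, $(x_i)$. Suppose that $\deg(D)=p^n$ with $p$ prime and $n\ge 1$, and that $F_0$ contains a primitive $p$-th root of unity. Then the following statements are equivalent: 1. $D$ is an elementary abelian graded crossed product; 2. there is a field $M$ with $F_0\subseteq M\subseteq D_0$ such that $M/F_0$ and $D_0/M$ are elementary abelian, and the class of $(D_0/F_0,G,d)$ in $\mathrm{Br}(D_0/F_0)/\mathrm{Dec}(D_0/F_0)$ lies in the image of the canonical homomorphism $\mathrm{Br}(M/F_0)/\mathrm{Dec}(M/F_0)\to\mathrm{Br}(D_0/F_0)/\mathrm{Dec}(D_0/F_0)$;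 3. $\exp(G)\in\{p,p^2\}$, and the class of $(D_0/F_0,G,d)$ in $\mathrm{Br}(D_0/F_0)/\mathrm{Dec}(D_0/F_0)$ lies in the image of the canonical homomorphism $\mathrm{Br}(L/F_0)/\mathrm{Dec}(L/F_0)\to\mathrm{Br}(D_0/F_0)/\mathrm{Dec}(D_0/F_0)$, where $L$ is the subfield of $D_0$ fixed by $G^p=\{\sigma^p:\sigma\in G\}$. Moreover, if $\exp(G)=p$, then $L=D_0$ and the condition on the class in (3) holds automatically. -/

import Mathlib

universe u v

open scoped TensorProduct

/-! ### The Brauer group of a field -/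

namespace BrauerTheory

section Tensor

variable {k : Type*} [Field k]

/-- An element of `A ⊗ B` commuting with `1 ⊗ B`, where `B` is central, lies in `A ⊗ 1`. -/
lemma exists_tmul_one_of_commute {A B : Type*} [Ring A] [Ring B] [Algebra k A] [Algebra k B]
    [Algebra.IsCentral k B] (z : A ⊗[k] B) (hz : ∀ b : B, (1 ⊗ₜ b) * z = z * (1 ⊗ₜ b)) :
    ∃ a : A, z = a ⊗ₜ 1 := by
  have h : z ∈ Subalgebra.centralizer k
      ((Algebra.TensorProduct.includeRight : B →ₐ[k] A ⊗[k] B).range : Set (A ⊗[k] B)) := by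
    rw [Subalgebra.mem_centralizer_iff]
    rintro _ ⟨b, rfl⟩
    exact hz b
  rw [Subalgebra.centralizer_range_includeRight_eq_center_tensorProduct] at h
  obtain ⟨w, rfl⟩ := h
  clear hz
  induction w using TensorProduct.induction_on with
  | zero => exact ⟨0, by simp⟩
  | tmul a c =>
    obtain ⟨c, hc⟩ := c
    obtain ⟨t, rfl⟩ := (Algebra.IsCentral.mem_center_iff k).1 hc
    refine ⟨t • a, ?_⟩
    simp [Algebra.algebraMap_eq_smul_one, TensorProduct.tmul_smul, TensorProduct.smul_tmul']
  | add x y hx hy =>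
    obtain ⟨a, ha⟩ := hx
    obtain ⟨b, hb⟩ := hy
    exact ⟨a + b, by rw [map_add, ha, hb, TensorProduct.add_tmul]⟩

instance isCentral_tensor (A B : Type*) [Ring A] [Ring B] [Algebra k A] [Algebra k B]
    [Nontrivial B] [Algebra.IsCentral k A] [Algebra.IsCentral k B] :
    Algebra.IsCentral k (A ⊗[k] B) where
  out z hz := by
    rw [Subalgebra.mem_center_iff] at hz
    obtain ⟨a, rfl⟩ := exists_tmul_one_of_commute z fun b => hz _
    have hinj := Algebra.TensorProduct.includeLeft_injective (R := k) (S := k) (A := A) (B := B)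
      (FaithfulSMul.algebraMap_injective k B)
    have ha : a ∈ Subalgebra.center k A := by
      rw [Subalgebra.mem_center_iff]
      intro c
      apply hinj
      simpa using hz (c ⊗ₜ 1)
    obtain ⟨t, rfl⟩ := (Algebra.IsCentral.mem_center_iff k).1 ha
    exact ⟨t, rfl⟩

instance isCentral_baseChange (L A : Type*) [Field L] [Ring A] [Algebra k L] [Algebra k A]
    [Algebra.IsCentral k A] : Algebra.IsCentral L (L ⊗[k] A) where
  out z hz := by
    rw [Subalgebra.mem_center_iff] at hz
    obtain ⟨a, rfl⟩ := exists_tmul_one_of_commute z fun b => hz _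
    exact ⟨a, rfl⟩

/-- The tensor product of a central simple algebra and a simple algebra is simple. -/
instance isSimpleRing_tensor (A B : Type*) [Ring A] [Ring B] [Algebra k A] [Algebra k B]
    [Algebra.IsCentral k A] [IsSimpleRing A] [IsSimpleRing B] : IsSimpleRing (A ⊗[k] B) := by
  classical
  have hinj := Algebra.TensorProduct.includeRight_injective (R := k) (A := A) (B := B)
      (FaithfulSMul.algebraMap_injective k A)
  have : Nontrivial (A ⊗[k] B) := hinj.nontrivial
  refine .of_eq_bot_or_eq_top fun I => ?_
  rw [or_iff_not_imp_left]
  intro hI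
  let b := Module.Basis.ofVectorSpace k B
  let c := Algebra.TensorProduct.basis A b
  have hR : ∀ (a : A) (y : A ⊗[k] B) i, c.repr (y * (a ⊗ₜ 1)) i = c.repr y i * a := by
    intro a y i
    induction y using TensorProduct.induction_on with
    | zero => simp
    | tmul x z =>
      simp only [Algebra.TensorProduct.tmul_mul_tmul, mul_one, c,
        Algebra.TensorProduct.basis_repr_tmul, Finsupp.smul_apply, Finsupp.mapRange_apply,
        smul_eq_mul, mul_assoc, Algebra.commutes]
    | add x y hx hy => simp [add_mul, hx, hy]
  have hL : ∀ (a : A) (y : A ⊗[k] B) i, c.repr ((a ⊗ₜ 1) * y) i = a * c.repr y i := by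
    intro a y i
    induction y using TensorProduct.induction_on with
    | zero => simp
    | tmul x z =>
      simp only [Algebra.TensorProduct.tmul_mul_tmul, one_mul, c,
        Algebra.TensorProduct.basis_repr_tmul, Finsupp.smul_apply, Finsupp.mapRange_apply,
        smul_eq_mul, mul_assoc]
    | add x y hx hy => simp [mul_add, hx, hy]
  -- a nonzero element of `I` with the fewest coordinates
  have hex : ∃ n, ∃ x ∈ I, x ≠ 0 ∧ (c.repr x).support.card = n := by
    obtain ⟨x, hx, hx0⟩ := SetLike.exists_of_lt (bot_lt_iff_ne_bot.mpr hI : ⊥ < I)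
    exact ⟨_, x, hx, hx0, rfl⟩
  obtain ⟨x, hx, hx0, hcard⟩ := Nat.find_spec hex
  have hmin : ∀ y ∈ I, (c.repr y).support ⊂ (c.repr x).support → y = 0 := by
    intro y hy hss
    by_contra hy0
    exact Nat.find_min hex (hcard ▸ Finset.card_lt_card hss) ⟨y, hy, hy0, rfl⟩
  obtain ⟨i, hi⟩ : ∃ i, c.repr x i ≠ 0 := by
    by_contra! h
    exact hx0 (c.repr.map_eq_zero_iff.1 (Finsupp.ext h))
  let J : TwoSidedIdeal A := TwoSidedIdeal.mk'
    {a | ∃ y ∈ I, (c.repr y).support ⊆ (c.repr x).support ∧ c.repr y i = a}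
    ⟨0, I.zero_mem, by simp, by simp⟩
    (by
      rintro _ _ ⟨y, hy, hs, rfl⟩ ⟨z, hz, ht, rfl⟩
      exact ⟨y + z, I.add_mem hy hz, by
        rw [map_add]
        exact Finsupp.support_add.trans (Finset.union_subset hs ht), by simp⟩)
    (by
      rintro _ ⟨y, hy, hs, rfl⟩
      exact ⟨-y, I.neg_mem hy, by simpa using hs, by simp⟩)
    (by
      rintro a _ ⟨y, hy, hs, rfl⟩
      refine ⟨(a ⊗ₜ 1) * y, I.mul_mem_left _ _ hy, fun j hj => hs ?_, hL _ _ _⟩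
      rw [Finsupp.mem_support_iff, hL] at hj
      rw [Finsupp.mem_support_iff]
      exact right_ne_zero_of_mul hj)
    (by
      rintro _ a ⟨y, hy, hs, rfl⟩
      refine ⟨y * (a ⊗ₜ 1), I.mul_mem_right _ _ hy, fun j hj => hs ?_, hR _ _ _⟩
      rw [Finsupp.mem_support_iff, hR] at hj
      rw [Finsupp.mem_support_iff]
      exact left_ne_zero_of_mul hj)
  have h1 : (1 : A) ∈ J := IsSimpleRing.one_mem_of_ne_zero_mem J hi (by
    rw [TwoSidedIdeal.mem_mk']
    exact ⟨x, hx, subset_rfl, rfl⟩)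
  rw [TwoSidedIdeal.mem_mk'] at h1
  obtain ⟨y, hy, hys, hyi⟩ := h1
  have hcomm : ∀ a : A, (a ⊗ₜ 1) * y = y * (a ⊗ₜ 1) := by
    intro a
    rw [← sub_eq_zero]
    refine hmin _ (I.sub_mem (I.mul_mem_left _ _ hy) (I.mul_mem_right _ _ hy)) ?_
    rw [Finset.ssubset_iff_of_subset]
    · refine ⟨i, by simpa using hi, ?_⟩
      simp [hL, hR, hyi]
    · intro j hj
      apply hys
      rw [Finsupp.mem_support_iff] at hj ⊢
      intro h0
      apply hj
      simp [hL, hR, h0]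
  obtain ⟨β, hβ⟩ : ∃ β : B, y = 1 ⊗ₜ β := by
    obtain ⟨β, hβ⟩ := exists_tmul_one_of_commute (Algebra.TensorProduct.comm k A B y) (fun a => by
      have := congrArg (Algebra.TensorProduct.comm k A B) (hcomm a)
      simpa using this)
    refine ⟨β, (Algebra.TensorProduct.comm k A B).injective ?_⟩
    simpa using hβ
  have hβ0 : β ≠ 0 := by
    rintro rfl
    rw [TensorProduct.tmul_zero] at hβ
    rw [hβ] at hyi
    simp at hyi
  have h1 : (1 : B) ∈ I.comap (Algebra.TensorProduct.includeRight : B →ₐ[k] A ⊗[k] B) :=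
    IsSimpleRing.one_mem_of_ne_zero_mem _ hβ0 (by
      rw [TwoSidedIdeal.mem_comap]
      rw [hβ] at hy
      exact hy)
  rw [TwoSidedIdeal.mem_comap, map_one] at h1
  exact I.one_mem_iff.1 h1

instance isSimpleRing_baseChange (L A : Type*) [Field L] [Ring A] [Algebra k L] [Algebra k A]
    [Algebra.IsCentral k A] [IsSimpleRing A] : IsSimpleRing (L ⊗[k] A) :=
  IsSimpleRing.of_ringEquiv (Algebra.TensorProduct.comm k A L).toRingEquiv inferInstance

end Tensor

variable {k : Type u} [Field k]

/-- The central simple algebra given by an algebra with the required properties. -/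
abbrev csaOf (k : Type u) [Field k] (A : Type u) [Ring A] [Algebra k A] [Algebra.IsCentral k A]
    [IsSimpleRing A] [FiniteDimensional k A] : CSA.{u, u} k where
  toAlgCat := AlgCat.of k A

/-- The class of a central simple algebra in the Brauer group. -/
abbrev brauerClass (k : Type u) [Field k] (A : Type u) [Ring A] [Algebra k A]
    [Algebra.IsCentral k A] [IsSimpleRing A] [FiniteDimensional k A] : BrauerGroup.{u, u} k :=
  Quotient.mk (Brauer.CSA_Setoid k) (csaOf k A)

lemma brauerEquivalent_of_matrix {A B : CSA.{u, u} k} {ι κ : Type*} [Fintype ι] [Fintype κ]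
    [DecidableEq ι] [DecidableEq κ] [Nonempty ι] [Nonempty κ]
    (e : Matrix ι ι A ≃ₐ[k] Matrix κ κ B) : IsBrauerEquivalent A B :=
  ⟨Fintype.card ι, Fintype.card κ, Fintype.card_ne_zero, Fintype.card_ne_zero,
    ⟨(Matrix.reindexAlgEquiv k A (Fintype.equivFin ι)).symm.trans
      (e.trans (Matrix.reindexAlgEquiv k B (Fintype.equivFin κ)))⟩⟩

lemma brauerEquivalent_of_algEquiv {A B : CSA.{u, u} k} (e : A ≃ₐ[k] B) :
    IsBrauerEquivalent A B :=
  brauerEquivalent_of_matrix (ι := Unit) (κ := Unit) e.mapMatrix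

lemma brauerEquivalent_one_of_matrix {A : CSA.{u, u} k} {κ : Type*} [Fintype κ]
    [DecidableEq κ] [Nonempty κ] (e : A ≃ₐ[k] Matrix κ κ k) :
    IsBrauerEquivalent A (csaOf k k) :=
  brauerEquivalent_of_matrix (ι := Unit) (κ := κ)
    ((Matrix.uniqueAlgEquiv (R := k) (m := Unit) (A := A)).trans e)

/-- Multiplication of Brauer classes: the class of the tensor product. -/
noncomputable instance : Mul (BrauerGroup.{u, u} k) where
  mul := Quotient.map₂ (fun A B => csaOf k (A ⊗[k] B)) (by
    rintro A A' ⟨n, m, hn, hm, ⟨e⟩⟩ B B' ⟨p, q, hp, hq, ⟨f⟩⟩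
    have := NeZero.mk hn
    have := NeZero.mk hm
    have := NeZero.mk hp
    have := NeZero.mk hq
    exact brauerEquivalent_of_matrix (ι := Fin n × Fin p) (κ := Fin m × Fin q)
      ((Matrix.kroneckerTMulAlgEquiv (Fin n) (Fin p) k k A B).symm.trans
        ((Algebra.TensorProduct.congr e f).trans
          (Matrix.kroneckerTMulAlgEquiv (Fin m) (Fin q) k k A' B'))))

/-- The trivial Brauer class. -/
instance : One (BrauerGroup.{u, u} k) where
  one := brauerClass k k

/-- The inverse of a Brauer class: the class of the opposite algebra. -/
instance : Inv (BrauerGroup.{u, u} k) where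
  inv := Quotient.map (fun A => csaOf k (Aᵐᵒᵖ)) (by
    rintro A A' ⟨n, m, hn, hm, ⟨e⟩⟩
    have := NeZero.mk hn
    have := NeZero.mk hm
    exact brauerEquivalent_of_matrix (ι := Fin n) (κ := Fin m)
      (AlgEquiv.mopMatrix.trans ((AlgEquiv.op e).trans AlgEquiv.mopMatrix.symm)))

/-- The canonical isomorphism `A ⊗ Aᵐᵒᵖ ≃ End_k(A)` of a central simple algebra. -/
noncomputable def mulLeftRightEquiv (A : Type u) [Ring A] [Algebra k A] [Algebra.IsCentral k A]
    [IsSimpleRing A] [FiniteDimensional k A] : A ⊗[k] Aᵐᵒᵖ ≃ₐ[k] Module.End k A :=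
  AlgEquiv.ofBijective (AlgHom.mulLeftRight k A) (by
    have hinj : Function.Injective (AlgHom.mulLeftRight k A) :=
      (AlgHom.mulLeftRight k A).toRingHom.injective
    refine ⟨hinj, ?_⟩
    have hdim : Module.finrank k (A ⊗[k] Aᵐᵒᵖ) = Module.finrank k (Module.End k A) := by
      rw [Module.finrank_tensorProduct, Module.finrank_linearMap,
        LinearEquiv.finrank_eq (MulOpposite.opLinearEquiv k (M := A)).symm]
    exact ((AlgHom.mulLeftRight k A).toLinearMap.injective_iff_surjective_of_finrank_eq_finrank
      hdim).1 hinj)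

/-- The Brauer group, with multiplication induced by the tensor product. -/
noncomputable instance : CommGroup (BrauerGroup.{u, u} k) where
  mul_assoc := by
    rintro ⟨A⟩ ⟨B⟩ ⟨C⟩
    exact Quotient.sound (s := Brauer.CSA_Setoid k)
      (brauerEquivalent_of_algEquiv (Algebra.TensorProduct.assoc k k k A B C))
  one_mul := by
    rintro ⟨A⟩
    exact Quotient.sound (s := Brauer.CSA_Setoid k)
      (brauerEquivalent_of_algEquiv (Algebra.TensorProduct.lid k A))
  mul_one := by
    rintro ⟨A⟩
    exact Quotient.sound (s := Brauer.CSA_Setoid k)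
      (brauerEquivalent_of_algEquiv (Algebra.TensorProduct.rid k k A))
  mul_comm := by
    rintro ⟨A⟩ ⟨B⟩
    exact Quotient.sound (s := Brauer.CSA_Setoid k)
      (brauerEquivalent_of_algEquiv (Algebra.TensorProduct.comm k A B))
  inv_mul_cancel := by
    rintro ⟨A⟩
    have : NeZero (Module.finrank k A) := ⟨Module.finrank_pos.ne'⟩
    exact Quotient.sound (s := Brauer.CSA_Setoid k)
      (brauerEquivalent_one_of_matrix (κ := Fin (Module.finrank k A))
        ((Algebra.TensorProduct.comm k (Aᵐᵒᵖ) A).trans ((mulLeftRightEquiv (k := k) A).trans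
          (algEquivMatrix (Module.finBasis k A)))))

/-- The restriction (base change) homomorphism `Br(k) → Br(L)`, `[A] ↦ [L ⊗ A]`. -/
noncomputable def res (k L : Type u) [Field k] [Field L] [Algebra k L] :
    BrauerGroup.{u, u} k →* BrauerGroup.{u, u} L where
  toFun := Quotient.map (fun A => csaOf L (L ⊗[k] A)) (by
    rintro A A' ⟨n, m, hn, hm, ⟨e⟩⟩
    have := NeZero.mk hn
    have := NeZero.mk hm
    exact brauerEquivalent_of_matrix (ι := Unit × Fin n) (κ := Unit × Fin m)
      ((Matrix.kroneckerTMulAlgEquiv Unit (Fin n) k L L A).symm.trans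
        ((Algebra.TensorProduct.congr AlgEquiv.refl e).trans
          (Matrix.kroneckerTMulAlgEquiv Unit (Fin m) k L L A'))))
  map_one' := Quotient.sound (s := Brauer.CSA_Setoid L)
    (brauerEquivalent_of_algEquiv (Algebra.TensorProduct.rid k L L))
  map_mul' := by
    rintro ⟨A⟩ ⟨B⟩
    exact Quotient.sound (s := Brauer.CSA_Setoid L) (brauerEquivalent_of_algEquiv
      (((Algebra.TensorProduct.tensorTensorTensorComm k k L L L A L B).trans
        (Algebra.TensorProduct.congr (Algebra.TensorProduct.lid L L) AlgEquiv.refl)).symm))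

lemma res_res (k L L' : Type u) [Field k] [Field L] [Field L'] [Algebra k L] [Algebra k L']
    [Algebra L L'] [IsScalarTower k L L'] (b : BrauerGroup.{u, u} k) :
    res L L' (res k L b) = res k L' b := by
  obtain ⟨A⟩ := b
  exact Quotient.sound (s := Brauer.CSA_Setoid L') (brauerEquivalent_of_algEquiv
    ((Algebra.TensorProduct.assoc k L L' L' L A).symm.trans
      (Algebra.TensorProduct.congr (Algebra.TensorProduct.rid L L' L') AlgEquiv.refl)))

/-- The relative Brauer group `Br(K/k)`: the classes of `Br(k)` split by `K`. -/
noncomputable def relBr (k K : Type u) [Field k] [Field K] [Algebra k K] :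
    Subgroup (BrauerGroup.{u, u} k) :=
  (res k K).ker

lemma relBr_le_of_algHom {k K K' : Type u} [Field k] [Field K] [Field K'] [Algebra k K]
    [Algebra k K'] (f : K →ₐ[k] K') : relBr k K ≤ relBr k K' := by
  let _ := f.toRingHom.toAlgebra
  have : IsScalarTower k K K' := .of_algebraMap_eq fun x => (f.commutes x).symm
  intro b hb
  rw [relBr, MonoidHom.mem_ker] at hb ⊢
  rw [← res_res k K K', hb, map_one]

/-- `Dec(K/k)`: the subgroup of `Br(k)` generated by the groups `Br(L/k)`, where `L` ranges over
the cyclic Galois extensions of `k` in `K`. -/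
noncomputable def dec (k K : Type u) [Field k] [Field K] [Algebra k K] :
    Subgroup (BrauerGroup.{u, u} k) :=
  ⨆ (L : IntermediateField k K) (_ : IsGalois k L ∧ IsCyclic (L ≃ₐ[k] L)), relBr k L

lemma dec_le_relBr (k K : Type u) [Field k] [Field K] [Algebra k K] : dec k K ≤ relBr k K :=
  iSup₂_le fun L _ => relBr_le_of_algHom L.val

lemma dec_le_of_algHom {k K K' : Type u} [Field k] [Field K] [Field K'] [Algebra k K]
    [Algebra k K'] (f : K →ₐ[k] K') : dec k K ≤ dec k K' := by
  refine iSup₂_le fun L hL => ?_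
  let e : L ≃ₐ[k] L.map f := L.equivMap f
  have h1 := hL.1
  have h2 := hL.2
  refine (relBr_le_of_algHom e.toAlgHom).trans ?_
  refine le_iSup₂_of_le (L.map f) ⟨IsGalois.of_algEquiv e, ?_⟩ le_rfl
  exact isCyclic_of_surjective (AlgEquiv.autCongr e) (AlgEquiv.autCongr e).surjective

/-- The quotient group `Br(K/k) / Dec(K/k)`. -/
abbrev RelBrModDec (k K : Type u) [Field k] [Field K] [Algebra k K] : Type _ :=
  relBr k K ⧸ (dec k K).subgroupOf (relBr k K)

/-- The canonical homomorphism `Br(M/k) / Dec(M/k) → Br(K/k) / Dec(K/k)` for a field `M` between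
`k` and `K`. -/
noncomputable def relBrModDecMap {k K : Type u} [Field k] [Field K] [Algebra k K]
    (M : IntermediateField k K) : RelBrModDec k M →* RelBrModDec k K :=
  QuotientGroup.map _ _ (Subgroup.inclusion (relBr_le_of_algHom M.val))
    (fun _ hb => dec_le_of_algHom M.val hb)

/-! ### Crossed products -/

section CrossedProduct

variable {K : Type u} [Field K] [Algebra k K]

/-- The crossed product `(K/k, G, d) = ⨁_{σ ∈ G} K x_σ` of a finite Galois extension `K/k` with
Galois group `G` and a 2-cocycle `d`, with `x_σ a = σ(a) x_σ` and `x_σ x_τ = d(σ, τ) x_{στ}`.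
The element `∑ a_σ x_σ` is represented by the family `σ ↦ a_σ` of its coefficients. -/
@[ext]
structure CrossedProduct {d : (K ≃ₐ[k] K) × (K ≃ₐ[k] K) → Kˣ}
    (hd : groupCohomology.IsMulCocycle₂ d) : Type u where
  /-- The coefficients of `∑ a_σ x_σ`. -/
  coeff : (K ≃ₐ[k] K) → K

namespace CrossedProduct

variable {d : (K ≃ₐ[k] K) × (K ≃ₐ[k] K) → Kˣ} (hd : groupCohomology.IsMulCocycle₂ d)

/-- The coefficients as an equivalence. -/
def coeffEquiv : CrossedProduct hd ≃ ((K ≃ₐ[k] K) → K) where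
  toFun := coeff
  invFun := mk

instance : AddCommGroup (CrossedProduct hd) := (coeffEquiv hd).addCommGroup

instance : Module k (CrossedProduct hd) := (coeffEquiv hd).module k

/-- The coefficients as a linear equivalence. -/
def coeffLinearEquiv : CrossedProduct hd ≃ₗ[k] ((K ≃ₐ[k] K) → K) :=
  (coeffEquiv hd).linearEquiv k

variable {hd}

lemma ext' {f g : CrossedProduct hd} (h : ∀ σ, f.coeff σ = g.coeff σ) : f = g :=
  CrossedProduct.ext (funext h)

@[simp] lemma zero_apply (σ : K ≃ₐ[k] K) : (0 : CrossedProduct hd).coeff σ = 0 := rfl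
@[simp] lemma add_apply (f g : CrossedProduct hd) (σ : K ≃ₐ[k] K) :
    (f + g).coeff σ = f.coeff σ + g.coeff σ := rfl
@[simp] lemma sub_apply (f g : CrossedProduct hd) (σ : K ≃ₐ[k] K) :
    (f - g).coeff σ = f.coeff σ - g.coeff σ := rfl
@[simp] lemma smul_apply (c : k) (f : CrossedProduct hd) (σ : K ≃ₐ[k] K) :
    (c • f).coeff σ = c • f.coeff σ := rfl

open Classical in
/-- The element `a x_σ`. -/
noncomputable def single (hd : groupCohomology.IsMulCocycle₂ d) (σ : K ≃ₐ[k] K) (a : K) :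
    CrossedProduct hd :=
  ⟨fun τ => if τ = σ then a else 0⟩

lemma cocycle (hd : groupCohomology.IsMulCocycle₂ d) (σ τ ρ : K ≃ₐ[k] K) :
    (d (σ * τ, ρ) : K) * d (σ, τ) = σ (d (τ, ρ)) * d (σ, τ * ρ) := by
  have := congrArg (Units.val) (hd σ τ ρ)
  simpa using this

lemma map_one_fst (hd : groupCohomology.IsMulCocycle₂ d) (σ : K ≃ₐ[k] K) :
    d (1, σ) = d (1, 1) :=
  groupCohomology.map_one_fst_of_isMulCocycle₂ hd σ

lemma map_one_snd (hd : groupCohomology.IsMulCocycle₂ d) (σ : K ≃ₐ[k] K) :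
    (d (σ, 1) : K) = σ (d (1, 1)) :=
  congrArg Units.val (groupCohomology.map_one_snd_of_isMulCocycle₂ hd σ)

noncomputable instance : One (CrossedProduct hd) where
  one := single hd 1 (d (1, 1) : K)⁻¹

lemma one_def : (1 : CrossedProduct hd) = single hd 1 (d (1, 1) : K)⁻¹ := rfl

variable [FiniteDimensional k K]

noncomputable instance : Mul (CrossedProduct hd) where
  mul f g := ⟨fun ρ => ∑ σ, f.coeff σ * σ (g.coeff (σ⁻¹ * ρ)) * d (σ, σ⁻¹ * ρ)⟩

lemma mul_apply (f g : CrossedProduct hd) (ρ : K ≃ₐ[k] K) :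
    (f * g).coeff ρ = ∑ σ, f.coeff σ * σ (g.coeff (σ⁻¹ * ρ)) * d (σ, σ⁻¹ * ρ) := rfl

lemma single_mul_apply (σ : K ≃ₐ[k] K) (a : K) (g : CrossedProduct hd) (ρ : K ≃ₐ[k] K) :
    (single hd σ a * g).coeff ρ = a * σ (g.coeff (σ⁻¹ * ρ)) * d (σ, σ⁻¹ * ρ) := by
  rw [mul_apply, Finset.sum_eq_single σ]
  · simp [single]
  · intro τ _ h
    simp [single, h]
  · simp

lemma mul_single_apply (τ : K ≃ₐ[k] K) (a : K) (f : CrossedProduct hd) (ρ : K ≃ₐ[k] K) :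
    (f * single hd τ a).coeff ρ = f.coeff (ρ * τ⁻¹) * (ρ * τ⁻¹) a * d (ρ * τ⁻¹, τ) := by
  rw [mul_apply, Finset.sum_eq_single (ρ * τ⁻¹)]
  · simp [single]
  · intro σ _ h
    have : σ⁻¹ * ρ ≠ τ := by
      rintro rfl
      exact h (by group)
    simp [single, this]
  · simp

/-- The defining relations: `a x_σ · b x_τ = a σ(b) d(σ, τ) x_{στ}`. -/
lemma single_mul_single (σ τ : K ≃ₐ[k] K) (a b : K) :
    single hd σ a * single hd τ b = single hd (σ * τ) (a * σ b * d (σ, τ)) := by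
  refine ext' fun ρ => ?_
  rw [single_mul_apply]
  by_cases h : ρ = σ * τ
  · subst h
    simp [single]
  · have : σ⁻¹ * ρ ≠ τ := by
      rintro rfl
      exact h (by group)
    simp [single, h, this]

noncomputable instance : Ring (CrossedProduct hd) where
  __ := (inferInstance : AddCommGroup (CrossedProduct hd))
  left_distrib f g h := by
    refine ext' fun ρ => ?_
    simp only [mul_apply, add_apply, map_add, mul_add, add_mul, Finset.sum_add_distrib]
  right_distrib f g h := by
    refine ext' fun ρ => ?_
    simp only [mul_apply, add_apply, add_mul, Finset.sum_add_distrib]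
  zero_mul f := by
    refine ext' fun ρ => ?_
    simp [mul_apply]
  mul_zero f := by
    refine ext' fun ρ => ?_
    simp [mul_apply]
  one_mul f := by
    refine ext' fun ρ => ?_
    rw [one_def, single_mul_apply]
    simp only [inv_one, one_mul, AlgEquiv.one_apply, map_one_fst hd ρ]
    field_simp
  mul_one f := by
    refine ext' fun ρ => ?_
    rw [one_def, mul_single_apply]
    simp only [inv_one, mul_one, map_inv₀, map_one_snd hd ρ]
    have : ρ (d (1, 1) : K) ≠ 0 := by simp
    field_simp
  mul_assoc f g h := by
    refine ext' fun ρ => ?_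
    simp only [mul_apply, map_sum, Finset.sum_mul, Finset.mul_sum, map_mul]
    rw [Finset.sum_comm]
    refine Finset.sum_congr rfl fun σ _ => ?_
    refine Fintype.sum_equiv (Equiv.mulLeft σ⁻¹) _ _ fun τ => ?_
    have h1 := cocycle hd σ (σ⁻¹ * τ) (τ⁻¹ * ρ)
    have h2 : σ⁻¹ * τ * (τ⁻¹ * ρ) = σ⁻¹ * ρ := by group
    have h3 : (σ⁻¹ * τ)⁻¹ * (σ⁻¹ * ρ) = τ⁻¹ * ρ := by group
    rw [h2, mul_inv_cancel_left] at h1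
    simp only [Equiv.coe_mulLeft, h3]
    have h4 : σ ((σ⁻¹ * τ) (h.coeff (τ⁻¹ * ρ))) = τ (h.coeff (τ⁻¹ * ρ)) := by
      rw [← AlgEquiv.mul_apply, mul_inv_cancel_left]
    rw [h4]
    linear_combination (f.coeff σ * σ (g.coeff (σ⁻¹ * τ)) * τ (h.coeff (τ⁻¹ * ρ))) * h1

noncomputable instance : Algebra k (CrossedProduct hd) :=
  Algebra.ofModule
    (fun c f g => by
      refine ext' fun ρ => ?_
      simp only [mul_apply, smul_apply, Finset.smul_sum, smul_mul_assoc])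
    (fun c f g => by
      refine ext' fun ρ => ?_
      simp only [mul_apply, smul_apply, Finset.smul_sum, map_smul, smul_mul_assoc,
        mul_smul_comm])

instance : FiniteDimensional k (CrossedProduct hd) :=
  Module.Finite.equiv (coeffLinearEquiv hd).symm

instance : Nontrivial (CrossedProduct hd) :=
  (coeffEquiv hd).nontrivial

/-- The embedding of `K` into the crossed product. -/
noncomputable def ofField (hd : groupCohomology.IsMulCocycle₂ d) (a : K) : CrossedProduct hd :=
  single hd 1 (a * (d (1, 1) : K)⁻¹)

lemma ofField_mul_apply (a : K) (f : CrossedProduct hd) (ρ : K ≃ₐ[k] K) :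
    (ofField hd a * f).coeff ρ = a * f.coeff ρ := by
  rw [ofField, single_mul_apply]
  simp only [inv_one, one_mul, AlgEquiv.one_apply, map_one_fst hd ρ]
  field_simp

lemma mul_ofField_apply (a : K) (f : CrossedProduct hd) (ρ : K ≃ₐ[k] K) :
    (f * ofField hd a).coeff ρ = f.coeff ρ * ρ a := by
  rw [ofField, mul_single_apply]
  simp only [inv_one, mul_one, map_mul, map_inv₀, map_one_snd hd ρ]
  have : ρ (d (1, 1) : K) ≠ 0 := by simp
  field_simp

instance [IsGalois k K] : Algebra.IsCentral k (CrossedProduct hd) where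
  out f hf := by
    rw [Subalgebra.mem_center_iff] at hf
    have h0 : ∀ ρ ≠ 1, f.coeff ρ = 0 := by
      intro ρ hρ
      by_contra hne
      apply hρ
      ext a
      have := congrFun (congrArg coeff (hf (ofField hd a))) ρ
      rw [ofField_mul_apply, mul_ofField_apply, mul_comm] at this
      simpa using (mul_left_cancel₀ hne this).symm
    have hfix : ∀ τ : K ≃ₐ[k] K, τ (f.coeff 1 * d (1, 1)) = f.coeff 1 * d (1, 1) := by
      intro τ
      have := congrFun (congrArg coeff (hf (single hd τ 1))) τ
      rw [single_mul_apply, mul_single_apply] at this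
      simp only [inv_mul_cancel, mul_inv_cancel, one_mul, map_one, mul_one, map_one_snd hd τ,
        map_one_fst hd τ] at this
      rw [map_mul, this]
    obtain ⟨c, hc⟩ := (IsGalois.mem_range_algebraMap_iff_fixed (F := k) _).2 hfix
    refine ⟨c, ?_⟩
    change algebraMap k _ c = f
    rw [Algebra.algebraMap_eq_smul_one]
    refine ext' fun ρ => ?_
    rw [smul_apply, one_def]
    by_cases hρ : ρ = 1
    · subst hρ
      simp [single, Algebra.smul_def, hc]
    · simp [single, hρ, h0 ρ hρ]

instance : IsSimpleRing (CrossedProduct hd) := by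
  classical
  refine .of_eq_bot_or_eq_top fun I => ?_
  rw [or_iff_not_imp_left]
  intro hI
  let supp (f : CrossedProduct hd) : Finset (K ≃ₐ[k] K) := Finset.univ.filter fun σ => f.coeff σ ≠ 0
  have hex : ∃ n, ∃ x ∈ I, x ≠ 0 ∧ (supp x).card = n := by
    obtain ⟨x, hx, hx0⟩ := SetLike.exists_of_lt (bot_lt_iff_ne_bot.mpr hI : ⊥ < I)
    exact ⟨_, x, hx, hx0, rfl⟩
  obtain ⟨f, hf, hf0, hcard⟩ := Nat.find_spec hex
  have hmin : ∀ y ∈ I, supp y ⊂ supp f → y = 0 := by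
    intro y hy hss
    by_contra hy0
    exact Nat.find_min hex (hcard ▸ Finset.card_lt_card hss) ⟨y, hy, hy0, rfl⟩
  obtain ⟨σ, hσ⟩ : ∃ σ, f.coeff σ ≠ 0 := by
    by_contra! h
    exact hf0 (ext' h)
  have h0 : ∀ ρ ≠ σ, f.coeff ρ = 0 := by
    intro ρ hρ
    obtain ⟨b, hb⟩ : ∃ b, ρ b ≠ σ b := by
      by_contra! h
      exact hρ (AlgEquiv.ext h)
    have hz := hmin (f * ofField hd b - ofField hd (σ b) * f)
      (I.sub_mem (I.mul_mem_right _ _ hf) (I.mul_mem_left _ _ hf)) (by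
        rw [Finset.ssubset_iff_of_subset]
        · refine ⟨σ, by simpa [supp] using hσ, ?_⟩
          simp [supp, mul_ofField_apply, ofField_mul_apply, mul_comm]
        · intro τ hτ
          simp only [supp, Finset.mem_filter, Finset.mem_univ, true_and] at hτ ⊢
          intro h
          apply hτ
          simp [mul_ofField_apply, ofField_mul_apply, h])
    have := congrFun (congrArg coeff hz) ρ
    rw [sub_apply, mul_ofField_apply, ofField_mul_apply, mul_comm, ← sub_mul] at this
    exact (mul_eq_zero.1 this).resolve_left (sub_ne_zero.2 hb)
  have hfs : f = single hd σ (f.coeff σ) := by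
    refine ext' fun τ => ?_
    by_cases h : τ = σ
    · subst h
      simp [single]
    · simp [single, h, h0 τ h]
  rw [← I.one_mem_iff]
  have := I.mul_mem_right _ (single hd σ⁻¹
    (σ⁻¹ ((f.coeff σ)⁻¹ * (d (σ, σ⁻¹) : K)⁻¹ * (d (1, 1) : K)⁻¹))) hf
  rw [hfs, single_mul_single] at this
  convert this using 1
  rw [one_def, mul_inv_cancel, ← AlgEquiv.mul_apply, mul_inv_cancel, AlgEquiv.one_apply]
  congr 1
  have h1 : (single hd σ (f.coeff σ)).coeff σ ≠ 0 := by simpa [single] using hσ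
  field_simp
  simp [single]

open Classical in
/-- The matrix of left multiplication with respect to the right `K`-basis `(x_σ)`. -/
noncomputable def toMatrix (hd : groupCohomology.IsMulCocycle₂ d) :
    CrossedProduct hd →ₐ[k] Matrix (K ≃ₐ[k] K) (K ≃ₐ[k] K) K :=
  AlgHom.ofLinearMap
    { toFun := fun f => Matrix.of fun τ ρ => τ⁻¹ (f.coeff (τ * ρ⁻¹) * d (τ * ρ⁻¹, ρ))
      map_add' := fun f g => by
        ext τ ρ
        simp [add_mul]
      map_smul' := fun c f => by
        ext τ ρ
        simp }
    (by
      ext τ ρ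
      by_cases h : τ = ρ
      · subst h
        simp [one_def, single, map_one_fst hd τ]
      · have : τ * ρ⁻¹ ≠ 1 := fun h' => h (mul_inv_eq_one.1 h')
        simp [one_def, single, this, h])
    (fun f g => by
      ext τ ρ
      simp only [LinearMap.coe_mk, AddHom.coe_mk, Matrix.of_apply, Matrix.mul_apply, mul_apply,
        Finset.sum_mul, map_sum]
      refine Fintype.sum_equiv ((Equiv.inv _).trans (Equiv.mulRight τ)) _ _ fun σ => ?_
      have h1 := cocycle hd σ (σ⁻¹ * (τ * ρ⁻¹)) ρ
      have h2 : τ * (σ⁻¹ * τ)⁻¹ = σ := by group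
      have h3 : σ⁻¹ * (τ * ρ⁻¹) * ρ = σ⁻¹ * τ := by group
      have h4 : σ⁻¹ * τ * ρ⁻¹ = σ⁻¹ * (τ * ρ⁻¹) := by group
      have h5 : (σ⁻¹ * τ)⁻¹ = τ⁻¹ * σ := by group
      rw [h3, mul_inv_cancel_left] at h1
      simp only [Equiv.trans_apply, Equiv.inv_apply, Equiv.coe_mulRight, h2, h4]
      rw [h5, AlgEquiv.mul_apply, ← map_mul]
      congr 1
      rw [map_mul]
      linear_combination (f.coeff σ * σ (g.coeff (σ⁻¹ * (τ * ρ⁻¹)))) * h1)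

variable [IsGalois k K]

/-- A crossed product of `K/k` is split by `K`. -/
lemma brauerClass_mem_relBr (hd : groupCohomology.IsMulCocycle₂ d) :
    brauerClass k (CrossedProduct hd) ∈ relBr k K := by
  classical
  let φ : K ⊗[k] CrossedProduct hd →ₐ[K] Matrix (K ≃ₐ[k] K) (K ≃ₐ[k] K) K :=
    Algebra.TensorProduct.lift (Algebra.ofId K _) (toMatrix hd)
      (fun a _ => Algebra.commutes a _)
  have hinj : Function.Injective φ := φ.toRingHom.injective
  have hdim : Module.finrank K (K ⊗[k] CrossedProduct hd) =
      Module.finrank K (Matrix (K ≃ₐ[k] K) (K ≃ₐ[k] K) K) := by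
    have h : Module.finrank k (CrossedProduct hd) =
        Module.finrank k ((K ≃ₐ[k] K) → K) := (coeffLinearEquiv hd).finrank_eq
    rw [Module.finrank_baseChange, Module.finrank_matrix, h, Module.finrank_pi_fintype,
      Finset.sum_const, Finset.card_univ, ← Nat.card_eq_fintype_card,
      IsGalois.card_aut_eq_finrank, Module.finrank_self, smul_eq_mul, mul_one]
  have hbij : Function.Bijective φ :=
    ⟨hinj, (φ.toLinearMap.injective_iff_surjective_of_finrank_eq_finrank hdim).1 hinj⟩
  exact Quotient.sound (s := Brauer.CSA_Setoid K)
    (brauerEquivalent_one_of_matrix (AlgEquiv.ofBijective φ hbij))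

/-- The class of the crossed product `(K/k, G, d)` in `Br(K/k) / Dec(K/k)`. -/
noncomputable def classModDec (hd : groupCohomology.IsMulCocycle₂ d) : RelBrModDec k K :=
  QuotientGroup.mk ⟨brauerClass k (CrossedProduct hd), brauerClass_mem_relBr hd⟩

end CrossedProduct

end CrossedProduct

end BrauerTheory

/-! ### Graded division rings -/

namespace GradedDivision

variable {Γ : Type v} [AddCommGroup Γ] [LinearOrder Γ]

/-- A graded division ring: a nonzero graded ring in which every nonzero homogeneous element is
invertible. If the ring is commutative, this is a graded field. -/
class IsGradedDivisionRing {A : Type*} [Ring A] (𝒜 : Γ → AddSubgroup A) [GradedRing 𝒜] : Prop where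
  one_ne_zero : (1 : A) ≠ 0
  isUnit_of_mem : ∀ (γ : Γ) (a : A), a ∈ 𝒜 γ → a ≠ 0 → IsUnit a

section Ring

variable {A : Type*} [Ring A] (𝒜 : Γ → AddSubgroup A) [GradedRing 𝒜]

lemma inv_mem {γ : Γ} (u : Aˣ) (hu : (u : A) ∈ 𝒜 γ) : ((u⁻¹ : Aˣ) : A) ∈ 𝒜 (-γ) := by
  have h := DirectSum.coe_decompose_mul_add_of_left_mem 𝒜 (j := -γ) (b := ((u⁻¹ : Aˣ) : A)) hu
  rw [Units.mul_inv, add_neg_cancel,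
    DirectSum.decompose_of_mem_same 𝒜 (SetLike.one_mem_graded 𝒜)] at h
  have h2 : ((u⁻¹ : Aˣ) : A) = DirectSum.decompose 𝒜 ((u⁻¹ : Aˣ) : A) (-γ) :=
    Units.inv_eq_of_mul_eq_one_right h.symm
  rw [h2]
  exact SetLike.coe_mem _

variable [IsGradedDivisionRing 𝒜]

/-- The support `Γ_A = {γ | A_γ ≠ 0}`, a subgroup of `Γ`. -/
def gradeGroup : AddSubgroup Γ where
  carrier := {γ | ∃ u : Aˣ, (u : A) ∈ 𝒜 γ}
  zero_mem' := ⟨1, SetLike.one_mem_graded 𝒜⟩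
  add_mem' := by
    rintro γ γ' ⟨u, hu⟩ ⟨v, hv⟩
    exact ⟨u * v, SetLike.mul_mem_graded hu hv⟩
  neg_mem' := by
    rintro γ ⟨u, hu⟩
    exact ⟨u⁻¹, inv_mem 𝒜 u hu⟩

lemma nontrivial_of_isGradedDivisionRing {A : Type*} [Ring A] (𝒜 : Γ → AddSubgroup A)
    [GradedRing 𝒜] [IsGradedDivisionRing 𝒜] : Nontrivial A :=
  ⟨1, 0, IsGradedDivisionRing.one_ne_zero 𝒜⟩

lemma mem_gradeGroup_iff (γ : Γ) : γ ∈ gradeGroup 𝒜 ↔ 𝒜 γ ≠ ⊥ := by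
  have := nontrivial_of_isGradedDivisionRing 𝒜
  rw [AddSubgroup.ne_bot_iff_exists_ne_zero]
  constructor
  · rintro ⟨u, hu⟩
    exact ⟨⟨u, hu⟩, fun h => u.ne_zero (congrArg Subtype.val h)⟩
  · rintro ⟨⟨a, ha⟩, h⟩
    obtain ⟨u, rfl⟩ := IsGradedDivisionRing.isUnit_of_mem γ a ha (fun h0 => h (Subtype.ext h0))
    exact ⟨u, ha⟩

open Classical in
/-- The component of degree `0` of a graded division ring, if commutative, is a field. -/
noncomputable instance fieldGradeZero [IsMulCommutative (𝒜 0)] : Field (𝒜 0) where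
  __ := SetLike.GradeZero.instRing 𝒜
  mul_comm a b := mul_comm' a b
  inv a := if h : a = 0 then 0 else
    ⟨((IsGradedDivisionRing.isUnit_of_mem 0 (a : A) a.2 (fun h0 => h (Subtype.ext h0))).unit⁻¹ :
      Aˣ), by simpa using inv_mem 𝒜 (γ := 0) _ a.2⟩
  exists_pair_ne := ⟨1, 0, fun h =>
    IsGradedDivisionRing.one_ne_zero 𝒜 (congrArg Subtype.val h)⟩
  mul_inv_cancel a ha := by
    rw [dif_neg ha]
    exact Subtype.ext (IsUnit.mul_val_inv
      (IsGradedDivisionRing.isUnit_of_mem 0 (a : A) a.2 (fun h0 => ha (Subtype.ext h0))))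
  inv_zero := dif_pos rfl
  nnqsmul := _
  qsmul := _

end Ring

section Algebra

variable {F D : Type u} [CommRing F] [Ring D] [Algebra F D]
variable (ℱ : Γ → AddSubgroup F) (𝒟 : Γ → AddSubgroup D) [GradedRing ℱ] [GradedRing 𝒟]

/-- `D` is a graded algebra over the graded ring `F`: the structure map preserves degrees. -/
class IsGradedAlgebra : Prop where
  algebraMap_mem : ∀ (γ : Γ) (a : F), a ∈ ℱ γ → algebraMap F D a ∈ 𝒟 γ

section

variable [IsGradedAlgebra ℱ 𝒟]

lemma decompose_algebraMap (a : F) (γ : Γ) :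
    (DirectSum.decompose 𝒟 (algebraMap F D a) γ : D) =
      algebraMap F D (DirectSum.decompose ℱ a γ) := by
  induction a using DirectSum.Decomposition.inductionOn ℱ with
  | zero => simp
  | @homogeneous i m =>
    have hm := IsGradedAlgebra.algebraMap_mem (𝒟 := 𝒟) i (m : F) m.2
    by_cases h : i = γ
    · subst h
      rw [DirectSum.decompose_of_mem_same 𝒟 hm, DirectSum.decompose_of_mem_same ℱ m.2]
    · rw [DirectSum.decompose_of_mem_ne 𝒟 hm h, DirectSum.decompose_of_mem_ne ℱ m.2 h, map_zero]
  | add a b ha hb => simp [DirectSum.decompose_add, ha, hb]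

lemma unitsMap_mem {γ : Γ} (u : Fˣ) (hu : (u : F) ∈ ℱ γ) :
    ((Units.map (algebraMap F D).toMonoidHom u : Dˣ) : D) ∈ 𝒟 γ :=
  IsGradedAlgebra.algebraMap_mem γ (u : F) hu

lemma gradeGroup_le : gradeGroup ℱ ≤ gradeGroup 𝒟 := by
  rintro γ ⟨u, hu⟩
  exact ⟨Units.map (algebraMap F D).toMonoidHom u, unitsMap_mem ℱ 𝒟 u hu⟩

lemma algebraMap_injective [IsGradedDivisionRing ℱ] [IsGradedDivisionRing 𝒟] :
    Function.Injective (algebraMap F D) := by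
  have := nontrivial_of_isGradedDivisionRing 𝒟
  rw [injective_iff_map_eq_zero]
  intro a ha
  by_contra hne
  obtain ⟨γ, hγ⟩ : ∃ γ, (DirectSum.decompose ℱ a γ : F) ≠ 0 := by
    by_contra! h
    apply hne
    apply (DirectSum.decompose ℱ).injective
    rw [DirectSum.decompose_zero]
    exact DFinsupp.ext fun γ => Subtype.ext (h γ)
  have hu := (IsGradedDivisionRing.isUnit_of_mem γ _ (SetLike.coe_mem _) hγ).map (algebraMap F D)
  rw [← decompose_algebraMap ℱ 𝒟, ha] at hu
  simp at hu

end

variable [IsGradedDivisionRing 𝒟] [IsMulCommutative (𝒟 0)] [IsGradedAlgebra ℱ 𝒟]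

/-- The map `F₀ → D₀`. -/
noncomputable instance algebraGradeZero : Algebra (ℱ 0) (𝒟 0) :=
  RingHom.toAlgebra
    { toFun := fun a => ⟨algebraMap F D a, IsGradedAlgebra.algebraMap_mem 0 (a : F) a.2⟩
      map_one' := Subtype.ext (map_one (algebraMap F D))
      map_mul' := fun a b => Subtype.ext (map_mul (algebraMap F D) (a : F) (b : F))
      map_zero' := Subtype.ext (map_zero (algebraMap F D))
      map_add' := fun a b => Subtype.ext (map_add (algebraMap F D) (a : F) (b : F)) }

lemma coe_algebraMap_zero (a : ℱ 0) :
    ((algebraMap (ℱ 0) (𝒟 0) a : 𝒟 0) : D) = algebraMap F D a := rfl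

/-- Conjugation `a ↦ u a u⁻¹` on `D₀` by a homogeneous invertible element `u`. -/
noncomputable def conj {γ : Γ} (u : Dˣ) (hu : (u : D) ∈ 𝒟 γ) : 𝒟 0 ≃ₐ[ℱ 0] 𝒟 0 where
  toFun a := ⟨u * a * (u⁻¹ : Dˣ), by
    simpa using SetLike.mul_mem_graded (SetLike.mul_mem_graded hu a.2) (inv_mem 𝒟 u hu)⟩
  invFun a := ⟨(u⁻¹ : Dˣ) * a * u, by
    simpa using SetLike.mul_mem_graded (SetLike.mul_mem_graded (inv_mem 𝒟 u hu) a.2) hu⟩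
  left_inv a := Subtype.ext (by simp [mul_assoc])
  right_inv a := Subtype.ext (by simp [mul_assoc])
  map_mul' a b := Subtype.ext (by
    change (u : D) * ((a : D) * b) * (u⁻¹ : Dˣ) =
      u * a * (u⁻¹ : Dˣ) * (u * b * (u⁻¹ : Dˣ))
    simp [mul_assoc])
  map_add' a b := Subtype.ext (by
    change (u : D) * ((a : D) + b) * (u⁻¹ : Dˣ) = u * a * (u⁻¹ : Dˣ) + u * b * (u⁻¹ : Dˣ)
    rw [mul_add, add_mul])
  commutes' a := Subtype.ext (by
    change (u : D) * (algebraMap F D a) * (u⁻¹ : Dˣ) = algebraMap F D a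
    rw [← Algebra.commutes, mul_assoc, Units.mul_inv, mul_one])

lemma coe_conj {γ : Γ} (u : Dˣ) (hu : (u : D) ∈ 𝒟 γ) (a : 𝒟 0) :
    ((conj ℱ 𝒟 u hu a : 𝒟 0) : D) = u * a * (u⁻¹ : Dˣ) := rfl

/-- The conjugation action on `D₀` depends only on the degree. -/
lemma conj_eq_conj {γ : Γ} (u v : Dˣ) (hu : (u : D) ∈ 𝒟 γ) (hv : (v : D) ∈ 𝒟 γ) :
    conj ℱ 𝒟 u hu = conj ℱ 𝒟 v hv := by
  ext a
  have hw : ((v⁻¹ * u : Dˣ) : D) ∈ 𝒟 0 := by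
    simpa using SetLike.mul_mem_graded (inv_mem 𝒟 v hv) hu
  have hc : ((v⁻¹ * u : Dˣ) : D) * a = a * ((v⁻¹ * u : Dˣ) : D) :=
    congrArg Subtype.val (mul_comm (⟨_, hw⟩ : 𝒟 0) a)
  rw [coe_conj, coe_conj, Units.mul_inv_eq_iff_eq_mul]
  have h2 := congrArg (fun t => (v : D) * t) hc
  simp only [Units.val_mul] at h2
  rw [← mul_assoc, ← mul_assoc, Units.mul_inv, one_mul] at h2
  rw [h2]
  simp only [mul_assoc]

/-- The homomorphism `θ_D : Γ_D → Gal(D₀/F₀)` given by conjugation. -/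
noncomputable def theta : gradeGroup 𝒟 →+ Additive (𝒟 0 ≃ₐ[ℱ 0] 𝒟 0) :=
  AddMonoidHom.mk' (fun γ => Additive.ofMul (conj ℱ 𝒟 γ.2.choose γ.2.choose_spec)) (by
    intro γ γ'
    rw [← ofMul_mul]
    congr 1
    rw [conj_eq_conj ℱ 𝒟 _ (γ.2.choose * γ'.2.choose) _
      (SetLike.mul_mem_graded γ.2.choose_spec γ'.2.choose_spec)]
    ext a
    rw [AlgEquiv.mul_apply, coe_conj, coe_conj, coe_conj]
    simp [mul_assoc])

lemma theta_eq_conj (γ : gradeGroup 𝒟) (u : Dˣ) (hu : (u : D) ∈ 𝒟 γ) :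
    theta ℱ 𝒟 γ = Additive.ofMul (conj ℱ 𝒟 u hu) :=
  congrArg Additive.ofMul (conj_eq_conj ℱ 𝒟 _ u _ hu)

lemma mem_range_of_conj_eq [Algebra.IsCentral F D] (a : 𝒟 0)
    (h : ∀ γ (u : Dˣ) (hu : (u : D) ∈ 𝒟 γ), conj ℱ 𝒟 u hu a = a) :
    ∃ c : ℱ 0, algebraMap (ℱ 0) (𝒟 0) c = a := by
  have hc : (a : D) ∈ Subalgebra.center F D := by
    rw [Subalgebra.mem_center_iff]
    intro b
    induction b using DirectSum.Decomposition.inductionOn 𝒟 with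
    | zero => simp
    | @homogeneous i m =>
      by_cases hm : (m : D) = 0
      · simp [hm]
      · obtain ⟨u, hu⟩ := IsGradedDivisionRing.isUnit_of_mem i (m : D) m.2 hm
        have h1 := congrArg Subtype.val (h i u (hu ▸ m.2))
        rw [coe_conj, Units.mul_inv_eq_iff_eq_mul, hu] at h1
        exact h1
    | add b c hb hc => rw [add_mul, mul_add, hb, hc]
  obtain ⟨f, hf⟩ := (Algebra.IsCentral.mem_center_iff F).1 hc
  refine ⟨DirectSum.decompose ℱ f 0, Subtype.ext ?_⟩
  rw [coe_algebraMap_zero, ← decompose_algebraMap ℱ 𝒟, ← hf]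
  exact DirectSum.decompose_of_mem_same 𝒟 a.2

variable [IsGradedDivisionRing ℱ]

/-- A semiramified graded division algebra `D` over `F`: its component `D₀` of degree `0` is a
field and `[D₀ : F₀] = |Γ_D / Γ_F| = deg(D)`, where `deg(D)² = [D : F]`. -/
class IsSemiramified : Prop where
  finrank_eq_relIndex :
    Module.finrank (ℱ 0) (𝒟 0) = (gradeGroup ℱ).relIndex (gradeGroup 𝒟)
  finrank_eq_sq : Module.finrank F D = Module.finrank (ℱ 0) (𝒟 0) ^ 2

lemma theta_eq_zero_of_mem (γ : gradeGroup 𝒟) (hγ : (γ : Γ) ∈ gradeGroup ℱ) :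
    theta ℱ 𝒟 γ = 0 := by
  obtain ⟨u, hu⟩ := hγ
  rw [theta_eq_conj ℱ 𝒟 γ (Units.map (algebraMap F D).toMonoidHom u)
    (unitsMap_mem ℱ 𝒟 u hu), ofMul_eq_zero]
  ext a
  rw [AlgEquiv.one_apply]
  rw [coe_conj, Units.mul_inv_eq_iff_eq_mul]
  exact Algebra.commutes (u : F) (a : D)

section Finite

variable [Module.Finite F D] [IsSemiramified ℱ 𝒟]

lemma finrank_pos : 0 < Module.finrank (ℱ 0) (𝒟 0) := by
  have := nontrivial_of_isGradedDivisionRing ℱ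
  have h : 0 < Module.finrank F D := by
    have hli : LinearIndependent F (fun _ : Unit => (1 : D)) := by
      rw [linearIndependent_iff']
      intro t g hg i hi
      have ht : t = {i} := by
        ext j
        simp [Subsingleton.elim j i, hi]
      rw [ht, Finset.sum_singleton, Algebra.smul_def, mul_one] at hg
      exact algebraMap_injective ℱ 𝒟 (hg.trans (map_zero _).symm)
    have := hli.fintype_card_le_finrank
    rw [Fintype.card_unit] at this
    exact this
  rw [IsSemiramified.finrank_eq_sq (ℱ := ℱ) (𝒟 := 𝒟)] at h
  exact Nat.pos_of_ne_zero fun h0 => by simp [h0] at h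

instance finiteDimensional_zero : FiniteDimensional (ℱ 0) (𝒟 0) :=
  FiniteDimensional.of_finrank_pos (finrank_pos ℱ 𝒟)

variable [Algebra.IsCentral F D]

instance isGalois_zero : IsGalois (ℱ 0) (𝒟 0) := by
  apply IsGalois.of_fixedField_eq_bot
  rw [eq_bot_iff]
  intro a ha
  rw [IntermediateField.mem_fixedField_iff] at ha
  obtain ⟨c, hc⟩ := mem_range_of_conj_eq ℱ 𝒟 a fun γ u hu => ha _ (Subgroup.mem_top _)
  exact IntermediateField.mem_bot.2 ⟨c, hc⟩

lemma theta_surjective : Function.Surjective (theta ℱ 𝒟) := by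
  let H : Subgroup (𝒟 0 ≃ₐ[ℱ 0] 𝒟 0) := AddSubgroup.toSubgroup' (theta ℱ 𝒟).range
  have hH : IntermediateField.fixedField H = ⊥ := by
    rw [eq_bot_iff]
    intro a ha
    rw [IntermediateField.mem_fixedField_iff] at ha
    obtain ⟨c, hc⟩ := mem_range_of_conj_eq ℱ 𝒟 a fun γ u hu =>
      ha _ ⟨⟨γ, u, hu⟩, theta_eq_conj ℱ 𝒟 ⟨γ, u, hu⟩ u hu⟩
    exact IntermediateField.mem_bot.2 ⟨c, hc⟩
  have hT : H = ⊤ := by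
    rw [← IntermediateField.fixingSubgroup_fixedField H, hH,
      IntermediateField.fixingSubgroup_bot]
  intro σ
  have : σ.toMul ∈ H := hT ▸ Subgroup.mem_top _
  exact this

lemma theta_eq_zero_iff (γ : gradeGroup 𝒟) : theta ℱ 𝒟 γ = 0 ↔ (γ : Γ) ∈ gradeGroup ℱ := by
  refine ⟨fun h => ?_, theta_eq_zero_of_mem ℱ 𝒟 γ⟩
  have hle : (gradeGroup ℱ).addSubgroupOf (gradeGroup 𝒟) ≤ (theta ℱ 𝒟).ker :=
    fun γ hγ => theta_eq_zero_of_mem ℱ 𝒟 γ hγ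
  have h1 : (theta ℱ 𝒟).ker.index = Module.finrank (ℱ 0) (𝒟 0) := by
    rw [AddSubgroup.index_ker, AddMonoidHom.range_eq_top.2 (theta_surjective ℱ 𝒟),
      ← IsGalois.card_aut_eq_finrank]
    exact Nat.card_congr (AddSubgroup.topEquiv.toEquiv.trans Additive.toMul)
  have h2 : ((gradeGroup ℱ).addSubgroupOf (gradeGroup 𝒟)).index =
      Module.finrank (ℱ 0) (𝒟 0) := IsSemiramified.finrank_eq_relIndex.symm
  have h3 := AddSubgroup.relIndex_mul_index hle
  rw [h1, h2] at h3
  have h4 := Nat.eq_of_mul_eq_mul_right (finrank_pos ℱ 𝒟) (h3.trans (one_mul _).symm)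
  rw [AddSubgroup.relIndex_eq_one] at h4
  exact h4 h

end Finite

/-- The choices that define the cocycle of a semiramified graded division algebra: a basis
`(δᵢ + Γ_F)ᵢ` of the finite abelian group `Γ_D / Γ_F`, homogeneous units `zᵢ ∈ D*` of degree `δᵢ`,
and homogeneous units `xᵢ ∈ F*` of degree `qᵢ δᵢ`, where `qᵢ` is the order of `δᵢ + Γ_F`. -/
structure CocycleData where
  /-- The number of elements of the basis. -/
  r : ℕ
  /-- Representatives of the elements of the basis. -/
  δ : Fin r → Γ
  /-- The units `zᵢ` of `D`. -/
  z : Fin r → Dˣ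
  /-- The units `xᵢ` of `F`. -/
  x : Fin r → Fˣ
  z_mem : ∀ i, (z i : D) ∈ 𝒟 (δ i)
  x_mem : ∀ i, (x i : F) ∈ ℱ (addOrderOf (δ i : Γ ⧸ gradeGroup ℱ) • δ i)
  /-- Every class of `Γ_D / Γ_F` is `∑ mᵢ (δᵢ + Γ_F)` for unique `0 ≤ mᵢ < qᵢ`. -/
  basis : ∀ γ ∈ gradeGroup 𝒟, ∃! m : (i : Fin r) → Fin (addOrderOf (δ i : Γ ⧸ gradeGroup ℱ)),
    (γ : Γ ⧸ gradeGroup ℱ) = ∑ i, (m i : ℕ) • (δ i : Γ ⧸ gradeGroup ℱ)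

lemma cocycle_aux {G : Type*} [Group G] {a b c e s t r u v w : G} (ha : ∀ g, a * g = g * a)
    (hc : ∀ g, c * g = g * c) (h : a * b = c * e) :
    s * t * u⁻¹ * a⁻¹ * (u * r * v⁻¹ * b⁻¹) =
      s * (t * r * w⁻¹ * c⁻¹) * s⁻¹ * (s * w * v⁻¹ * e⁻¹) := by
  have ha' : ∀ g, a⁻¹ * g = g * a⁻¹ := fun g => by
    rw [inv_mul_eq_iff_eq_mul, ← mul_assoc, ha, mul_inv_cancel_right]
  have hc' : ∀ g, c⁻¹ * g = g * c⁻¹ := fun g => by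
    rw [inv_mul_eq_iff_eq_mul, ← mul_assoc, hc, mul_inv_cancel_right]
  have h' : a⁻¹ * b⁻¹ = c⁻¹ * e⁻¹ := by
    rw [ha', hc', ← mul_inv_rev, ← mul_inv_rev, h]
  calc s * t * u⁻¹ * a⁻¹ * (u * r * v⁻¹ * b⁻¹)
      = s * t * u⁻¹ * (a⁻¹ * (u * r * v⁻¹)) * b⁻¹ := by group
    _ = s * t * r * v⁻¹ * (a⁻¹ * b⁻¹) := by
      rw [ha']
      group
    _ = s * t * r * w⁻¹ * (w * v⁻¹ * c⁻¹) * e⁻¹ := by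
      rw [h']
      group
    _ = s * (t * r * w⁻¹ * c⁻¹) * s⁻¹ * (s * w * v⁻¹ * e⁻¹) := by
      rw [← hc']
      group

namespace CocycleData

variable {ℱ 𝒟}

section

variable (S : CocycleData ℱ 𝒟)

/-- The order `qᵢ` of `δᵢ + Γ_F`. -/
noncomputable def q (i : Fin S.r) : ℕ := addOrderOf (S.δ i : Γ ⧸ gradeGroup ℱ)

/-- The product `z^m = z₁^{m₁} ⋯ z_r^{m_r}`, in this order. -/
def zPow (m : Fin S.r → ℕ) : Dˣ := (List.ofFn fun i => S.z i ^ m i).prod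

lemma zPow_mem (m : Fin S.r → ℕ) : (S.zPow m : D) ∈ 𝒟 (∑ i, m i • S.δ i) := by
  have h := SetLike.list_prod_ofFn_mem_graded (A := 𝒟) (fun i => m i • S.δ i)
    (fun i => (S.z i : D) ^ m i) (fun i => SetLike.pow_mem_graded _ (S.z_mem i))
  rw [List.sum_ofFn] at h
  convert h using 1
  rw [zPow, ← Units.coeHom_apply, map_list_prod, List.map_ofFn]
  congr 2

end

variable [Module.Finite F D] [IsSemiramified ℱ 𝒟] [Algebra.IsCentral F D] (S : CocycleData ℱ 𝒟)

lemma exists_exponents (σ : 𝒟 0 ≃ₐ[ℱ 0] 𝒟 0) :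
    ∃ m : (i : Fin S.r) → Fin (S.q i),
      conj ℱ 𝒟 (S.zPow fun i => m i) (S.zPow_mem _) = σ := by
  obtain ⟨γ, hγ⟩ := theta_surjective ℱ 𝒟 (Additive.ofMul σ)
  obtain ⟨m, hm, -⟩ := S.basis γ γ.2
  refine ⟨m, ?_⟩
  have hmem : ∑ i, (m i : ℕ) • S.δ i ∈ gradeGroup 𝒟 := ⟨_, S.zPow_mem fun i => m i⟩
  have h0 : theta ℱ 𝒟 (-⟨_, hmem⟩ + γ) = 0 := by
    rw [theta_eq_zero_iff]
    refine QuotientAddGroup.eq.1 ?_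
    rw [hm]
    simp
  rw [map_add, map_neg, neg_add_eq_zero, hγ,
    theta_eq_conj ℱ 𝒟 ⟨_, hmem⟩ _ (S.zPow_mem fun i => m i)] at h0
  exact Additive.ofMul.injective h0

/-- The exponents `m(σ)`: the tuple `0 ≤ mᵢ < qᵢ` such that `∑ mᵢ (δᵢ + Γ_F)` corresponds to
`σ ∈ Gal(D₀/F₀)` under the isomorphism `Γ_D / Γ_F ≃ Gal(D₀/F₀)`; that is, conjugation by `z^{m(σ)}`
induces `σ` on `D₀`. -/
noncomputable def exponents (σ : 𝒟 0 ≃ₐ[ℱ 0] 𝒟 0) (i : Fin S.r) : ℕ :=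
  (S.exists_exponents σ).choose i

lemma exponents_lt (σ : 𝒟 0 ≃ₐ[ℱ 0] 𝒟 0) (i : Fin S.r) : S.exponents σ i < S.q i :=
  ((S.exists_exponents σ).choose i).2

lemma conj_exponents (σ : 𝒟 0 ≃ₐ[ℱ 0] 𝒟 0) :
    conj ℱ 𝒟 (S.zPow (S.exponents σ)) (S.zPow_mem _) = σ :=
  (S.exists_exponents σ).choose_spec

/-- The exponents `tᵢ(σ, τ)` with `mᵢ(σ) + mᵢ(τ) = mᵢ(στ) + tᵢ(σ, τ) qᵢ`. -/
noncomputable def carry (σ τ : 𝒟 0 ≃ₐ[ℱ 0] 𝒟 0) (i : Fin S.r) : ℕ :=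
  (S.exponents σ i + S.exponents τ i) / S.q i

lemma exponents_mul (σ τ : 𝒟 0 ≃ₐ[ℱ 0] 𝒟 0) (i : Fin S.r) :
    S.exponents σ i + S.exponents τ i = S.exponents (σ * τ) i + S.carry σ τ i * S.q i := by
  have hq : ∀ i, 0 < S.q i := fun i => (Nat.zero_le _).trans_lt (S.exponents_lt σ i)
  have hmem : ∀ ρ, ∑ i, S.exponents ρ i • S.δ i ∈ gradeGroup 𝒟 :=
    fun ρ => ⟨_, S.zPow_mem (S.exponents ρ)⟩
  have hθ : ∀ ρ, theta ℱ 𝒟 ⟨_, hmem ρ⟩ = Additive.ofMul ρ := fun ρ => by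
    rw [theta_eq_conj ℱ 𝒟 ⟨_, hmem ρ⟩ _ (S.zPow_mem _), S.conj_exponents]
  have h0 : theta ℱ 𝒟 (-⟨_, hmem (σ * τ)⟩ + (⟨_, hmem σ⟩ + ⟨_, hmem τ⟩)) = 0 := by
    rw [map_add, map_neg, map_add, hθ, hθ, hθ, ofMul_mul, neg_add_cancel]
  rw [theta_eq_zero_iff] at h0
  have h1 := QuotientAddGroup.eq.2 h0
  have h2 : ((∑ i, S.exponents (σ * τ) i • S.δ i : Γ) : Γ ⧸ gradeGroup ℱ) =
      ∑ i, ((S.exponents σ i + S.exponents τ i) % S.q i) • (S.δ i : Γ ⧸ gradeGroup ℱ) := by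
    refine h1.trans ?_
    change ((∑ i, S.exponents σ i • S.δ i + ∑ i, S.exponents τ i • S.δ i : Γ) :
      Γ ⧸ gradeGroup ℱ) = _
    rw [QuotientAddGroup.mk_add, QuotientAddGroup.mk_sum, QuotientAddGroup.mk_sum,
      ← Finset.sum_add_distrib]
    refine Finset.sum_congr rfl fun i _ => ?_
    rw [q, mod_addOrderOf_nsmul, add_nsmul]
    rfl
  obtain ⟨m, -, huniq⟩ := S.basis _ (hmem (σ * τ))
  have e1 := huniq (fun i => ⟨S.exponents (σ * τ) i, S.exponents_lt _ i⟩) (by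
    rw [QuotientAddGroup.mk_sum]
    rfl)
  have e2 := huniq (fun i => ⟨(S.exponents σ i + S.exponents τ i) % S.q i, Nat.mod_lt _ (hq i)⟩) h2
  have e3 : S.exponents (σ * τ) i = (S.exponents σ i + S.exponents τ i) % S.q i :=
    congrArg Fin.val (congrFun (e1.trans e2.symm) i)
  rw [e3, carry, mul_comm, Nat.mod_add_div]

/-- The cocycle `h(σ, τ) = ∏ xᵢ^{tᵢ(σ, τ)}` with values in `F*`. -/
noncomputable def hCocycle (σ τ : 𝒟 0 ≃ₐ[ℱ 0] 𝒟 0) : Fˣ := ∏ i, S.x i ^ S.carry σ τ i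

lemma hCocycle_mem (σ τ : 𝒟 0 ≃ₐ[ℱ 0] 𝒟 0) :
    (S.hCocycle σ τ : F) ∈ ℱ (∑ i, (S.carry σ τ i * S.q i) • S.δ i) := by
  have h := SetLike.prod_mem_graded (A := ℱ) (fun i => (S.carry σ τ i * S.q i) • S.δ i)
    (fun i => (S.x i : F) ^ S.carry σ τ i) (F := Finset.univ) (fun i _ => by
      rw [mul_nsmul']
      exact SetLike.pow_mem_graded _ (S.x_mem i))
  convert h using 1
  simp [hCocycle]

/-- The element `z^{m(σ)} z^{m(τ)} (z^{m(στ)})⁻¹ h(σ, τ)⁻¹` of `D*`. -/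
noncomputable def dUnit (σ τ : 𝒟 0 ≃ₐ[ℱ 0] 𝒟 0) : Dˣ :=
  S.zPow (S.exponents σ) * S.zPow (S.exponents τ) * (S.zPow (S.exponents (σ * τ)))⁻¹ *
    (Units.map (algebraMap F D).toMonoidHom (S.hCocycle σ τ))⁻¹

lemma dUnit_mem (σ τ : 𝒟 0 ≃ₐ[ℱ 0] 𝒟 0) : (S.dUnit σ τ : D) ∈ 𝒟 0 := by
  have h := SetLike.mul_mem_graded (SetLike.mul_mem_graded
    (SetLike.mul_mem_graded (S.zPow_mem (S.exponents σ)) (S.zPow_mem (S.exponents τ)))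
    (inv_mem 𝒟 _ (S.zPow_mem (S.exponents (σ * τ)))))
    (inv_mem 𝒟 _ (unitsMap_mem ℱ 𝒟 _ (S.hCocycle_mem σ τ)))
  have h0 : ∑ i, S.exponents σ i • S.δ i + ∑ i, S.exponents τ i • S.δ i =
      ∑ i, S.exponents (σ * τ) i • S.δ i + ∑ i, (S.carry σ τ i * S.q i) • S.δ i := by
    rw [← Finset.sum_add_distrib, ← Finset.sum_add_distrib]
    exact Finset.sum_congr rfl fun i _ => by rw [← add_nsmul, S.exponents_mul σ τ, add_nsmul]
  have h1 : ∑ i, S.exponents σ i • S.δ i + ∑ i, S.exponents τ i • S.δ i +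
      -∑ i, S.exponents (σ * τ) i • S.δ i + -∑ i, (S.carry σ τ i * S.q i) • S.δ i = 0 := by
    rw [h0]
    abel
  rw [h1] at h
  exact h

/-- The cocycle `d : G × G → D₀*`, `d(σ, τ) = z^{m(σ)} z^{m(τ)} (z^{m(στ)})⁻¹ h(σ, τ)⁻¹`, where
`G = Gal(D₀/F₀)`. -/
noncomputable def d (στ : (𝒟 0 ≃ₐ[ℱ 0] 𝒟 0) × (𝒟 0 ≃ₐ[ℱ 0] 𝒟 0)) : (𝒟 0)ˣ :=
  Units.mk0 ⟨S.dUnit στ.1 στ.2, S.dUnit_mem στ.1 στ.2⟩ (fun h0 => by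
    have := nontrivial_of_isGradedDivisionRing 𝒟
    exact (S.dUnit στ.1 στ.2).ne_zero (congrArg Subtype.val h0))

lemma coe_d (σ τ : 𝒟 0 ≃ₐ[ℱ 0] 𝒟 0) : (((S.d (σ, τ) : (𝒟 0)ˣ) : 𝒟 0) : D) = S.dUnit σ τ := rfl

lemma hCocycle_cocycle (σ τ ρ : 𝒟 0 ≃ₐ[ℱ 0] 𝒟 0) :
    S.hCocycle σ τ * S.hCocycle (σ * τ) ρ = S.hCocycle τ ρ * S.hCocycle σ (τ * ρ) := by
  simp only [hCocycle, ← Finset.prod_mul_distrib, ← pow_add]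
  refine Finset.prod_congr rfl fun i _ => ?_
  congr 1
  have hq : 0 < S.q i := (Nat.zero_le _).trans_lt (S.exponents_lt σ i)
  have h1 := S.exponents_mul σ τ i
  have h2 := S.exponents_mul (σ * τ) ρ i
  have h3 := S.exponents_mul τ ρ i
  have h4 := S.exponents_mul σ (τ * ρ) i
  rw [mul_assoc] at h2
  refine Nat.eq_of_mul_eq_mul_right hq ?_
  rw [add_mul, add_mul]
  omega

/-- `d` is a 2-cocycle. -/
theorem isMulCocycle : groupCohomology.IsMulCocycle₂ S.d := by
  intro σ τ ρ
  refine Units.ext ?_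
  rw [mul_comm]
  refine Subtype.ext ?_
  change (S.dUnit σ τ : D) * S.dUnit (σ * τ) ρ = ((σ (S.d (τ, ρ) : 𝒟 0) : 𝒟 0) : D) *
    S.dUnit σ (τ * ρ)
  have hσ : ((σ (S.d (τ, ρ) : 𝒟 0) : 𝒟 0) : D) =
      S.zPow (S.exponents σ) * S.dUnit τ ρ * ((S.zPow (S.exponents σ))⁻¹ : Dˣ) := by
    conv_lhs => rw [← S.conj_exponents σ]
    rfl
  rw [hσ]
  rw [← Units.val_mul, ← Units.val_mul, ← Units.val_mul, ← Units.val_mul]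
  refine congrArg Units.val ?_
  have hc : ∀ (c : Fˣ) (u : Dˣ), Units.map (algebraMap F D).toMonoidHom c * u =
      u * Units.map (algebraMap F D).toMonoidHom c :=
    fun c u => Units.ext (Algebra.commutes (c : F) (u : D))
  have hh := congrArg (Units.map (algebraMap F D).toMonoidHom) (S.hCocycle_cocycle σ τ ρ)
  rw [map_mul, map_mul] at hh
  unfold dUnit
  rw [← mul_assoc σ τ ρ]
  exact cocycle_aux (hc _) (hc _) hh

/-- The class of the crossed product algebra `(D₀/F₀, G, d)` in `Br(D₀/F₀) / Dec(D₀/F₀)`. -/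
noncomputable def crossedProductClass : BrauerTheory.RelBrModDec (ℱ 0) (𝒟 0) :=
  BrauerTheory.CrossedProduct.classModDec S.isMulCocycle

end CocycleData

end Algebra

/-! ### Elementary abelian graded crossed products -/

/-- A group is elementary abelian: abelian and killed by some prime number. -/
def IsElementaryAbelian (G : Type*) [Group G] : Prop :=
  (∀ a b : G, a * b = b * a) ∧ ∃ q : ℕ, q.Prime ∧ ∀ a : G, a ^ q = 1

/-- A Galois extension of fields whose Galois group is elementary abelian. -/
def IsElementaryAbelianExtension (k K : Type*) [Field k] [Field K] [Algebra k K] : Prop :=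
  IsGalois k K ∧ IsElementaryAbelian (K ≃ₐ[k] K)

/-- An extension `S / R` of commutative domains (here: of graded fields) whose extension of
fraction fields `Frac(S) / Frac(R)` is Galois with elementary abelian Galois group. -/
def IsFracElementaryAbelian (R S : Type u) [CommRing R] [CommRing S] [Algebra R S] : Prop :=
  ∃ (E L : Type u) (_ : Field E) (_ : Field L) (_ : Algebra R E) (_ : Algebra S L)
    (_ : Algebra R L) (_ : Algebra E L),
    IsFractionRing R E ∧ IsFractionRing S L ∧ IsScalarTower R S L ∧ IsScalarTower R E L ∧
      IsElementaryAbelianExtension E L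

section CrossedProduct

variable {F D : Type u} [CommRing F] [Ring D] [Algebra F D]
variable (𝒟 : Γ → AddSubgroup D) [GradedRing 𝒟]

/-- A graded subfield of `D` containing `F`: a commutative homogeneous subalgebra that contains
the inverses of its nonzero homogeneous elements. -/
structure IsGradedSubfield (K : Subalgebra F D) : Prop where
  decompose_mem : ∀ a ∈ K, ∀ γ, (DirectSum.decompose 𝒟 a γ : D) ∈ K
  isMulCommutative : IsMulCommutative K
  inv_mem : ∀ a ∈ K, ∀ γ, a ∈ 𝒟 γ → a ≠ 0 → ∃ b ∈ K, a * b = 1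

variable (F) in
open scoped IsMulCommutative in
/-- `D` is an elementary abelian graded crossed product over `F`: it has a maximal graded subfield
which is Galois over `F` with elementary abelian Galois group. -/
def IsElementaryAbelianGradedCrossedProduct : Prop :=
  ∃ K : Subalgebra F D, Maximal (IsGradedSubfield 𝒟) K ∧
    ∃ _ : IsMulCommutative K, IsFracElementaryAbelian F K

end CrossedProduct

/-- The subgroup `G^n` of an abelian group `G` generated by (and, `G` being abelian, consisting
of) the `n`-th powers of elements of `G`. -/
def powSubgroup (G : Type*) [Group G] (n : ℕ) : Subgroup G :=
  Subgroup.closure (Set.range fun a : G => a ^ n)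

end GradedDivision

/-! Write `k = F₀`, `K = D₀`, `G = Gal(K/k)`, and `H = Gal(K/M)` for a field `M` between them. The
theorem rests on a comparison: the homogeneous elements `a z^{m(σ)}` of `D` multiply like the
elements `a u_σ` of the crossed product, up to the central factors `h(σ, τ) ∈ F*`, which are
symmetric in `σ` and `τ` (`homog_mul_homog`, `hCocycle_comm`). Hence commutation, and the property
that a `p`-th power is a scalar, pass between the two algebras.

Brauer classes are handled through `Represents`: the Galois conjugates of a splitting `A → M_n(K)`
are intertwined by matrices that satisfy a cocycle relation up to scalars `c(σ, τ)`. Such functions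
multiply with the classes. A class is split by `M` exactly when its function is a coboundary on `H`:
one direction is Hilbert 90 for `GL_n`, the other holds because only scalars commute with a
splitting. Classes in `Dec(K/k)` are represented by symmetric functions with values in `k*`, since
this is so for cyclic extensions. Conversely, the carries of a `ℚ/ℤ`-valued character of `G`, used
as exponents of an element of `k*`, represent a class in `Dec(K/k)`.

From the Brauer condition to a crossed product: if the class of `d` comes from `Br(M/k)`, then on
`H` the cocycle `d` is cohomologous to a symmetric `f` with values in `k*`. The elements `y_σ = a_σ
z^{m(σ)}`, `σ ∈ H`, therefore commute and multiply up to factors in `F`; as `H` has exponent `p`,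
each `y_σ^p` lies in `F`. The centralizer of `M` and the `y_σ` turns out to be generated over `F` by
them, so it is a maximal graded subfield. By Kummer theory `M` is spanned by `p`-th roots of
elements of `k`, so the whole subfield is generated by `p`-th roots of elements of `F`, and its
fraction field is a Kummer extension.

From a crossed product to the Brauer condition: let `P` be the maximal graded subfield and `M = P₀`.
An automorphism of `Frac(P)` over `Frac(F)` multiplies a homogeneous element by an element of `P₀`;
this is a leading term argument (`exists_eq_mul_of_pow_eq`). So each `P_γ` is stable and decomposes
into eigenvectors, which are homogeneous `p`-th roots of elements of `F`. In degree `0` this makes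
`M/k` elementary abelian. By maximality every `σ ∈ H` is conjugation by a homogeneous element of
`P`, hence by such a `p`-th root, so `σ^p = 1`. The crossed product thus contains commuting `a_σ
u_σ`, `σ ∈ H`, with `p`-th powers `b_σ ∈ k*`. In a basis of `H`, `d` becomes on `H` a product of
powers of the `b_j` with carries as exponents. The coordinate characters extend from `H` to `G`, so
this product is the restriction of a function representing a class in `Dec(K/k)`; dividing by that
class leaves one split by `M` (`mem_range_of_commute`).

The criterion in terms of `exp(G)` is group theory: `M/k` has exponent `p` when `G^p ⊆ H`, so the
fixed field of `G^p` is the largest possible `M`, and the condition on the class is weakest for it.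
-/

namespace BrauerTheory

/-! ### Splittings of central simple algebras by matrices -/

section MatrixRepresentation

variable {k K : Type*} [Field k] [Field K] [Algebra k K]

/-- The `K`-linear extension of a homomorphism from a `k`-algebra to matrices over `K`. -/
noncomputable def matrixLift {A ι : Type*} [Ring A] [Algebra k A] [Fintype ι] [DecidableEq ι]
    (ψ : A →ₐ[k] Matrix ι ι K) : K ⊗[k] A →ₐ[K] Matrix ι ι K :=
  Algebra.TensorProduct.lift (Algebra.ofId K _) ψ (fun a _ => Algebra.commute_algebraMap_left a _)

@[simp] lemma matrixLift_tmul {A ι : Type*} [Ring A] [Algebra k A] [Fintype ι] [DecidableEq ι]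
    (ψ : A →ₐ[k] Matrix ι ι K) (c : K) (a : A) : matrixLift ψ (c ⊗ₜ a) = c • ψ a := by
  rw [Algebra.smul_def]
  exact Algebra.TensorProduct.lift_tmul (Algebra.ofId K _) ψ _ c a

variable {A : Type*} [Ring A] [Algebra k A] [Algebra.IsCentral k A] [IsSimpleRing A]
  [FiniteDimensional k A]

section Lift

variable {ι : Type*} [Fintype ι] [DecidableEq ι] (ψ : A →ₐ[k] Matrix ι ι K)

/-- Injectivity comes from the simplicity of `K ⊗[k] A`, surjectivity from equality of dimensions.
-/
lemma matrixLift_bijective (h : Module.finrank k A = Fintype.card ι ^ 2) :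
    Function.Bijective (matrixLift ψ) := by
  have hpos : 0 < Module.finrank k A := Module.finrank_pos
  have : Nonempty ι := by
    rw [← Fintype.card_pos_iff]
    by_contra h0
    rw [h] at hpos
    simp_all
  have hinj : Function.Injective (matrixLift ψ) := (matrixLift ψ).toRingHom.injective
  have hdim : Module.finrank K (K ⊗[k] A) = Module.finrank K (Matrix ι ι K) := by
    rw [Module.finrank_baseChange, Module.finrank_matrix, Module.finrank_self, h, mul_one, sq]
  exact ⟨hinj, ((matrixLift ψ).toLinearMap.injective_iff_surjective_of_finrank_eq_finrank
    hdim).1 hinj⟩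

/-- The isomorphism of `K ⊗ A` with a matrix algebra given by a splitting of `A`. -/
noncomputable def matrixLiftEquiv (h : Module.finrank k A = Fintype.card ι ^ 2) :
    K ⊗[k] A ≃ₐ[K] Matrix ι ι K :=
  AlgEquiv.ofBijective (matrixLift ψ) (matrixLift_bijective ψ h)

lemma matrixLiftEquiv_one_tmul (h : Module.finrank k A = Fintype.card ι ^ 2) (a : A) :
    matrixLiftEquiv ψ h (1 ⊗ₜ a) = ψ a := by
  simp [matrixLiftEquiv]

/-- The commutant of a splitting consists of scalar matrices. -/
lemma exists_smul_one_of_commute (h : Module.finrank k A = Fintype.card ι ^ 2)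
    (X : Matrix ι ι K) (hX : ∀ a, X * ψ a = ψ a * X) : ∃ c : K, X = c • 1 := by
  -- The image of `ψ` spans the matrix algebra over `K`, so `X` is central.
  have hall : ∀ Y : Matrix ι ι K, Commute Y X := by
    intro Y
    obtain ⟨y, rfl⟩ := (matrixLift_bijective ψ h).2 Y
    induction y using TensorProduct.induction_on with
    | zero => simp
    | tmul c a =>
      rw [matrixLift_tmul]
      exact (Commute.smul_left (hX a).symm c)
    | add x y hx hy =>
      rw [map_add]
      exact hx.add_left hy
  obtain ⟨c, hc⟩ := Matrix.mem_range_scalar_of_commute_single (M := X) (fun i j _ => hall _)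
  exact ⟨c, by rw [← hc, Matrix.smul_one_eq_diagonal]; rfl⟩

/-- Two splittings of a central simple algebra of the same degree are conjugate. -/
lemma exists_conj (ψ' : A →ₐ[k] Matrix ι ι K) (h : Module.finrank k A = Fintype.card ι ^ 2) :
    ∃ P : (Matrix ι ι K)ˣ, ∀ a, ψ' a * P = P * ψ a := by
  -- The `K`-automorphism of the matrix algebra that carries `ψ` to `ψ'`; it is inner because all
  -- automorphisms of `End(K^ι)` are.
  let e : Matrix ι ι K ≃ₐ[K] Matrix ι ι K :=
    (matrixLiftEquiv ψ h).symm.trans (matrixLiftEquiv ψ' h)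
  have he : ∀ a, e (ψ a) = ψ' a := fun a => by
    change matrixLiftEquiv ψ' h ((matrixLiftEquiv ψ h).symm (ψ a)) = ψ' a
    rw [← matrixLiftEquiv_one_tmul ψ h, AlgEquiv.symm_apply_apply, matrixLiftEquiv_one_tmul]
  let t : Matrix ι ι K ≃ₐ[K] Module.End K (ι → K) := Matrix.toLinAlgEquiv'
  obtain ⟨T, hT⟩ := AlgEquiv.eq_linearEquivConjAlgEquiv ((t.symm.trans e).trans t)
  refine ⟨Units.map t.symm.toAlgHom.toRingHom.toMonoidHom
    (LinearMap.GeneralLinearGroup.ofLinearEquiv T), fun a => ?_⟩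
  apply t.injective
  have h1 := DFunLike.congr_fun hT (t (ψ a))
  change t (e (t.symm (t (ψ a)))) = _ at h1
  rw [AlgEquiv.symm_apply_apply, he] at h1
  have h2 : t ((Units.map t.symm.toAlgHom.toRingHom.toMonoidHom
    (LinearMap.GeneralLinearGroup.ofLinearEquiv T) : (Matrix ι ι K)ˣ) : Matrix ι ι K) = T :=
    t.apply_symm_apply _
  rw [map_mul, map_mul, h1, h2]
  ext v
  simp [LinearEquiv.conjAlgEquiv_apply]

end Lift

end MatrixRepresentation

/-! ### Functions representing Brauer classes -/

variable {k : Type u} [Field k]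

/-- The class `b` of the Brauer group of `k` is represented by the function `c` with values in the
extension field `K`: a splitting `ψ` of an algebra in the class is intertwined with its Galois
conjugates by matrices `W_σ` that satisfy `σ(W_τ) W_σ = c(σ, τ) W_{στ}`. -/
def Represents {K : Type u} [Field K] [Algebra k K] (b : BrauerGroup.{u, u} k)
    (c : (K ≃ₐ[k] K) → (K ≃ₐ[k] K) → K) : Prop :=
  ∃ (A : CSA.{u, u} k) (n : ℕ) (ψ : A →ₐ[k] Matrix (Fin n) (Fin n) K)
    (W : (K ≃ₐ[k] K) → (Matrix (Fin n) (Fin n) K)ˣ),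
    Quotient.mk (Brauer.CSA_Setoid k) A = b ∧ Module.finrank k A = n ^ 2 ∧
    (∀ σ a, σ.mapMatrix (ψ a) * W σ = W σ * ψ a) ∧
    ∀ σ τ, σ.mapMatrix (W τ : Matrix (Fin n) (Fin n) K) * W σ =
      c σ τ • (W (σ * τ) : Matrix (Fin n) (Fin n) K)

lemma mapMatrix_smul {K ι : Type*} [Field K] [Algebra k K] [Fintype ι] [DecidableEq ι]
    (σ : K ≃ₐ[k] K) (c : K) (X : Matrix ι ι K) :
    σ.mapMatrix (c • X) = σ c • σ.mapMatrix X := by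
  ext i j
  simp

lemma smul_unit_injective {K ι : Type*} [Field K] [Fintype ι] [DecidableEq ι] [Nonempty ι]
    (U : (Matrix ι ι K)ˣ) {a b : K} (h : a • (U : Matrix ι ι K) = b • (U : Matrix ι ι K)) :
    a = b := smul_left_injective K U.ne_zero h

/-- Natural splittings are indexed by a Galois group or by a product of index sets; reindexing
brings them to the form `Fin n` that `Represents` requires. -/
lemma represents_of_fintype {K : Type u} [Field K] [Algebra k K] {A : Type u} [Ring A]
    [Algebra k A] [Algebra.IsCentral k A] [IsSimpleRing A] [FiniteDimensional k A]
    {ι : Type*} [Fintype ι] [DecidableEq ι] {c : (K ≃ₐ[k] K) → (K ≃ₐ[k] K) → K}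
    (ψ : A →ₐ[k] Matrix ι ι K) (W : (K ≃ₐ[k] K) → (Matrix ι ι K)ˣ)
    (hdim : Module.finrank k A = Fintype.card ι ^ 2)
    (h1 : ∀ σ a, σ.mapMatrix (ψ a) * W σ = W σ * ψ a)
    (h2 : ∀ σ τ, σ.mapMatrix (W τ : Matrix ι ι K) * W σ = c σ τ • (W (σ * τ) : Matrix ι ι K)) :
    Represents (brauerClass k A) c := by
  let e := Matrix.reindexAlgEquiv K K (Fintype.equivFin ι)
  have hmap : ∀ (σ : K ≃ₐ[k] K) (X : Matrix ι ι K), σ.mapMatrix (e X) = e (σ.mapMatrix X) :=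
    fun σ X => rfl
  refine ⟨csaOf k A, Fintype.card ι, (e.restrictScalars k).toAlgHom.comp ψ,
    fun σ => Units.map e.toAlgHom.toRingHom.toMonoidHom (W σ), rfl, hdim, fun σ a => ?_,
    fun σ τ => ?_⟩
  · change σ.mapMatrix (e (ψ a)) * e (W σ : Matrix ι ι K) = e (W σ : Matrix ι ι K) * e (ψ a)
    rw [hmap, ← map_mul, h1, map_mul]
  · change σ.mapMatrix (e (W τ : Matrix ι ι K)) * e (W σ : Matrix ι ι K) =
      c σ τ • e (W (σ * τ) : Matrix ι ι K)
    rw [hmap, ← map_mul, h2, map_smul]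

namespace Represents

variable {K : Type u} [Field K] [Algebra k K]

lemma pos_of_finrank {A : CSA.{u, u} k} {n : ℕ} (h : Module.finrank k A = n ^ 2) : 0 < n := by
  have hpos : 0 < Module.finrank k A := Module.finrank_pos
  rw [h] at hpos
  exact Nat.pos_of_ne_zero (by rintro rfl; simp at hpos)

open scoped Kronecker in
-- The Kronecker product of two splittings splits the tensor product, and the Kronecker products of
-- the intertwining matrices intertwine it with its conjugates.
lemma mul {b b' : BrauerGroup.{u, u} k} {c c' : (K ≃ₐ[k] K) → (K ≃ₐ[k] K) → K}
    (h : Represents b c) (h' : Represents b' c') :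
    Represents (b * b') (fun σ τ => c σ τ * c' σ τ) := by
  obtain ⟨A, n, ψ, W, rfl, hdim, h1, h2⟩ := h
  obtain ⟨A', n', ψ', W', rfl, hdim', h1', h2'⟩ := h'
  let l : A →ₐ[k] Matrix (Fin n × Fin n') (Fin n × Fin n') K :=
    AlgHom.ofLinearMap
      { toFun := fun a => ψ a ⊗ₖ (1 : Matrix (Fin n') (Fin n') K)
        map_add' := fun a b => by rw [map_add, Matrix.add_kronecker]
        map_smul' := fun c a => by rw [map_smul, Matrix.smul_kronecker]; rfl }
      (by simp) (fun a b => by simp [← Matrix.mul_kronecker_mul])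
  let r : A' →ₐ[k] Matrix (Fin n × Fin n') (Fin n × Fin n') K :=
    AlgHom.ofLinearMap
      { toFun := fun a => (1 : Matrix (Fin n) (Fin n) K) ⊗ₖ ψ' a
        map_add' := fun a b => by rw [map_add, Matrix.kronecker_add]
        map_smul' := fun c a => by rw [map_smul, Matrix.kronecker_smul]; rfl }
      (by simp) (fun a b => by simp [← Matrix.mul_kronecker_mul])
  have hl : ∀ a, l a = ψ a ⊗ₖ (1 : Matrix (Fin n') (Fin n') K) := fun _ => rfl
  have hr : ∀ a, r a = (1 : Matrix (Fin n) (Fin n) K) ⊗ₖ ψ' a := fun _ => rfl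
  let Ψ : A ⊗[k] A' →ₐ[k] Matrix (Fin n × Fin n') (Fin n × Fin n') K :=
    Algebra.TensorProduct.lift l r (fun a a' => by
      rw [Commute, SemiconjBy, hl, hr, ← Matrix.mul_kronecker_mul, ← Matrix.mul_kronecker_mul]
      simp)
  have hΨ : ∀ a a', Ψ (a ⊗ₜ a') = ψ a ⊗ₖ ψ' a' := fun a a' => by
    rw [Algebra.TensorProduct.lift_tmul, hl, hr, ← Matrix.mul_kronecker_mul]
    simp
  have hmap : ∀ (σ : K ≃ₐ[k] K) (X : Matrix (Fin n) (Fin n) K) (Y : Matrix (Fin n') (Fin n') K),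
      σ.mapMatrix (X ⊗ₖ Y) = σ.mapMatrix X ⊗ₖ σ.mapMatrix Y := fun σ X Y => by
    ext i j
    simp [Matrix.kroneckerMap_apply]
  refine represents_of_fintype (A := A ⊗[k] A') Ψ
    (fun σ => Matrix.GeneralLinearGroup.kronecker (W σ) (W' σ)) ?_ ?_ ?_
  · rw [Module.finrank_tensorProduct, hdim, hdim']
    simp [mul_pow]
  · intro σ a
    change σ.mapMatrix (Ψ a) * ((W σ : Matrix (Fin n) (Fin n) K) ⊗ₖ
      (W' σ : Matrix (Fin n') (Fin n') K)) = ((W σ : Matrix (Fin n) (Fin n) K) ⊗ₖ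
      (W' σ : Matrix (Fin n') (Fin n') K)) * Ψ a
    induction a using TensorProduct.induction_on with
    | zero => simp
    | tmul a a' =>
      rw [hΨ, hmap, ← Matrix.mul_kronecker_mul, ← Matrix.mul_kronecker_mul, h1, h1']
    | add x y hx hy => rw [map_add, map_add, add_mul, hx, hy, mul_add]
  · intro σ τ
    change σ.mapMatrix ((W τ : Matrix (Fin n) (Fin n) K) ⊗ₖ
      (W' τ : Matrix (Fin n') (Fin n') K)) * ((W σ : Matrix (Fin n) (Fin n) K) ⊗ₖ
      (W' σ : Matrix (Fin n') (Fin n') K)) = (c σ τ * c' σ τ) •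
      ((W (σ * τ) : Matrix (Fin n) (Fin n) K) ⊗ₖ (W' (σ * τ) : Matrix (Fin n') (Fin n') K))
    rw [hmap, ← Matrix.mul_kronecker_mul, h2, h2', Matrix.smul_kronecker, Matrix.kronecker_smul,
      smul_smul]

lemma one : Represents (1 : BrauerGroup.{u, u} k) (fun _ _ : K ≃ₐ[k] K => (1 : K)) :=
  represents_of_fintype (A := k) (ι := Unit) (Algebra.ofId k _) (fun _ => 1) (by simp)
    (fun σ a => by
      rw [Units.val_one, mul_one, one_mul, Algebra.ofId_apply, AlgEquiv.commutes]) (by simp)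

/-- The function representing a class may be pulled back to a larger field. -/
lemma inflation {b : BrauerGroup.{u, u} k} {L : Type u} [Field L] [Algebra k L] [Algebra L K]
    [IsScalarTower k L K] [Normal k L] {c : (L ≃ₐ[k] L) → (L ≃ₐ[k] L) → L}
    (h : Represents b c) :
    Represents (K := K) b (fun σ τ => algebraMap L K
      (c (AlgEquiv.restrictNormalHom L σ) (AlgEquiv.restrictNormalHom L τ))) := by
  obtain ⟨A, n, ψ, W, hb, hdim, h1, h2⟩ := h
  let f : Matrix (Fin n) (Fin n) L →ₐ[k] Matrix (Fin n) (Fin n) K :=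
    (IsScalarTower.toAlgHom k L K).mapMatrix
  have hmap : ∀ (σ : K ≃ₐ[k] K) (X : Matrix (Fin n) (Fin n) L),
      σ.mapMatrix (f X) = f ((AlgEquiv.restrictNormalHom L σ).mapMatrix X) := fun σ X => by
    ext i j
    exact (AlgEquiv.restrictNormal_commutes σ L (X i j)).symm
  refine ⟨A, n, f.comp ψ, fun σ => Units.map f.toRingHom.toMonoidHom
    (W (AlgEquiv.restrictNormalHom L σ)), hb, hdim, fun σ a => ?_, fun σ τ => ?_⟩
  · change σ.mapMatrix (f (ψ a)) * f _ = f _ * f (ψ a)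
    rw [hmap, ← map_mul, h1, map_mul]
  · change σ.mapMatrix (f _) * f _ = _ • f _
    rw [hmap, ← map_mul, h2, map_mul]
    ext i j
    simp [f]

end Represents

end BrauerTheory

/-! ### Hilbert 90 and the classes split by an intermediate field -/

namespace BrauerTheory

/-- A function with values in `K` is a coboundary on the subgroup `H` of the Galois group. -/
def IsCoboundaryOn {k K : Type*} [Field k] [Field K] [Algebra k K] (H : Subgroup (K ≃ₐ[k] K))
    (c : (K ≃ₐ[k] K) → (K ≃ₐ[k] K) → K) : Prop :=
  ∃ a : (K ≃ₐ[k] K) → K, (∀ σ ∈ H, a σ ≠ 0) ∧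
    ∀ σ ∈ H, ∀ τ ∈ H, a σ * σ (a τ) = c σ τ * a (σ * τ)

/-- Hilbert's theorem 90 for the general linear group. -/
lemma exists_mapMatrix_eq_mul {k K ι : Type*} [Field k] [Field K] [Algebra k K]
    [FiniteDimensional k K] [Fintype ι] [DecidableEq ι] (H : Subgroup (K ≃ₐ[k] K))
    (W : (K ≃ₐ[k] K) → (Matrix ι ι K)ˣ)
    (hW : ∀ σ ∈ H, ∀ τ ∈ H, σ.mapMatrix (W τ : Matrix ι ι K) * W σ = W (σ * τ)) :
    ∃ P : (Matrix ι ι K)ˣ, ∀ σ ∈ H, σ.mapMatrix (P : Matrix ι ι K) = W σ * P := by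
  classical
  -- Averaging over `H` for the twisted semilinear action `v ↦ W_h⁻¹ h(v)`. The vectors `T v`
  -- satisfy `σ(T v) = W_σ T v`, so any basis of `K^ι` made of them gives the columns of `P`.
  let T : (ι → K) → (ι → K) := fun v => ∑ h : H, ((W h)⁻¹ : (Matrix ι ι K)ˣ).val.mulVec (fun i => h.1 (v i))
  have hspan : Submodule.span K (Set.range T) = ⊤ := by
    by_contra hne
    obtain ⟨ℓ, hℓ0, hℓ⟩ := Submodule.exists_le_ker_of_lt_top _ (lt_top_iff_ne_top.2 hne)
    apply hℓ0
    -- A linear form `ℓ` that kills all `T (a • v)`, `a ∈ K`, gives a linear relation between the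
    -- distinct characters `a ↦ h(a)`; by Dedekind independence each coefficient vanishes, in
    -- particular the one at `h = 1`.
    have hv : ∀ v : ι → K, ℓ (((W 1)⁻¹ : (Matrix ι ι K)ˣ).val.mulVec v) = 0 := by
      intro v
      have hli := (linearIndependent_monoidHom K K).comp
        (fun h : H => ((h.1 : K ≃ₐ[k] K) : K →* K)) (fun h h' hh => Subtype.ext (AlgEquiv.ext
          fun x => DFunLike.congr_fun hh x))
      rw [Fintype.linearIndependent_iff] at hli
      have := hli (fun h => ℓ (((W h)⁻¹ : (Matrix ι ι K)ˣ).val.mulVec (fun i => h.1 (v i)))) (by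
        ext a
        have h1 : ℓ (T (a • v)) = 0 := hℓ (Submodule.subset_span ⟨_, rfl⟩)
        simp only [T, map_sum] at h1
        rw [Finset.sum_apply]
        refine Eq.trans (Finset.sum_congr rfl fun h _ => ?_) h1
        have h2 : (fun i => h.1 ((a • v) i)) = h.1 a • fun i => h.1 (v i) := by
          ext i
          simp
        rw [h2, Matrix.mulVec_smul, map_smul]
        simp [mul_comm]) 1
      simpa using this
    ext i
    have := hv ((W 1).val.mulVec (Pi.single i 1))
    rw [Matrix.mulVec_mulVec, Units.inv_mul, Matrix.one_mulVec] at this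
    simpa using this
  obtain ⟨f, hf, -, hfli⟩ := Submodule.exists_fun_fin_finrank_span_eq K (Set.range T)
  have hn : Module.finrank K (Submodule.span K (Set.range T)) = Fintype.card ι := by
    rw [hspan, finrank_top, Module.finrank_fintype_fun_eq_card]
  let e : ι ≃ Fin (Module.finrank K (Submodule.span K (Set.range T))) :=
    (Fintype.equivFin ι).trans (finCongr hn.symm)
  let P : Matrix ι ι K := Matrix.of fun i j => f (e j) i
  have hP : IsUnit P := Matrix.linearIndependent_cols_iff_isUnit.1 (hfli.comp e e.injective)
  refine ⟨hP.unit, fun σ hσ => ?_⟩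
  have hfix : ∀ v : ι → K, (fun i => σ (T v i)) = (W σ).val.mulVec (T v) := by
    intro v
    have h1 : (W σ).val.mulVec (T v) = ∑ h : H, ((W σ).val *
        ((W h)⁻¹ : (Matrix ι ι K)ˣ).val).mulVec (fun i => h.1 (v i)) := by
      simp only [T]
      rw [Matrix.mulVec_sum]
      exact Finset.sum_congr rfl fun h _ => Matrix.mulVec_mulVec _ _ _
    rw [h1, ← Equiv.sum_comp (Equiv.mulLeft (⟨σ, hσ⟩ : H))]
    ext i
    simp only [T]
    rw [Finset.sum_apply, Finset.sum_apply, map_sum]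
    refine Finset.sum_congr rfl fun h _ => ?_
    -- The cocycle relation `W_{σh} = σ(W_h) W_σ`, solved for `σ(W_h)⁻¹`.
    have h2 : (W σ).val * ((W (σ * h))⁻¹ : (Matrix ι ι K)ˣ).val =
        σ.mapMatrix ((W h)⁻¹ : (Matrix ι ι K)ˣ).val := by
      rw [Units.mul_inv_eq_iff_eq_mul, ← hW σ hσ h h.2, ← mul_assoc, ← map_mul, Units.inv_mul,
        map_one, one_mul]
    change _ = ((W σ).val * ((W (σ * h))⁻¹ : (Matrix ι ι K)ˣ).val).mulVec
      (fun i => σ (h.1 (v i))) i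
    rw [h2]
    simp [Matrix.mulVec, dotProduct]
  ext i j
  obtain ⟨v, hv⟩ := hf (e j)
  have := congrFun (hfix v) i
  rw [hv] at this
  exact this

variable {k : Type u} [Field k]

lemma mem_relBr_of_splitting {L : Type u} [Field L] [Algebra k L] (A : CSA.{u, u} k) {n : ℕ}
    (ψ : A →ₐ[k] Matrix (Fin n) (Fin n) L) (h : Module.finrank k A = n ^ 2) :
    (Quotient.mk (Brauer.CSA_Setoid k) A) ∈ relBr k L := by
  have : NeZero n := ⟨(Represents.pos_of_finrank h).ne'⟩
  exact Quotient.sound (s := Brauer.CSA_Setoid L)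
    (brauerEquivalent_one_of_matrix (A := csaOf L (L ⊗[k] A))
      (matrixLiftEquiv ψ (h.trans (by rw [Fintype.card_fin]))))

/-- Triviality of the class of `L ⊗ A` only means that some matrix algebra over it is a matrix
algebra over `L`. This splits `M_p(A)`, which has the class of `A` by `mk_matrix`. -/
lemma exists_splitting_of_mem_relBr {L : Type u} [Field L] [Algebra k L] (A : CSA.{u, u} k)
    (h : (Quotient.mk (Brauer.CSA_Setoid k) A) ∈ relBr k L) :
    ∃ (p n : ℕ) (_ : NeZero p) (_ : Matrix (Fin p) (Fin p) A →ₐ[k] Matrix (Fin n) (Fin n) L),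
      Module.finrank k (Matrix (Fin p) (Fin p) A) = n ^ 2 := by
  have h1 : res k L (Quotient.mk (Brauer.CSA_Setoid k) A) = 1 := h
  obtain ⟨p, n, hp, hn, ⟨e⟩⟩ := Quotient.exact (s := Brauer.CSA_Setoid L) h1
  change Matrix (Fin p) (Fin p) (L ⊗[k] A) ≃ₐ[L] Matrix (Fin n) (Fin n) L at e
  refine ⟨p, n, ⟨hp⟩, ((e.restrictScalars k : _ ≃ₐ[k] _) : _ →ₐ[k] _).comp
    (Algebra.TensorProduct.includeRight : A →ₐ[k] L ⊗[k] A).mapMatrix, ?_⟩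
  have h2 := e.toLinearEquiv.finrank_eq
  rw [Module.finrank_matrix, Module.finrank_matrix, Module.finrank_self,
    Module.finrank_baseChange] at h2
  rw [Module.finrank_matrix, h2]
  simp [sq]

lemma mk_matrix (A : CSA.{u, u} k) (p : ℕ) [NeZero p] :
    Quotient.mk (Brauer.CSA_Setoid k) (csaOf k (Matrix (Fin p) (Fin p) A)) =
      Quotient.mk (Brauer.CSA_Setoid k) A :=
  Quotient.sound (s := Brauer.CSA_Setoid k) (brauerEquivalent_of_matrix (ι := Unit) (κ := Fin p)
    (Matrix.uniqueAlgEquiv (R := k) (m := Unit) (A := Matrix (Fin p) (Fin p) A)))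

namespace Represents

variable {K : Type u} [Field K] [Algebra k K] [FiniteDimensional k K] [IsGalois k K]

/-- A class is split by `M` if the function representing it is a coboundary on `Gal(K/M)`. -/
lemma mem_relBr {b : BrauerGroup.{u, u} k} {c : (K ≃ₐ[k] K) → (K ≃ₐ[k] K) → K}
    (h : Represents b c) (M : IntermediateField k K) (hc : IsCoboundaryOn M.fixingSubgroup c) :
    b ∈ relBr k M := by
  obtain ⟨A, n, ψ, W, rfl, hdim, h1, h2⟩ := h
  obtain ⟨a, ha0, ha⟩ := hc
  have hpos := pos_of_finrank hdim
  have : Nonempty (Fin n) := ⟨⟨0, hpos⟩⟩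
  have hc0 : ∀ σ ∈ M.fixingSubgroup, ∀ τ ∈ M.fixingSubgroup,
      (a (σ * τ))⁻¹ = σ (a τ)⁻¹ * ((a σ)⁻¹ * c σ τ) := by
    intro σ hσ τ hτ
    have e0 := ha0 _ hσ
    have e1 := ha0 _ (mul_mem hσ hτ)
    have e2 : σ (a τ) ≠ 0 := by simpa using ha0 _ hτ
    rw [map_inv₀]
    field_simp
    linear_combination ha σ hσ τ hτ
  classical
  -- Rescaling `W_σ` by `a_σ⁻¹` turns the relation up to scalars into an honest cocycle relation on
  -- `Gal(K/M)`, to which Hilbert 90 applies. The value `1` occurs only outside this subgroup and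
  -- plays no role.
  let s : (K ≃ₐ[k] K) → Kˣ := fun σ => if h : a σ = 0 then 1 else (Units.mk0 _ h)⁻¹
  have hs : ∀ σ ∈ M.fixingSubgroup, (s σ : K) = (a σ)⁻¹ := fun σ hσ => by
    simp only [s]
    rw [dif_neg (ha0 σ hσ), Units.val_inv_eq_inv_val, Units.val_mk0]
  obtain ⟨P, hP⟩ := exists_mapMatrix_eq_mul M.fixingSubgroup (fun σ => s σ • W σ) (by
    intro σ hσ τ hτ
    simp only [Units.val_smul, Units.smul_def]
    rw [mapMatrix_smul, hs _ hσ, hs _ hτ, hs _ (mul_mem hσ hτ), smul_mul_smul_comm, h2, smul_smul,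
      hc0 σ hσ τ hτ]
    congr 1
    ring)
  -- Conjugation by `P` absorbs the intertwining matrices: `ψ'` is fixed by `Gal(K/M)`, so its
  -- entries lie in `M`.
  let ψ' : A →ₐ[k] Matrix (Fin n) (Fin n) K :=
    AlgHom.ofLinearMap
      { toFun := fun x => P⁻¹.val * ψ x * P.val
        map_add' := fun x y => by rw [map_add, mul_add, add_mul]
        map_smul' := fun t x => by
          rw [map_smul, RingHom.id_apply, mul_smul_comm, smul_mul_assoc] }
      (by simp)
      (fun x y => by
        change P⁻¹.val * ψ (x * y) * P.val = P⁻¹.val * ψ x * P.val * (P⁻¹.val * ψ y * P.val)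
        rw [map_mul, mul_assoc (P⁻¹.val * ψ x), ← mul_assoc P.val, ← mul_assoc P.val,
          Units.mul_inv, one_mul]
        simp only [mul_assoc])
  have hψ' : ∀ x, ψ' x = P⁻¹.val * ψ x * P.val :=
    fun _ => rfl
  have hfix : ∀ σ ∈ M.fixingSubgroup, ∀ x, σ.mapMatrix (ψ' x) = ψ' x := by
    intro σ hσ x
    have e1 := hP σ hσ
    have e2 : P.val * ψ' x = ψ x * P.val := by
      rw [hψ', ← mul_assoc, ← mul_assoc, Units.mul_inv, one_mul]
    have e3 := congrArg σ.mapMatrix e2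
    rw [map_mul, map_mul, e1] at e3
    have e4 : σ.mapMatrix (ψ x) * (s σ • W σ).val =
        (s σ • W σ).val * ψ x := by
      simp only [Units.val_smul, Units.smul_def]
      rw [mul_smul_comm, smul_mul_assoc, h1]
    rw [← mul_assoc, e4, mul_assoc, mul_assoc, ← e2, ← mul_assoc, ← mul_assoc] at e3
    rw [← Units.val_mul] at e3
    exact (Units.mul_right_inj _).1 e3
  let f : Matrix (Fin n) (Fin n) M →ₐ[k] Matrix (Fin n) (Fin n) K := M.val.mapMatrix
  have hf : Function.Injective f := fun X Y hXY => by
    ext i j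
    exact congrFun (congrFun hXY i) j
  have hrange : ∀ x, ψ' x ∈ f.range := by
    intro x
    have hm : ∀ i j, ψ' x i j ∈ M := fun i j => by
      rw [← IsGalois.fixedField_fixingSubgroup M, IntermediateField.mem_fixedField_iff]
      intro σ hσ
      exact congrFun (congrFun (hfix σ hσ x) i) j
    exact ⟨Matrix.of fun i j => ⟨ψ' x i j, hm i j⟩, rfl⟩
  exact mem_relBr_of_splitting A (((AlgEquiv.ofInjective f hf).symm : _ →ₐ[k] _).comp
    (ψ'.codRestrict f.range hrange)) hdim

omit [FiniteDimensional k K] [IsGalois k K] in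
open scoped Kronecker in
/-- If a class is split by `M`, the function representing it is a coboundary on `Gal(K/M)`. -/
lemma isCoboundaryOn {b : BrauerGroup.{u, u} k} {c : (K ≃ₐ[k] K) → (K ≃ₐ[k] K) → K}
    (h : Represents b c) (M : IntermediateField k K) (hb : b ∈ relBr k M) :
    IsCoboundaryOn M.fixingSubgroup c := by
  obtain ⟨A, n, ψ, W, rfl, hdim, h1, h2⟩ := h
  obtain ⟨p, m, hp, φ, hφ⟩ := exists_splitting_of_mem_relBr A hb
  -- `M_p(A)` has two splittings over `K` of the same degree: `Ψ`, the blockwise version of `ψ`, and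
  -- `Φ` below, which is defined over `M`.
  let Ψ : Matrix (Fin p) (Fin p) A →ₐ[k] Matrix (Fin p × Fin n) (Fin p × Fin n) K :=
    ((Matrix.compAlgEquiv (Fin p) (Fin n) K k) : _ →ₐ[k] _).comp ψ.mapMatrix
  have hΨ : ∀ X i j, Ψ X i j = ψ (X i.1 j.1) i.2 j.2 := fun X i j => rfl
  have hm : Fintype.card (Fin p × Fin n) = m := by
    rw [Module.finrank_matrix, hdim] at hφ
    simp only [Fintype.card_prod, Fintype.card_fin] at hφ ⊢
    have : (p * n) ^ 2 = m ^ 2 := by rw [← hφ]; ring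
    exact Nat.pow_left_injective (by norm_num : 2 ≠ 0) this
  let e : Fin p × Fin n ≃ Fin m := Fintype.equivFinOfCardEq hm
  let Φ : Matrix (Fin p) (Fin p) A →ₐ[k] Matrix (Fin p × Fin n) (Fin p × Fin n) K :=
    ((Matrix.reindexAlgEquiv k K e.symm : _ ≃ₐ[k] _) : _ →ₐ[k] _).comp (M.val.mapMatrix.comp φ)
  have hΦ : ∀ σ ∈ M.fixingSubgroup, ∀ X, σ.mapMatrix (Φ X) = Φ X := fun σ hσ X => by
    ext i j
    exact hσ ⟨_, (φ X (e i) (e j)).2⟩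
  have hfin : Module.finrank k (Matrix (Fin p) (Fin p) A) = Fintype.card (Fin p × Fin n) ^ 2 :=
    hφ.trans (by rw [hm])
  obtain ⟨Q, hQ⟩ := exists_conj Ψ Φ hfin
  let W' : (K ≃ₐ[k] K) → (Matrix (Fin p × Fin n) (Fin p × Fin n) K)ˣ := fun σ =>
    Matrix.GeneralLinearGroup.kronecker 1 (W σ)
  have hW' : ∀ σ, (W' σ : Matrix (Fin p × Fin n) (Fin p × Fin n) K) = 1 ⊗ₖ (W σ : Matrix _ _ K) :=
    fun σ => rfl
  have hmap : ∀ (σ : K ≃ₐ[k] K) (Y : Matrix (Fin n) (Fin n) K),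
      σ.mapMatrix ((1 : Matrix (Fin p) (Fin p) K) ⊗ₖ Y) = 1 ⊗ₖ σ.mapMatrix Y := fun σ Y => by
    ext i j
    simp [Matrix.kroneckerMap_apply, Matrix.one_apply, apply_ite σ]
  have h1' : ∀ σ X, σ.mapMatrix (Ψ X) * W' σ = W' σ * Ψ X := fun σ X => by
    ext i j
    have := congrFun (congrFun (h1 σ (X i.1 j.1)) i.2) j.2
    simp only [Matrix.mul_apply] at this
    simpa [Matrix.mul_apply, hW', Fintype.sum_prod_type, Matrix.kroneckerMap_apply,
      Matrix.one_apply, hΨ] using this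
  have h2' : ∀ σ τ, σ.mapMatrix (W' τ : Matrix (Fin p × Fin n) (Fin p × Fin n) K) * W' σ =
      c σ τ • (W' (σ * τ) : Matrix (Fin p × Fin n) (Fin p × Fin n) K) := fun σ τ => by
    rw [hW', hW', hW', hmap, ← Matrix.mul_kronecker_mul, h2, one_mul, Matrix.kronecker_smul]
  -- The intertwining matrices of `Ψ` transported to `Φ` by the change of basis `Q`. If `σ` fixes
  -- `M`, then `σΦ = Φ`, so `V σ` commutes with `Φ` and is a scalar `a σ`; these scalars are the
  -- cochain sought.
  let V : (K ≃ₐ[k] K) → (Matrix (Fin p × Fin n) (Fin p × Fin n) K)ˣ := fun σ =>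
    Units.map σ.mapMatrix.toAlgHom.toRingHom.toMonoidHom Q * W' σ * Q⁻¹
  have hV : ∀ σ, (V σ).val * Q.val = σ.mapMatrix Q.val * (W' σ).val := fun σ => by
    change σ.mapMatrix Q.val * (W' σ).val * Q⁻¹.val * Q.val = _
    rw [mul_assoc, Units.inv_mul, mul_one]
  have hne : Nonempty (Fin p × Fin n) :=
    ⟨⟨⟨0, Nat.pos_of_ne_zero hp.out⟩, ⟨0, pos_of_finrank hdim⟩⟩⟩
  have hscal : ∀ σ ∈ M.fixingSubgroup, ∃ t : K, (V σ).val = t • 1 := by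
    intro σ hσ
    refine exists_smul_one_of_commute Φ hfin _ fun X => ?_
    rw [← Units.mul_left_inj Q]
    have e1 := congrArg σ.mapMatrix (hQ X)
    rw [map_mul, map_mul, hΦ σ hσ] at e1
    rw [mul_assoc, hQ, ← mul_assoc, hV, mul_assoc, ← h1', ← mul_assoc, ← e1, mul_assoc, mul_assoc,
      hV]
  have hdef : ∀ σ ∈ M.fixingSubgroup, ∃ t : K, t ≠ 0 ∧ (V σ).val = t • 1 := by
    intro σ hσ
    obtain ⟨t, ht⟩ := hscal σ hσ
    refine ⟨t, ?_, ht⟩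
    rintro rfl
    exact (V σ).ne_zero (by rw [ht, zero_smul])
  classical
  let a : (K ≃ₐ[k] K) → K := fun σ => if hσ : σ ∈ M.fixingSubgroup then (hdef σ hσ).choose else 0
  have ha : ∀ σ (hσ : σ ∈ M.fixingSubgroup), a σ ≠ 0 ∧ (V σ).val = a σ • 1 := by
    intro σ hσ
    simp only [a, dif_pos hσ]
    exact (hdef σ hσ).choose_spec
  refine ⟨a, fun σ hσ => (ha σ hσ).1, fun σ hσ τ hτ => ?_⟩
  -- The inner factors `σ(Q)⁻¹ σ(Q)` cancel, so `V` inherits the relation of `W'`.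
  have key : σ.mapMatrix (V τ).val * (V σ).val = c σ τ • (V (σ * τ)).val := by
    rw [← Units.mul_left_inj Q, mul_assoc, hV, ← mul_assoc, ← map_mul, hV, map_mul, mul_assoc, h2',
      smul_mul_assoc, hV, mul_smul_comm]
    rfl
  rw [(ha σ hσ).2, (ha τ hτ).2, (ha _ (mul_mem hσ hτ)).2, mapMatrix_smul, map_one,
    smul_mul_smul_comm, mul_one, smul_smul] at key
  have := smul_unit_injective (1 : (Matrix (Fin p × Fin n) (Fin p × Fin n) K)ˣ) key
  rw [mul_comm]
  exact this

end Represents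

end BrauerTheory

/-! ### Functions representing crossed products and decomposable classes -/

namespace BrauerTheory

variable {k : Type u} [Field k] {K : Type u} [Field K] [Algebra k K] [FiniteDimensional k K]

namespace Represents

variable [IsGalois k K]

/-- A crossed product algebra is represented by its cocycle. -/
lemma crossedProduct {d : (K ≃ₐ[k] K) × (K ≃ₐ[k] K) → Kˣ}
    (hd : groupCohomology.IsMulCocycle₂ d) :
    Represents (brauerClass k (CrossedProduct hd)) (fun σ τ => (d (σ, τ) : K)) := by
  classical
  -- Right multiplication by `x_τ` commutes with left multiplications and is `τ⁻¹`-semilinear for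
  -- the right `K`-structure. `W τ` is `τ` applied to its matrix in the right basis `(x_ρ)`; since
  -- `x_ρ x_τ = x_{ρτ} (ρτ)⁻¹(d(ρ, τ))`, the entry at `(ρτ, ρ)` is `ρ⁻¹(d(ρ, τ))`.
  let W : (K ≃ₐ[k] K) → Matrix (K ≃ₐ[k] K) (K ≃ₐ[k] K) K := fun τ => Matrix.of fun α ρ =>
    if α = ρ * τ then ρ⁻¹ (d (ρ, τ)) else 0
  let V : (K ≃ₐ[k] K) → Matrix (K ≃ₐ[k] K) (K ≃ₐ[k] K) K := fun τ => Matrix.of fun ρ α =>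
    if α = ρ * τ then (ρ⁻¹ (d (ρ, τ)))⁻¹ else 0
  have hWV : ∀ τ, V τ * W τ = 1 := by
    intro τ
    ext ρ ρ'
    rw [Matrix.mul_apply, Finset.sum_eq_single (ρ * τ)]
    · by_cases h : ρ = ρ'
      · subst h
        simp [V, W]
      · simp [V, W, h]
    · intro α _ hα
      simp [V, hα]
    · simp
  have hdim : Module.finrank k (CrossedProduct hd) = Fintype.card (K ≃ₐ[k] K) ^ 2 := by
    have h : Module.finrank k (CrossedProduct hd) = Module.finrank k ((K ≃ₐ[k] K) → K) :=
      (CrossedProduct.coeffLinearEquiv hd).finrank_eq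
    rw [h, Module.finrank_pi_fintype, Finset.sum_const, Finset.card_univ,
      ← IsGalois.card_aut_eq_finrank, Nat.card_eq_fintype_card, smul_eq_mul, sq]
  have hψ : ∀ f α ρ, CrossedProduct.toMatrix hd f α ρ =
      α⁻¹ (f.coeff (α * ρ⁻¹) * d (α * ρ⁻¹, ρ)) := fun f α ρ => by
    simp [CrossedProduct.toMatrix]
  refine represents_of_fintype (CrossedProduct.toMatrix hd)
    (fun τ => ⟨W τ, V τ, mul_eq_one_comm.1 (hWV τ), hWV τ⟩) hdim ?_ ?_
  · intro τ f
    ext α ρ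
    change (τ.mapMatrix (CrossedProduct.toMatrix hd f) * W τ) α ρ =
      (W τ * CrossedProduct.toMatrix hd f) α ρ
    rw [Matrix.mul_apply, Matrix.mul_apply, Finset.sum_eq_single (ρ * τ),
      Finset.sum_eq_single (α * τ⁻¹)]
    · have h1 := CrossedProduct.cocycle hd (α * τ⁻¹ * ρ⁻¹) ρ τ
      have h2 : α * (ρ * τ)⁻¹ = α * τ⁻¹ * ρ⁻¹ := by group
      have h3 : α * τ⁻¹ * ρ⁻¹ * ρ = α * τ⁻¹ := by group
      have h4 : τ * α⁻¹ = (α * τ⁻¹)⁻¹ := by group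
      have h5 : ρ⁻¹ = (α * τ⁻¹)⁻¹ * (α * τ⁻¹ * ρ⁻¹) := by group
      rw [h3] at h1
      simp only [AlgEquiv.mapMatrix_apply, Matrix.map_apply, hψ, W, Matrix.of_apply, if_true,
        inv_mul_cancel_right]
      rw [← AlgEquiv.mul_apply, h4, h2, h5, AlgEquiv.mul_apply, ← map_mul, ← map_mul]
      congr 1
      have h6 : (α * τ⁻¹)⁻¹ * (α * τ⁻¹ * ρ⁻¹) = ρ⁻¹ := by group
      rw [h6]
      linear_combination -(f.coeff (α * τ⁻¹ * ρ⁻¹)) * h1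
    · intro γ _ hγ
      have : α ≠ γ * τ := by
        rintro rfl
        exact hγ (by group)
      simp [W, this]
    · simp
    · intro β _ hβ
      simp [W, hβ]
    · simp
  · intro σ τ
    ext α ρ
    change (σ.mapMatrix (W τ) * W σ) α ρ = (d (σ, τ) : K) * W (σ * τ) α ρ
    rw [Matrix.mul_apply, Finset.sum_eq_single (ρ * σ)]
    · by_cases h : α = ρ * (σ * τ)
      · have h1 := CrossedProduct.cocycle hd ρ σ τ
        have h2 : σ * (ρ * σ)⁻¹ = ρ⁻¹ := by group
        simp only [AlgEquiv.mapMatrix_apply, Matrix.map_apply, W, Matrix.of_apply, if_true, h,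
          mul_assoc]
        rw [← AlgEquiv.mul_apply, h2, ← map_mul, h1, map_mul, ← AlgEquiv.mul_apply,
          inv_mul_cancel]
        rfl
      · have h' : α ≠ ρ * σ * τ := by rwa [mul_assoc]
        simp [W, h, h']
    · intro β _ hβ
      simp [W, hβ]
    · simp

/-- A class split by a cyclic extension is represented by a symmetric function with values in the
base field. -/
lemma exists_of_isCyclic [IsCyclic (K ≃ₐ[k] K)] {b : BrauerGroup.{u, u} k} (hb : b ∈ relBr k K) :
    ∃ f : (K ≃ₐ[k] K) → (K ≃ₐ[k] K) → k, (∀ σ τ, f σ τ ≠ 0) ∧ (∀ σ τ, f σ τ = f τ σ) ∧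
      Represents b (fun σ τ => algebraMap k K (f σ τ)) := by
  obtain ⟨A, rfl⟩ := Quotient.exists_rep b
  obtain ⟨p, n, hp, φ, hφ⟩ := exists_splitting_of_mem_relBr A hb
  obtain ⟨s, hs⟩ := IsCyclic.exists_generator (α := K ≃ₐ[k] K)
  have hfin : Module.finrank k (Matrix (Fin p) (Fin p) A) = Fintype.card (Fin n) ^ 2 := by
    rw [hφ, Fintype.card_fin]
  have hne : Nonempty (Fin n) :=
    ⟨⟨0, pos_of_finrank (A := csaOf k (Matrix (Fin p) (Fin p) A)) hφ⟩⟩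
  obtain ⟨P, hP⟩ := exists_conj φ ((s.mapMatrix (m := Fin n)).toAlgHom.comp φ) hfin
  let act : (K ≃ₐ[k] K) → (Matrix (Fin n) (Fin n) K)ˣ →* (Matrix (Fin n) (Fin n) K)ˣ := fun σ =>
    Units.map (σ.mapMatrix (m := Fin n)).toAlgHom.toRingHom.toMonoidHom
  have hact : ∀ σ X, (act σ X).val = σ.mapMatrix X.val := fun _ _ => rfl
  have hact2 : ∀ σ τ X, act (σ * τ) X = act σ (act τ X) := fun σ τ X => Units.ext rfl
  -- `W i = s^{i-1}(P) ⋯ s(P) P` intertwines `φ` with `s^i φ`. All intertwining matrices are thus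
  -- built from the one matrix `P` for the generator `s`.
  let W : ℕ → (Matrix (Fin n) (Fin n) K)ˣ := fun i => Nat.rec 1 (fun i w => act (s ^ i) P * w) i
  have hW0 : W 0 = 1 := rfl
  have hWs : ∀ i, W (i + 1) = act (s ^ i) P * W i := fun _ => rfl
  have hadd : ∀ i j, W (i + j) = act (s ^ i) (W j) * W i := by
    intro i j
    induction j with
    | zero => simp [hW0]
    | succ j ih => rw [← add_assoc, hWs, ih, hWs, map_mul, pow_add, hact2, mul_assoc]
  have hcomm : ∀ i a, (s ^ i).mapMatrix (φ a) * (W i).val = (W i).val * φ a := by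
    intro i
    induction i with
    | zero =>
      intro a
      rw [hW0, Units.val_one, mul_one, one_mul]
      rfl
    | succ i ih =>
      intro a
      have e1 : (s ^ (i + 1)).mapMatrix (φ a) = (s ^ i).mapMatrix (s.mapMatrix (φ a)) := by
        rw [pow_succ]
        rfl
      have e2 : s.mapMatrix (φ a) * P.val = P.val * φ a := hP a
      rw [hWs, Units.val_mul, hact, e1, ← mul_assoc, ← map_mul, e2, map_mul, mul_assoc, ih,
        mul_assoc]
  set q := orderOf s with hq
  have hq0 : 0 < q := orderOf_pos s
  -- Since `s ^ q = 1`, the matrix `W q` commutes with `φ`. The resulting scalar `t` is the constant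
  -- of the cyclic algebra.
  obtain ⟨t, ht⟩ := exists_smul_one_of_commute φ hfin (W q).val (fun a => by
    rw [← hcomm, hq, pow_orderOf_eq_one]
    rfl)
  have ht0 : t ≠ 0 := by
    rintro rfl
    exact (W q).ne_zero (by rw [ht, zero_smul])
  -- Comparing the two expansions of `W (q + 1)`, as `q + 1` and as `1 + q`, shows that `s` fixes
  -- `t`, so `t` lies in `k`.
  have hst : s t = t := by
    have e1 : act s (W q) * W 1 = act (s ^ q) (W 1) * W q := by
      rw [← hadd, add_comm, hadd, pow_one]
    rw [hq, pow_orderOf_eq_one, ← hq] at e1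
    have e2 := congrArg Units.val e1
    rw [Units.val_mul, Units.val_mul, hact, ht, mapMatrix_smul, map_one, smul_mul_assoc, one_mul,
      mul_smul_comm, mul_one] at e2
    exact smul_unit_injective (W 1) e2
  obtain ⟨t0, rfl⟩ : t ∈ Set.range (algebraMap k K) := by
    rw [IsGalois.mem_range_algebraMap_iff_fixed]
    intro σ
    have : Subgroup.zpowers s ≤ MulAction.stabilizer (K ≃ₐ[k] K) t := by
      rw [Subgroup.zpowers_le]
      exact hst
    exact this (hs σ)
  have hmod : ∀ i m, (W (i + q * m)).val = (algebraMap k K t0) ^ m • (W i).val := by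
    intro i m
    induction m with
    | zero => simp
    | succ m ih =>
      rw [mul_add, mul_one, ← add_assoc, hadd, Units.val_mul, hact, ht, mapMatrix_smul, map_one,
        AlgEquiv.commutes, smul_mul_assoc, one_mul, ih, smul_smul, pow_succ']
  have hexp : ∀ σ, ∃ i, i < q ∧ s ^ i = σ := fun σ => by
    obtain ⟨i, hi⟩ := (Submonoid.mem_powers_iff _ _).1
      ((mem_powers_iff_mem_zpowers (x := s)).2 (hs σ))
    exact ⟨i % q, Nat.mod_lt _ hq0, by rw [hq, pow_mod_orderOf, hi]⟩
  choose e he hes using hexp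
  have hemul : ∀ σ τ, (e σ + e τ) % q = e (σ * τ) := by
    intro σ τ
    refine pow_injOn_Iio_orderOf (x := s) (Nat.mod_lt _ hq0) (he _) ?_
    change s ^ ((e σ + e τ) % q) = s ^ e (σ * τ)
    rw [hq, pow_mod_orderOf, pow_add, hes, hes, hes]
  -- The cocycle of a cyclic algebra: adding exponents in `[0, q)` produces one factor `t0` per
  -- carry. Symmetry is that of addition.
  refine ⟨fun σ τ => t0 ^ ((e σ + e τ) / q), fun σ τ => pow_ne_zero _ ?_,
    fun σ τ => by simp only [add_comm], ?_⟩
  · rintro rfl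
    exact ht0 (map_zero _)
  · rw [← mk_matrix A p]
    refine ⟨csaOf k (Matrix (Fin p) (Fin p) A), n, φ, fun σ => W (e σ), rfl, hφ, fun σ a => ?_,
      fun σ τ => ?_⟩
    · have := hcomm (e σ) a
      rwa [hes] at this
    · have e1 := hadd (e σ) (e τ)
      rw [hes] at e1
      have e2 := congrArg Units.val e1
      rw [Units.val_mul, hact, ← Nat.mod_add_div (e σ + e τ) q, hmod, hemul] at e2
      rw [← e2]
      simp only [map_pow]

omit [FiniteDimensional k K] [IsGalois k K] in
lemma finset_prod {J : Type*} (s : Finset J) {b : J → BrauerGroup.{u, u} k}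
    {c : J → (K ≃ₐ[k] K) → (K ≃ₐ[k] K) → K} (h : ∀ j, Represents (b j) (c j)) :
    Represents (∏ j ∈ s, b j) (fun σ τ => ∏ j ∈ s, c j σ τ) := by
  classical
  induction s using Finset.induction_on with
  | empty => simpa using Represents.one
  | insert j s hj ih =>
    simp only [Finset.prod_insert hj]
    exact (h j).mul ih

end Represents

/-- A class in `Dec(K/k)` is represented by a symmetric function with values in the base field. -/
lemma exists_represents_of_mem_dec [IsGalois k K] {b : BrauerGroup.{u, u} k} (hb : b ∈ dec k K) :
    ∃ f : (K ≃ₐ[k] K) → (K ≃ₐ[k] K) → k, (∀ σ τ, f σ τ ≠ 0) ∧ (∀ σ τ, f σ τ = f τ σ) ∧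
      Represents b (fun σ τ => algebraMap k K (f σ τ)) := by
  refine Subgroup.iSup_induction (C := fun b => ∃ f : (K ≃ₐ[k] K) → (K ≃ₐ[k] K) → k,
    (∀ σ τ, f σ τ ≠ 0) ∧ (∀ σ τ, f σ τ = f τ σ) ∧
      Represents b (fun σ τ => algebraMap k K (f σ τ))) _ hb (fun L b hb => ?_) ?_ ?_
  · by_cases hL : IsGalois k L ∧ IsCyclic (L ≃ₐ[k] L)
    · rw [iSup_pos hL] at hb
      have h1 := hL.1
      have h2 := hL.2
      obtain ⟨f, hf0, hfs, hf⟩ := Represents.exists_of_isCyclic hb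
      exact ⟨fun σ τ => f (AlgEquiv.restrictNormalHom L σ) (AlgEquiv.restrictNormalHom L τ),
        fun _ _ => hf0 _ _, fun _ _ => hfs _ _, hf.inflation (K := K)⟩
    -- For `L` not cyclic Galois the inner supremum is empty and contributes only the trivial class.
    · rw [iSup_neg hL, Subgroup.mem_bot] at hb
      subst hb
      exact ⟨fun _ _ => 1, by simp, by simp, by simpa using Represents.one⟩
  · exact ⟨fun _ _ => 1, by simp, by simp, by simpa using Represents.one⟩
  · rintro b b' ⟨f, hf0, hfs, hf⟩ ⟨f', hf0', hfs', hf'⟩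
    exact ⟨fun σ τ => f σ τ * f' σ τ, fun σ τ => mul_ne_zero (hf0 σ τ) (hf0' σ τ),
      fun σ τ => by simp only [hfs σ τ, hfs' σ τ], by simpa using hf.mul hf'⟩

omit [FiniteDimensional k K] in
lemma mk_mem_range_relBrModDecMap_iff (M : IntermediateField k K) {b : BrauerGroup.{u, u} k}
    (hb : b ∈ relBr k K) :
    (QuotientGroup.mk ⟨b, hb⟩ : RelBrModDec k K) ∈ (relBrModDecMap M).range ↔
      ∃ β ∈ relBr k M, β⁻¹ * b ∈ dec k K := by
  constructor
  · rintro ⟨x, hx⟩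
    obtain ⟨β, rfl⟩ := QuotientGroup.mk_surjective x
    exact ⟨β, β.2, (QuotientGroup.eq (s := (dec k K).subgroupOf (relBr k K))
      (a := ⟨β, relBr_le_of_algHom M.val β.2⟩)).1 hx⟩
  · rintro ⟨β, hβ, h⟩
    exact ⟨QuotientGroup.mk ⟨β, hβ⟩, QuotientGroup.eq.2 h⟩

/-- If the class of a crossed product modulo `Dec` comes from `Br(M/k)`, its cocycle is cohomologous
on `Gal(K/M)` to a symmetric function with values in the base field. -/
lemma exists_symmetric_of_mem_range [IsGalois k K] {d : (K ≃ₐ[k] K) × (K ≃ₐ[k] K) → Kˣ}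
    (hd : groupCohomology.IsMulCocycle₂ d) (M : IntermediateField k K)
    (h : CrossedProduct.classModDec hd ∈ (relBrModDecMap M).range) :
    ∃ (a : (K ≃ₐ[k] K) → K) (f : (K ≃ₐ[k] K) → (K ≃ₐ[k] K) → k), (∀ σ τ, f σ τ ≠ 0) ∧
      (∀ σ τ, f σ τ = f τ σ) ∧ (∀ σ ∈ M.fixingSubgroup, a σ ≠ 0) ∧
      ∀ σ ∈ M.fixingSubgroup, ∀ τ ∈ M.fixingSubgroup,
        a σ * σ (a τ) * d (σ, τ) = algebraMap k K (f σ τ) * a (σ * τ) := by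
  obtain ⟨β, hβ, hdec⟩ := (mk_mem_range_relBrModDecMap_iff M _).1 h
  obtain ⟨f, hf0, hfs, hf⟩ := exists_represents_of_mem_dec (inv_mem hdec)
  -- With `f` representing `(β⁻¹ b)⁻¹`, where `b` is the class of the crossed product, the function
  -- `d f` represents `β`, which is split by `M`. Hence `d f` is a coboundary on `Gal(K/M)`;
  -- inverting both the cochain and `f` gives the assertion.
  have h1 := ((Represents.crossedProduct hd).mul hf)
  rw [show brauerClass k (CrossedProduct hd) * (β⁻¹ * brauerClass k (CrossedProduct hd))⁻¹ = β by
    group] at h1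
  obtain ⟨a, ha0, ha⟩ := h1.isCoboundaryOn M hβ
  refine ⟨fun σ => (a σ)⁻¹, fun σ τ => (f σ τ)⁻¹, fun σ τ => inv_ne_zero (hf0 σ τ),
    fun σ τ => by simp only [hfs σ τ], fun σ hσ => inv_ne_zero (ha0 σ hσ), fun σ hσ τ hτ => ?_⟩
  have e0 := ha0 _ hσ
  have e1 := ha0 _ (mul_mem hσ hτ)
  have e2 : σ (a τ) ≠ 0 := by simpa using ha0 _ hτ
  have e3 : algebraMap k K (f σ τ) ≠ 0 := by simpa using hf0 σ τ
  rw [map_inv₀, map_inv₀]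
  field_simp
  linear_combination -ha σ hσ τ hτ

end BrauerTheory

/-! ### Characters and bases of finite abelian groups -/

section FiniteAbelian

/-- Extension of a character of order `p` of a subgroup, given by representatives in `[0, p)`, to
the whole group, given by representatives in `[0, 1)` of values in `ℚ / ℤ`. -/
lemma exists_extend_character {G : Type*} [Group G] [Finite G] (hG : ∀ a b : G, a * b = b * a)
    (H : Subgroup G) {p : ℕ} (hp : p ≠ 0) (ε : H → ℕ) (hεlt : ∀ h, ε h < p)
    (hε : ∀ h h', (ε h + ε h') % p = ε (h * h')) :
    ∃ (e : G → ℚ) (m : G → G → ℤ) (N : Subgroup G), (∀ σ τ, e σ + e τ = e (σ * τ) + m σ τ) ∧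
      (∀ h : H, e h = ε h / p) ∧ (∀ σ ∈ N, e σ = 0) ∧ ∃ _ : N.Normal, IsCyclic (G ⧸ N) := by
  classical
  let _ : CommGroup G := { (inferInstance : Group G) with mul_comm := hG }
  have hp' : (p : ℚ) ≠ 0 := by exact_mod_cast hp
  have : Fact ((0 : ℚ) < 1) := ⟨one_pos⟩
  -- The character `h ↦ ε(h)/p` of `H` with values in `ℚ/ℤ`.
  let χ0 : CharacterModule (Additive H) := AddMonoidHom.mk'
    (fun h => ((ε h.toMul / p : ℚ) : AddCircle (1 : ℚ))) (fun h h' => by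
      rw [← AddCircle.coe_add, toMul_add, ← hε, ← add_div, ← sub_eq_zero, ← AddCircle.coe_sub,
        AddCircle.coe_eq_zero_iff]
      refine ⟨-(((ε h.toMul + ε h'.toMul) / p : ℕ) : ℤ), ?_⟩
      have h1 := Nat.mod_add_div (ε h.toMul + ε h'.toMul) p
      have h2 : (((ε h.toMul + ε h'.toMul) % p : ℕ) : ℚ) +
        p * ((ε h.toMul + ε h'.toMul) / p : ℕ) = ε h.toMul + ε h'.toMul := by exact_mod_cast h1
      rw [← h2]
      generalize (ε h.toMul + ε h'.toMul) / p = t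
      simp only [zsmul_eq_mul, Int.cast_neg, mul_one, Int.cast_natCast]
      field_simp
      ring)
  -- `ℚ/ℤ` is divisible, hence injective, so the character extends to `G`.
  obtain ⟨χ, hχ⟩ := CharacterModule.dual_surjective_of_injective
    (MonoidHom.toAdditive H.subtype).toIntLinearMap H.subtype_injective χ0
  have hχ0 : ∀ h : H, χ (Additive.ofMul (h : G)) = ((ε h / p : ℚ) : AddCircle (1 : ℚ)) :=
    fun h => DFunLike.congr_fun hχ (Additive.ofMul h)
  let e : G → ℚ := fun σ => AddCircle.equivIco (1 : ℚ) 0 (χ (Additive.ofMul σ))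
  have heχ : ∀ σ, ((e σ : ℚ) : AddCircle (1 : ℚ)) = χ (Additive.ofMul σ) := fun σ =>
    (AddCircle.equivIco (1 : ℚ) 0).symm_apply_apply _
  have heI : ∀ σ, e σ ∈ Set.Ico (0 : ℚ) 1 := fun σ => by
    simpa using (AddCircle.equivIco (1 : ℚ) 0 (χ (Additive.ofMul σ))).2
  have huniq : ∀ x y : ℚ, x ∈ Set.Ico (0 : ℚ) 1 → y ∈ Set.Ico (0 : ℚ) 1 →
      (x : AddCircle (1 : ℚ)) = y → x = y := by
    intro x y hx hy hxy
    exact AddCircle.coe_eq_coe_iff_of_mem_Ico (a := 0) (by simpa using hx) (by simpa using hy) |>.1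
      hxy
  have hsum : ∀ σ τ, ∃ m : ℤ, e σ + e τ = e (σ * τ) + m := by
    intro σ τ
    have h1 : ((e σ + e τ - e (σ * τ) : ℚ) : AddCircle (1 : ℚ)) = 0 := by
      rw [AddCircle.coe_sub, AddCircle.coe_add, heχ, heχ, heχ, ofMul_mul, map_add, sub_self]
    obtain ⟨m, hm⟩ := (AddCircle.coe_eq_zero_iff _).1 h1
    refine ⟨m, ?_⟩
    simp only [zsmul_eq_mul, mul_one] at hm
    linarith
  choose m hm using hsum
  let N : Subgroup G := (AddMonoidHom.toMultiplicativeRight χ).ker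
  have hN : ∀ σ, σ ∈ N ↔ χ (Additive.ofMul σ) = 0 := fun σ => Iff.rfl
  refine ⟨e, m, N, hm, fun h => ?_, fun σ hσ => ?_, inferInstance, ?_⟩
  · refine huniq _ _ (heI _) ⟨by positivity, ?_⟩ ((heχ _).trans (hχ0 h))
    rw [div_lt_one (by positivity)]
    exact_mod_cast hεlt h
  · refine huniq _ _ (heI _) ⟨le_rfl, one_pos⟩ ?_
    rw [heχ, (hN σ).1 hσ]
    rfl
  · have : Fintype (G ⧸ N) := Fintype.ofFinite _
    -- `G ⧸ N` embeds into `ℚ/ℤ`. If `x^n = 1`, then `n e(x)` is an integer in `[0, n)` that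
    -- determines `x`, so there are at most `n` such `x`.
    refine isCyclic_of_card_pow_eq_one_le fun n hn => ?_
    have hχq : ∀ x : G ⧸ N, x ^ n = 1 → ∃ j : ℕ, j < n ∧ (n : ℚ) * e x.out = j := by
      intro x hx
      have h1 : χ (Additive.ofMul (x.out ^ n)) = 0 := by
        rw [← hN, ← QuotientGroup.eq_one_iff, QuotientGroup.mk_pow, QuotientGroup.out_eq', hx]
      have h2 : (((n : ℚ) * e x.out : ℚ) : AddCircle (1 : ℚ)) = 0 := by
        rw [← nsmul_eq_mul, AddCircle.coe_nsmul, heχ, ← map_nsmul, ← ofMul_pow, h1]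
      obtain ⟨j, hj⟩ := (AddCircle.coe_eq_zero_iff _).1 h2
      simp only [zsmul_eq_mul, mul_one] at hj
      have h3 := heI x.out
      have hn' : (0 : ℚ) < n := by exact_mod_cast hn
      have h4 : (0 : ℚ) ≤ j := by
        rw [hj]
        exact mul_nonneg hn'.le h3.1
      have h5 : (j : ℚ) < n := by
        rw [hj]
        exact mul_lt_of_lt_one_right hn' h3.2
      lift j to ℕ using by exact_mod_cast h4
      exact ⟨j, by exact_mod_cast h5, by rw [← hj]; simp⟩
    choose! J hJ using hχq
    refine (Finset.card_le_card_of_injOn J (t := Finset.range n) (fun x hx => ?_)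
      fun x hx y hy hxy => ?_).trans (Finset.card_range n).le
    · simp only [Finset.coe_filter, Finset.mem_univ, true_and, Set.mem_ofPred_eq] at hx
      exact Finset.mem_coe.2 (Finset.mem_range.2 (hJ x hx).1)
    · simp only [Finset.coe_filter, Finset.mem_univ, true_and, Set.mem_ofPred_eq] at hx hy
      have hn' : (n : ℚ) ≠ 0 := by exact_mod_cast hn.ne'
      have h1 : e x.out = e y.out := by
        have := (hJ x hx).2.trans ((congrArg Nat.cast hxy).trans (hJ y hy).2.symm)
        exact mul_left_cancel₀ hn' this
      have h2 : χ (Additive.ofMul x.out) = χ (Additive.ofMul y.out) := by rw [← heχ, h1, heχ]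
      have h3 : x.out⁻¹ * y.out ∈ N := by
        rw [hN, ofMul_mul, ofMul_inv, map_add, map_neg, h2, neg_add_cancel]
      rw [← QuotientGroup.out_eq' x, ← QuotientGroup.out_eq' y]
      exact QuotientGroup.eq.2 h3

/-- A finite elementary abelian `p`-group has a basis. -/
lemma exists_basis_of_pow_eq_one {H : Type*} [CommGroup H] [Finite H] {p : ℕ} (hp : p.Prime)
    (hH : ∀ h : H, h ^ p = 1) :
    ∃ (r : ℕ) (b : Fin r → H) (ε : Fin r → H → ℕ), (∀ j h, ε j h < p) ∧
      (∀ j h h', (ε j h + ε j h') % p = ε j (h * h')) ∧ ∀ h, ∏ j, b j ^ ε j h = h := by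
  have : Fact p.Prime := ⟨hp⟩
  let _ : Module (ZMod p) (Additive H) := AddCommGroup.zmodModule (n := p) (fun x => hH x.toMul)
  let B := Module.finBasis (ZMod p) (Additive H)
  refine ⟨_, fun j => (B j).toMul, fun j h => (B.repr (Additive.ofMul h) j).val,
    fun j h => ZMod.val_lt _, fun j h h' => ?_, fun h => ?_⟩
  · change _ = (B.repr (Additive.ofMul (h * h')) j).val
    rw [ofMul_mul, map_add, Finsupp.add_apply, ZMod.val_add]
  · have h1 := B.sum_repr (Additive.ofMul h)
    apply Additive.ofMul.injective
    rw [ofMul_prod]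
    refine Eq.trans (Finset.sum_congr rfl fun j _ => ?_) h1
    rw [ofMul_pow, ofMul_toMul]
    conv_rhs => rw [← ZMod.natCast_zmod_val (B.repr (Additive.ofMul h) j)]
    rw [Nat.cast_smul_eq_nsmul]

end FiniteAbelian

/-! ### From commuting elements of a crossed product to `Br(M/k)` modulo `Dec` -/

namespace BrauerTheory

variable {k : Type u} [Field k] {K : Type u} [Field K] [Algebra k K] [FiniteDimensional k K]
  [IsGalois k K]

/-- The function `(σ, τ) ↦ b^{m(σ, τ)}` with `e(σ) + e(τ) = e(στ) + m(σ, τ)` represents a class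
split by the cyclic extension of `k` that is fixed by a subgroup on which `e` vanishes. -/
lemma exists_mem_dec_represents {e : (K ≃ₐ[k] K) → ℚ} {m : (K ≃ₐ[k] K) → (K ≃ₐ[k] K) → ℤ}
    (hm : ∀ σ τ, e σ + e τ = e (σ * τ) + m σ τ) {N : Subgroup (K ≃ₐ[k] K)}
    (hN : ∀ σ ∈ N, e σ = 0) [N.Normal] [IsCyclic ((K ≃ₐ[k] K) ⧸ N)] (b : kˣ) :
    ∃ β ∈ dec k K, Represents β
      (fun σ τ : K ≃ₐ[k] K => algebraMap k K ((b ^ m σ τ : kˣ) : k)) := by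
  let f : (K ≃ₐ[k] K) × (K ≃ₐ[k] K) → Kˣ := fun στ =>
    Units.map (algebraMap k K).toMonoidHom (b ^ m στ.1 στ.2)
  have hf : groupCohomology.IsMulCocycle₂ f := by
    intro σ τ ρ
    have h1 : σ • f (τ, ρ) = f (τ, ρ) := Units.ext (σ.commutes _)
    -- `m` is the coboundary of the rational cochain `e`, hence an integral cocycle for the trivial
    -- action.
    have h2 : m (σ * τ) ρ + m σ τ = m τ ρ + m σ (τ * ρ) := by
      have e1 := hm σ τ
      have e2 := hm (σ * τ) ρ
      have e3 := hm τ ρ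
      have e4 := hm σ (τ * ρ)
      rw [← mul_assoc] at e4
      have : (m (σ * τ) ρ + m σ τ : ℚ) = m τ ρ + m σ (τ * ρ) := by linarith
      exact_mod_cast this
    rw [h1]
    simp only [f, ← map_mul, ← zpow_add, h2]
  have hR := Represents.crossedProduct hf
  refine ⟨_, ?_, hR⟩
  have hgal : IsGalois k (IntermediateField.fixedField N) := IsGalois.of_fixedField_normal_subgroup N
  refine Subgroup.mem_iSup_of_mem (IntermediateField.fixedField N) (Subgroup.mem_iSup_of_mem
    ⟨hgal, ?_⟩ ?_)
  rotate_left
  · exact isCyclic_of_surjective (IsGalois.normalAutEquivQuotient N)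
      (IsGalois.normalAutEquivQuotient N).surjective
  · refine hR.mem_relBr _ ?_
    rw [IntermediateField.fixingSubgroup_fixedField]
    refine ⟨fun _ => 1, fun _ _ => one_ne_zero, fun σ hσ τ hτ => ?_⟩
    -- On `N` the cochain `e` vanishes, so the cocycle is identically `1` there and the fixed field
    -- of `N` splits the class.
    have h0 : m σ τ = 0 := by
      have := hm σ τ
      rw [hN σ hσ, hN τ hτ, hN _ (mul_mem hσ hτ)] at this
      have h : (m σ τ : ℚ) = 0 := by linarith
      exact_mod_cast h
    simp [f, h0]

/-- If a crossed product contains commuting elements `a_σ x_σ`, for `σ ∈ Gal(K/M)`, whose `p`-th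
powers are in the base field, its class modulo `Dec` comes from `Br(M/k)`. -/
lemma mem_range_of_commute {d : (K ≃ₐ[k] K) × (K ≃ₐ[k] K) → Kˣ}
    (hd : groupCohomology.IsMulCocycle₂ d) (M : IntermediateField k K)
    (hG : ∀ σ τ : K ≃ₐ[k] K, σ * τ = τ * σ) {p : ℕ} (hp : p.Prime)
    (hH : ∀ σ ∈ M.fixingSubgroup, σ ^ p = 1) (a : (K ≃ₐ[k] K) → K)
    (hcomm : ∀ σ ∈ M.fixingSubgroup, ∀ τ ∈ M.fixingSubgroup,
      Commute (CrossedProduct.single hd σ (a σ)) (CrossedProduct.single hd τ (a τ)))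
    (hpow : ∀ σ ∈ M.fixingSubgroup, ∃ b : kˣ,
      CrossedProduct.single hd σ (a σ) ^ p = algebraMap k _ (b : k)) :
    CrossedProduct.classModDec hd ∈ (relBrModDecMap M).range := by
  classical
  let _ : CommGroup (K ≃ₐ[k] K) := { (inferInstance : Group (K ≃ₐ[k] K)) with mul_comm := hG }
  obtain ⟨r, g, ε, hεlt, hε, hg⟩ := exists_basis_of_pow_eq_one (H := M.fixingSubgroup) hp
    (fun h => Subtype.ext (hH h h.2))
  choose b hb using fun j => hpow (g j) (g j).2
  let u : Fin r → CrossedProduct hd := fun j =>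
    CrossedProduct.single hd (g j : K ≃ₐ[k] K) (a (g j))
  -- The `p`-th power of `a_σ x_σ` is a unit, so the coefficient cannot vanish.
  have ha0 : ∀ j, a (g j) ≠ 0 := fun j h0 => by
    have h1 := hb j
    have h2 : CrossedProduct.single hd (g j : K ≃ₐ[k] K) (0 : K) = 0 :=
      CrossedProduct.ext' fun ρ => by simp [CrossedProduct.single]
    rw [h0, h2, zero_pow hp.ne_zero] at h1
    exact ((b j).isUnit.map (algebraMap k (CrossedProduct hd))).ne_zero h1.symm
  -- Pairing each `u j` with its group element keeps track of the degree in `G`. These pairs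
  -- generate a commutative monoid `C`, inside which finite products make sense and can be
  -- rearranged.
  let S : Set ((K ≃ₐ[k] K) × CrossedProduct hd) := Set.range fun j => ((g j : K ≃ₐ[k] K), u j)
  have hS : ∀ x ∈ S, ∀ y ∈ S, x * y = y * x := by
    rintro _ ⟨i, rfl⟩ _ ⟨j, rfl⟩
    exact Prod.ext (hG _ _) (hcomm _ (g i).2 _ (g j).2)
  let C := Submonoid.closure S
  have hCcomm : IsMulCommutative C := Submonoid.isMulCommutative_closure _ hS
  let _ : CommMonoid C :=
    { (inferInstance : Monoid C) with mul_comm := fun a b => mul_comm' a b }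
  let x : Fin r → C := fun j => ⟨_, Submonoid.subset_closure ⟨j, rfl⟩⟩
  have hC : ∀ y ∈ C, ∃ t : K, t ≠ 0 ∧ y.2 = CrossedProduct.single hd y.1 t := by
    intro y hy
    induction hy using Submonoid.closure_induction with
    | mem y hy =>
      obtain ⟨j, rfl⟩ := hy
      exact ⟨_, ha0 j, rfl⟩
    | one => exact ⟨_, inv_ne_zero (Units.ne_zero _), CrossedProduct.one_def⟩
    | mul y z _ _ hy hz =>
      obtain ⟨s, hs0, hs⟩ := hy
      obtain ⟨t, ht0, ht⟩ := hz
      refine ⟨s * y.1 t * d (y.1, z.1), ?_, ?_⟩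
      · simp [hs0, ht0]
      · rw [Prod.snd_mul, hs, ht, CrossedProduct.single_mul_single]
        rfl
  let v : M.fixingSubgroup → C := fun h => ∏ j, x j ^ ε j h
  have hv1 : ∀ h, (v h).1.1 = h := fun h => by
    have h1 := map_prod ((MonoidHom.fst (K ≃ₐ[k] K) (CrossedProduct hd)).comp C.subtype)
      (fun j => x j ^ ε j h) Finset.univ
    have h2 := map_prod M.fixingSubgroup.subtype (fun j => g j ^ ε j h) Finset.univ
    rw [hg] at h2
    exact h1.trans h2.symm
  have hx : ∀ j, ((x j ^ p : C) : (K ≃ₐ[k] K) × CrossedProduct hd) =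
      (1, algebraMap k _ (b j : k)) := fun j =>
    Prod.ext (hH _ (g j).2) (hb j)
  let carry : Fin r → M.fixingSubgroup → M.fixingSubgroup → ℕ := fun j h h' => (ε j h + ε j h') / p
  -- Each exponent `ε j h + ε j h'` is reduced modulo `p`; the excess is a power of `x j ^ p`, whose
  -- second component is the scalar `b j`.
  have hvv : ∀ h h', v h * v h' = v (h * h') * ∏ j, (x j ^ p) ^ carry j h h' := by
    intro h h'
    simp only [v]
    rw [← Finset.prod_mul_distrib, ← Finset.prod_mul_distrib]
    refine Finset.prod_congr rfl fun j _ => ?_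
    rw [← pow_add, ← pow_mul, ← pow_add, ← hε, Nat.mod_add_div]
  have hprod : ∀ h h', ((∏ j, (x j ^ p) ^ carry j h h' : C) :
      (K ≃ₐ[k] K) × CrossedProduct hd).2 = algebraMap k _ (∏ j, (b j : k) ^ carry j h h') := by
    intro h h'
    let φ : k →* (K ≃ₐ[k] K) × CrossedProduct hd :=
      MonoidHom.prod 1 (algebraMap k (CrossedProduct hd)).toMonoidHom
    have h1 : ∀ s : Finset (Fin r), ((∏ j ∈ s, (x j ^ p) ^ carry j h h' : C) :
        (K ≃ₐ[k] K) × CrossedProduct hd) = φ (∏ j ∈ s, (b j : k) ^ carry j h h') := by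
      intro s
      induction s using Finset.induction_on with
      | empty => rw [Finset.prod_empty, Finset.prod_empty, map_one]; rfl
      | insert j s hj ih =>
        rw [Finset.prod_insert hj, Finset.prod_insert hj, map_mul, ← ih, map_pow]
        change ((x j ^ p : C) : (K ≃ₐ[k] K) × CrossedProduct hd) ^ carry j h h' * _ = _
        rw [hx]
        rfl
    rw [h1]
    rfl
  choose t ht0 ht using fun h : M.fixingSubgroup => hC (v h) (v h).2
  -- Reading off coefficients of `v h * v h'`: after the change of cochain `t`, the cocycle `d` is
  -- `∏ b_j^{carry_j}` on `Gal(K/M)`.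
  have hcoc : ∀ h h' : M.fixingSubgroup, t h * (h : K ≃ₐ[k] K) (t h') * d (h, h') =
      algebraMap k K (∏ j, (b j : k) ^ carry j h h') * t (h * h') := by
    intro h h'
    have h1 := congrArg (fun y : C => (y : (K ≃ₐ[k] K) × CrossedProduct hd).2) (hvv h h')
    change (v h).1.2 * (v h').1.2 = (v (h * h')).1.2 * _ at h1
    rw [hprod, ht, ht, ht, CrossedProduct.single_mul_single, hv1, hv1, hv1,
      ← Algebra.commutes, ← Algebra.smul_def] at h1
    have h2 := congrArg (fun f : CrossedProduct hd => f.coeff (h * h')) h1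
    simp only [CrossedProduct.smul_apply, CrossedProduct.single, Subgroup.coe_mul, if_true] at h2
    rw [Algebra.smul_def] at h2
    exact h2
  have hchar := fun j => exists_extend_character hG M.fixingSubgroup hp.ne_zero (ε j) (hεlt j) (hε j)
  choose e m N hm heH hN hnormal hcyc using hchar
  -- Since `e` extends `ε/p`, its integral carries on `Gal(K/M)` are the carries modulo `p`.
  have hmH : ∀ j (h h' : M.fixingSubgroup), m j h h' = carry j h h' := by
    intro j h h'
    have h1 := hm j h h'
    have h2 : e j (h * h' : K ≃ₐ[k] K) = ε j (h * h') / p := heH j (h * h')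
    have hp' : (p : ℚ) ≠ 0 := by exact_mod_cast hp.ne_zero
    have h3 : ((ε j (h * h') : ℕ) : ℚ) + p * (carry j h h' : ℕ) = ε j h + ε j h' := by
      rw [← hε]
      exact_mod_cast Nat.mod_add_div _ _
    rw [heH, heH, h2] at h1
    field_simp at h1
    have h4 : (p : ℚ) * m j h h' = p * (carry j h h' : ℕ) := by linarith
    exact_mod_cast mul_left_cancel₀ hp' h4
  -- The inverse of `b j` makes these classes in `Dec` cancel the factor `∏ b_j^{carry_j}`. The
  -- product with the crossed product is then a coboundary on `Gal(K/M)`, with cochain `t⁻¹`.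
  have hβ := fun j => exists_mem_dec_represents (hm j) (hN j) (b j)⁻¹
  choose β hβdec hβR using hβ
  have hR := (Represents.crossedProduct hd).mul (Represents.finset_prod Finset.univ hβR)
  refine (mk_mem_range_relBrModDecMap_iff M _).2
    ⟨_, hR.mem_relBr M ?_, ?_⟩
  · refine ⟨fun σ => if hσ : σ ∈ M.fixingSubgroup then (t ⟨σ, hσ⟩)⁻¹ else 0, fun σ hσ => ?_,
      fun σ hσ τ hτ => ?_⟩
    · simp only [dif_pos hσ]
      exact inv_ne_zero (ht0 _)
    · have h1 := hcoc ⟨σ, hσ⟩ ⟨τ, hτ⟩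
      simp only [dif_pos hσ, dif_pos hτ, dif_pos (mul_mem hσ hτ), map_inv₀]
      have h2 : ∀ j, ((((b j)⁻¹ ^ m j σ τ : kˣ)) : k) =
          ((b j : k) ^ carry j ⟨σ, hσ⟩ ⟨τ, hτ⟩)⁻¹ := by
        intro j
        rw [hmH j ⟨σ, hσ⟩ ⟨τ, hτ⟩, zpow_natCast, inv_pow, Units.val_inv_eq_inv_val, Units.val_pow_eq_pow_val]
      simp only [h2, map_inv₀, Finset.prod_inv_distrib, ← map_prod]
      have e1 := ht0 ⟨σ, hσ⟩
      have e2 : σ (t ⟨τ, hτ⟩) ≠ 0 := by simpa using ht0 ⟨τ, hτ⟩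
      have e3 : t ⟨σ * τ, mul_mem hσ hτ⟩ ≠ 0 := ht0 _
      have e4 : algebraMap k K (∏ j, (b j : k) ^ carry j ⟨σ, hσ⟩ ⟨τ, hτ⟩) ≠ 0 := by
        rw [map_ne_zero]
        exact Finset.prod_ne_zero_iff.2 fun j _ => pow_ne_zero _ (b j).ne_zero
      change t _ * σ (t _) * d (σ, τ) = algebraMap k K _ * t ⟨σ * τ, mul_mem hσ hτ⟩ at h1
      field_simp
      linear_combination -h1
  · have : (brauerClass k (CrossedProduct hd) * ∏ j, β j)⁻¹ * brauerClass k (CrossedProduct hd) =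
        (∏ j, β j)⁻¹ := by
      rw [mul_inv_rev, inv_mul_cancel_right]
    rw [this]
    exact inv_mem (prod_mem fun j _ => hβdec j)

end BrauerTheory

/-! ### Kummer theory -/

section Kummer

variable {E L : Type*} [Field E] [Field L] [Algebra E L]

lemma algEquiv_ext_of_adjoin_eq_top {S : Set L} (hS : IntermediateField.adjoin E S = ⊤)
    {σ τ : L ≃ₐ[E] L} (h : ∀ x ∈ S, σ x = τ x) : σ = τ := by
  ext x
  have hx : x ∈ IntermediateField.adjoin E S := hS ▸ IntermediateField.mem_top
  induction hx using IntermediateField.adjoin_induction with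
  | mem x hx => exact h x hx
  | algebraMap x => rw [AlgEquiv.commutes, AlgEquiv.commutes]
  | add x y _ _ hx hy => rw [map_add, map_add, hx, hy]
  | inv x _ hx => rw [map_inv₀, map_inv₀, hx]
  | mul x y _ _ hx hy => rw [map_mul, map_mul, hx, hy]

/-- In the presence of a primitive `p`-th root of unity, an automorphism multiplies a `p`-th root of
an element of the base field by a power of the root of unity. -/
lemma exists_apply_eq_pow_mul {p : ℕ} [NeZero p] {ζ : E} (hζ : IsPrimitiveRoot ζ p) {x : L}
    (hx : x ^ p ∈ Set.range (algebraMap E L)) (σ : L ≃ₐ[E] L) :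
    ∃ i : ℕ, σ x = algebraMap E L (ζ ^ i) * x := by
  by_cases h0 : x = 0
  · exact ⟨0, by simp [h0]⟩
  obtain ⟨a, ha⟩ := hx
  have h1 : (σ x / x) ^ p = 1 := by
    rw [div_pow, ← map_pow, ← ha, AlgEquiv.commutes, div_self]
    rw [ha]
    exact pow_ne_zero _ h0
  obtain ⟨i, -, hi⟩ := (hζ.map_of_injective (algebraMap E L).injective).eq_pow_of_pow_eq_one h1
  exact ⟨i, by rw [map_pow, hi, div_mul_cancel₀ _ h0]⟩

/-- Kummer extensions are Galois with an elementary abelian group. -/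
lemma isElementaryAbelianExtension_of_adjoin {p : ℕ} (hp : p.Prime) {ζ : E}
    (hζ : IsPrimitiveRoot ζ p) {S : Set L} (hS : IntermediateField.adjoin E S = ⊤)
    (hpow : ∀ x ∈ S, x ^ p ∈ Set.range (algebraMap E L)) :
    GradedDivision.IsElementaryAbelianExtension E L := by
  have : NeZero p := ⟨hp.ne_zero⟩
  -- A primitive `p`-th root of unity in a field excludes characteristic `p`; this is what makes
  -- `X^p - a` separable for `a ≠ 0`.
  have hpE : (p : E) ≠ 0 := hζ.neZero'.out
  have hint : ∀ x ∈ S, IsIntegral E x ∧ ((minpoly E x).map (algebraMap E L)).Splits ∧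
      IsSeparable E x := by
    intro x hx
    by_cases h0 : x = 0
    · subst h0
      refine ⟨isIntegral_zero, ?_, ?_⟩
      · simp [minpoly.zero]
      · simp [IsSeparable, minpoly.zero, Polynomial.separable_X]
    obtain ⟨a, ha⟩ := hpow x hx
    have ha0 : a ≠ 0 := by
      rintro rfl
      rw [map_zero] at ha
      exact pow_ne_zero p h0 ha.symm
    have hmonic : (Polynomial.X ^ p - Polynomial.C a).Monic :=
      Polynomial.monic_X_pow_sub_C a hp.ne_zero
    have hroot : Polynomial.aeval x (Polynomial.X ^ p - Polynomial.C a) = 0 := by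
      simp [ha]
    have hdvd := minpoly.dvd E x hroot
    refine ⟨⟨_, hmonic, hroot⟩, ?_, (Polynomial.separable_X_pow_sub_C a hpE ha0).of_dvd hdvd⟩
    have hs := X_pow_sub_C_splits_of_isPrimitiveRoot
      (hζ.map_of_injective (algebraMap E L).injective) ha.symm
    refine hs.of_dvd (Polynomial.X_pow_sub_C_ne_zero hp.pos _) ?_
    have := Polynomial.map_dvd (algebraMap E L) hdvd
    simpa using this
  have hnormal : Normal E L := by
    have hmem : ∀ x : L, x ∈ IntermediateField.adjoin E S := fun x => hS ▸ IntermediateField.mem_top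
    have halg : Algebra.IsAlgebraic E L := ⟨fun x => by
      have : Algebra.IsAlgebraic E (IntermediateField.adjoin E S) :=
        IntermediateField.isAlgebraic_adjoin fun x hx => (hint x hx).1
      exact IntermediateField.isAlgebraic_iff.1
        (Algebra.IsAlgebraic.isAlgebraic (⟨x, hmem x⟩ : IntermediateField.adjoin E S))⟩
    exact ⟨fun x => IntermediateField.splits_of_mem_adjoin E L
      (fun x hx => ⟨(hint x hx).1, (hint x hx).2.1⟩) (hmem x)⟩
  have hsep : Algebra.IsSeparable E L := by
    have h1 : Algebra.IsSeparable E (IntermediateField.adjoin E S) :=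
      (IntermediateField.isSeparable_adjoin_iff_isSeparable E L).2 fun x hx => (hint x hx).2.2
    rw [hS] at h1
    exact Algebra.IsSeparable.of_algHom E (⊤ : IntermediateField E L)
      IntermediateField.topEquiv.symm.toAlgHom
  refine ⟨⟨⟩, fun σ τ => ?_, p, hp, fun σ => ?_⟩
  · refine algEquiv_ext_of_adjoin_eq_top hS fun x hx => ?_
    obtain ⟨i, hi⟩ := exists_apply_eq_pow_mul hζ (hpow x hx) σ
    obtain ⟨j, hj⟩ := exists_apply_eq_pow_mul hζ (hpow x hx) τ
    rw [AlgEquiv.mul_apply, AlgEquiv.mul_apply, hi, hj, map_mul, map_mul, AlgEquiv.commutes,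
      AlgEquiv.commutes, hi, hj]
    ring
  · refine algEquiv_ext_of_adjoin_eq_top hS fun x hx => ?_
    obtain ⟨i, hi⟩ := exists_apply_eq_pow_mul hζ (hpow x hx) σ
    have h1 : ∀ j : ℕ, (σ ^ j) x = algebraMap E L (ζ ^ i) ^ j * x := by
      intro j
      induction j with
      | zero => simp
      | succ j ih =>
        rw [pow_succ', AlgEquiv.mul_apply, ih, map_mul, hi, map_pow, AlgEquiv.commutes, pow_succ]
        ring
    rw [h1, ← map_pow, ← pow_mul, mul_comm i p, pow_mul, hζ.pow_eq_one, one_pow, map_one, one_mul]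
    rfl

/-- In an elementary abelian extension of exponent `p`, in the presence of a primitive `p`-th root
of unity, every element is a sum of `p`-th roots of elements of the base field. These are obtained
from the conjugates of the element by linear combinations. -/
lemma mem_closure_of_elementaryAbelian [FiniteDimensional E L] [IsGalois E L] {p : ℕ}
    (hp : p.Prime) {ζ : E} (hζ : IsPrimitiveRoot ζ p)
    (hcomm : ∀ σ τ : L ≃ₐ[E] L, σ * τ = τ * σ) (hexp : ∀ σ : L ≃ₐ[E] L, σ ^ p = 1)
    (R : Subfield E) (hR : ζ ∈ R) (V : AddSubgroup L)
    (hRV : ∀ c ∈ R, ∀ x ∈ V, algebraMap E L c * x ∈ V)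
    (hV : ∀ (σ : L ≃ₐ[E] L), ∀ x ∈ V, σ x ∈ V) {a : L} (ha : a ∈ V) :
    a ∈ AddSubgroup.closure {b | b ∈ V ∧ b ^ p ∈ Set.range (algebraMap E L)} := by
  classical
  have : NeZero p := ⟨hp.ne_zero⟩
  have : Fact p.Prime := ⟨hp⟩
  have hpE : (p : E) ≠ 0 := hζ.neZero'.out
  let G := L ≃ₐ[E] L
  let _ : CommGroup G := { (inferInstance : Group G) with mul_comm := hcomm }
  have hroots : HasEnoughRootsOfUnity E p := ⟨⟨ζ, hζ⟩, inferInstance⟩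
  have : HasEnoughRootsOfUnity E (Monoid.exponent G) :=
    hroots.of_dvd E (Monoid.exponent_dvd_of_forall_pow_eq_one hexp)
  have hfin : Finite (G →* Eˣ) := by
    refine Nat.finite_of_card_ne_zero ?_
    rw [CommGroup.card_monoidHom_of_hasEnoughRootsOfUnity G E]
    exact Nat.card_pos.ne'
  let _ : Fintype (G →* Eˣ) := Fintype.ofFinite _
  let N : ℕ := Fintype.card (G →* Eˣ)
  -- The dual group has the order of `G`, which is a power of `p` and hence invertible in `E`.
  have hN : (N : E) ≠ 0 := by
    have h1 : N = Nat.card G := by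
      rw [← CommGroup.card_monoidHom_of_hasEnoughRootsOfUnity G E, Nat.card_eq_fintype_card]
    obtain ⟨m, hm⟩ := IsPGroup.iff_card.1 (fun g => ⟨1, by rw [pow_one]; exact hexp g⟩ :
      IsPGroup p G)
    rw [h1, hm, Nat.cast_pow]
    exact pow_ne_zero _ hpE
  have hχ : ∀ (χ : G →* Eˣ) (σ : G), (χ σ : E) ^ p = 1 := fun χ σ => by
    rw [← Units.val_pow_eq_pow_val, ← map_pow, hexp, map_one, Units.val_one]
  have hχR : ∀ (χ : G →* Eˣ) (σ : G), (χ σ : E) ∈ R := fun χ σ => by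
    obtain ⟨i, -, hi⟩ := hζ.eq_pow_of_pow_eq_one (hχ χ σ)
    rw [← hi]
    exact pow_mem hR i
  -- `N` times the component of `a` in the `χ`-eigenspace of `G`. As `χ` takes `p`-th roots of unity
  -- as values, its `p`-th power is Galois invariant.
  let e : (G →* Eˣ) → L := fun χ => ∑ σ : G, algebraMap E L (χ σ⁻¹ : E) * σ a
  -- The coefficients are roots of unity and `N⁻¹`, all in `R`. This is the purpose of `R` and `V`:
  -- the decomposition takes place inside any stable `R`-submodule, later a homogeneous component.
  have heV : ∀ χ, algebraMap E L (N : E)⁻¹ * e χ ∈ V := fun χ =>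
    hRV _ (inv_mem (natCast_mem R N)) _ (sum_mem fun σ _ => hRV _ (hχR _ _) _ (hV σ a ha))
  have heτ : ∀ χ τ, (τ : G) (e χ) = algebraMap E L (χ τ : E) * e χ := by
    intro χ τ
    simp only [e, map_sum, Finset.mul_sum]
    rw [← Equiv.sum_comp (Equiv.mulLeft τ) (fun σ => algebraMap E L (χ τ : E) *
      (algebraMap E L (χ σ⁻¹ : E) * σ a))]
    refine Finset.sum_congr rfl fun σ _ => ?_
    have h1 : χ τ * χ (τ * σ)⁻¹ = χ σ⁻¹ := by
      rw [← map_mul, mul_inv_rev, mul_comm, inv_mul_cancel_right]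
    have h2 : τ (algebraMap E L (χ σ⁻¹ : E)) = algebraMap E L (χ σ⁻¹ : E) := AlgEquiv.commutes τ _
    change τ (algebraMap E L (χ σ⁻¹ : E) * σ a) = algebraMap E L (χ τ : E) *
      (algebraMap E L (χ (τ * σ)⁻¹ : E) * τ (σ a))
    rw [map_mul, h2, ← mul_assoc, ← map_mul, ← Units.val_mul, h1]
  have hepow : ∀ χ, (algebraMap E L (N : E)⁻¹ * e χ) ^ p ∈ Set.range (algebraMap E L) := by
    intro χ
    rw [IsGalois.mem_range_algebraMap_iff_fixed]
    intro τ
    rw [map_pow, map_mul, AlgEquiv.commutes, heτ, mul_left_comm, mul_pow, ← map_pow, hχ, map_one,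
      one_mul]
  -- Orthogonality of characters: multiplying by a character `φ` with `φ(σ⁻¹) ≠ 1` permutes the sum.
  -- It implies that the eigencomponents add up to `a`.
  have hsum0 : ∀ σ : G, σ ≠ 1 → ∑ χ : G →* Eˣ, (χ σ⁻¹ : E) = 0 := by
    intro σ hσ
    obtain ⟨φ, hφ⟩ := CommGroup.exists_apply_ne_one_of_hasEnoughRootsOfUnity G E
      (inv_ne_one.2 hσ)
    have h1 : (φ σ⁻¹ : E) * ∑ χ : G →* Eˣ, (χ σ⁻¹ : E) = ∑ χ : G →* Eˣ, (χ σ⁻¹ : E) := by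
      rw [Finset.mul_sum]
      exact Fintype.sum_equiv (Equiv.mulLeft φ) _ _ fun χ => by simp
    rw [← sub_eq_zero, ← sub_one_mul] at h1
    refine (mul_eq_zero.1 h1).resolve_left fun h => hφ (Units.ext ?_)
    rw [sub_eq_zero] at h
    simpa using h
  have hsum : a = ∑ χ : G →* Eˣ, algebraMap E L (N : E)⁻¹ * e χ := by
    rw [← Finset.mul_sum]
    simp only [e]
    rw [Finset.sum_comm]
    simp only [← Finset.sum_mul, ← map_sum]
    rw [Finset.sum_eq_single (1 : G)]
    · simp only [inv_one, map_one, Units.val_one, Finset.sum_const, Finset.card_univ, nsmul_eq_mul,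
        mul_one]
      rw [← mul_assoc, ← map_mul, inv_mul_cancel₀ hN, map_one, one_mul]
      rfl
    · intro σ _ hσ
      rw [hsum0 σ hσ, map_zero, zero_mul]
    · simp
  rw [hsum]
  exact sum_mem fun χ _ => AddSubgroup.subset_closure ⟨heV χ, hepow χ⟩

end Kummer

/-- The prime that kills an elementary abelian group is not prescribed; in a `p`-group, an element
killed by a prime other than `p` is trivial. -/
lemma GradedDivision.IsElementaryAbelian.pow_eq_one {G : Type*} [Group G]
    (h : GradedDivision.IsElementaryAbelian G) {p : ℕ} (hp : p.Prime) (hG : IsPGroup p G) (g : G) :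
    g ^ p = 1 := by
  obtain ⟨-, q, hq, hpow⟩ := h
  obtain ⟨j, hj⟩ := hG g
  by_cases hpq : p = q
  · rw [hpq]
    exact hpow g
  · have h1 : orderOf g ∣ 1 := by
      rw [← Nat.Coprime.gcd_eq_one (((Nat.coprime_primes hp hq).2 hpq).pow_left j)]
      exact Nat.dvd_gcd (orderOf_dvd_of_pow_eq_one hj) (orderOf_dvd_of_pow_eq_one (hpow g))
    rw [orderOf_eq_one_iff.1 (Nat.dvd_one.1 h1), one_pow]

/-! ### Exponents of Galois groups and the field fixed by `G^p` -/

namespace GradedDivision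

section Exponent

variable {k K : Type*} [Field k] [Field K] [Algebra k K]

lemma isAbelianGalois_of_forall_mul_comm [IsGalois k K]
    (hG : ∀ σ τ : K ≃ₐ[k] K, σ * τ = τ * σ) : IsAbelianGalois k K where
  is_comm := ⟨hG⟩

lemma isElementaryAbelianExtension_of_forall_pow_eq_one [IsAbelianGalois k K] {p : ℕ}
    (hp : p.Prime) (h : ∀ σ : K ≃ₐ[k] K, σ ^ p = 1) : IsElementaryAbelianExtension k K :=
  ⟨inferInstance, fun a b => mul_comm' a b, p, hp, h⟩

lemma isElementaryAbelianExtension_of_fixingSubgroup [IsAbelianGalois k K] {p : ℕ}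
    (hp : p.Prime) (M : IntermediateField k K) (h : ∀ σ ∈ M.fixingSubgroup, σ ^ p = 1) :
    IsElementaryAbelianExtension M K := by
  refine isElementaryAbelianExtension_of_forall_pow_eq_one hp fun σ => ?_
  obtain ⟨σ, rfl⟩ := M.fixingSubgroupEquiv.surjective σ
  have h1 : σ ^ p = 1 := Subtype.ext (h σ σ.2)
  rw [← map_pow, h1, map_one]

lemma pow_mem_fixingSubgroup_iff [FiniteDimensional k K] [IsAbelianGalois k K]
    (M : IntermediateField k K) (σ : K ≃ₐ[k] K) (p : ℕ) :
    σ ^ p ∈ M.fixingSubgroup ↔ AlgEquiv.restrictNormalHom M σ ^ p = 1 := by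
  rw [← map_pow, ← MonoidHom.mem_ker, IntermediateField.restrictNormalHom_ker]

lemma isPGroup_of_finrank [FiniteDimensional k K] [IsGalois k K] {p n : ℕ}
    (h : Module.finrank k K = p ^ n) : IsPGroup p (K ≃ₐ[k] K) :=
  IsPGroup.of_card (by rw [IsGalois.card_aut_eq_finrank, h])

lemma fixingSubgroup_pow_eq_one [FiniteDimensional k K] [IsAbelianGalois k K] {p n : ℕ}
    (hp : p.Prime) (h : Module.finrank k K = p ^ n) {M : IntermediateField k K}
    (hM : IsElementaryAbelianExtension M K) : ∀ σ ∈ M.fixingSubgroup, σ ^ p = 1 := by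
  intro σ hσ
  have h1 : IsPGroup p (K ≃ₐ[M] K) :=
    ((isPGroup_of_finrank h).to_subgroup M.fixingSubgroup).of_equiv M.fixingSubgroupEquiv
  have h2 := hM.2.pow_eq_one hp h1 (M.fixingSubgroupEquiv ⟨σ, hσ⟩)
  rw [← map_pow, map_eq_one_iff _ M.fixingSubgroupEquiv.injective] at h2
  exact congrArg Subtype.val h2

lemma intermediateField_pow_eq_one [FiniteDimensional k K] [IsAbelianGalois k K] {p n : ℕ}
    (hp : p.Prime) (h : Module.finrank k K = p ^ n) {M : IntermediateField k K}
    (hM : IsElementaryAbelianExtension k M) : ∀ σ : M ≃ₐ[k] M, σ ^ p = 1 :=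
  hM.2.pow_eq_one hp ((isPGroup_of_finrank h).of_surjective (AlgEquiv.restrictNormalHom M)
    (AlgEquiv.restrictNormalHom_surjective K))

end Exponent

section Brauer

variable {k K : Type u} [Field k] [Field K] [Algebra k K]

/-- A class split by `M` is split by the larger field `L`; the correction in `Dec(K/k)` stays the
same. -/
lemma mem_range_of_le {M L : IntermediateField k K} (hML : M ≤ L)
    {x : BrauerTheory.RelBrModDec k K} (hx : x ∈ (BrauerTheory.relBrModDecMap M).range) :
    x ∈ (BrauerTheory.relBrModDecMap L).range := by
  obtain ⟨⟨b, hb⟩, rfl⟩ := QuotientGroup.mk_surjective x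
  obtain ⟨β, hβ, h⟩ := (BrauerTheory.mk_mem_range_relBrModDecMap_iff M hb).1 hx
  exact (BrauerTheory.mk_mem_range_relBrModDecMap_iff L hb).2
    ⟨β, BrauerTheory.relBr_le_of_algHom (IntermediateField.inclusion hML) hβ, h⟩

lemma mem_range_top (x : BrauerTheory.RelBrModDec k K) :
    x ∈ (BrauerTheory.relBrModDecMap (⊤ : IntermediateField k K)).range := by
  obtain ⟨⟨b, hb⟩, rfl⟩ := QuotientGroup.mk_surjective x
  refine (BrauerTheory.mk_mem_range_relBrModDecMap_iff ⊤ hb).2 ⟨b, ?_, ?_⟩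
  · exact BrauerTheory.relBr_le_of_algHom IntermediateField.topEquiv.symm.toAlgHom hb
  · rw [inv_mul_cancel]
    exact one_mem _

lemma powSubgroup_eq_bot {G : Type*} [Group G] {p : ℕ} (h : Monoid.exponent G = p) :
    powSubgroup G p = ⊥ := by
  rw [powSubgroup, Subgroup.closure_eq_bot_iff]
  rintro _ ⟨a, rfl⟩
  rw [Set.mem_singleton_iff, ← h]
  exact Monoid.pow_exponent_eq_one a

lemma fixedField_powSubgroup_eq_top {p : ℕ} (h : Monoid.exponent (K ≃ₐ[k] K) = p) :
    IntermediateField.fixedField (powSubgroup (K ≃ₐ[k] K) p) = ⊤ := by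
  rw [powSubgroup_eq_bot h, IntermediateField.fixedField_bot]

/-- That `M/k` has exponent `p` means `G^p ⊆ Gal(K/M)`. If moreover `Gal(K/M)` has exponent `p`,
then `exp(G)` divides `p²`, and `M` lies in the field fixed by `G^p`, to which the condition on the
class passes. Conversely, if `exp(G)` divides `p²`, both `G/G^p` and `G^p` are killed by `p`, so
this field can serve as `M`. -/
lemma exists_intermediateField_iff_exponent [FiniteDimensional k K] [IsAbelianGalois k K]
    {p n : ℕ} (hp : p.Prime) (hn : n ≠ 0) (h : Module.finrank k K = p ^ n) (x : BrauerTheory.RelBrModDec k K) :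
    (∃ M : IntermediateField k K, IsElementaryAbelianExtension k M ∧
      IsElementaryAbelianExtension M K ∧ x ∈ (BrauerTheory.relBrModDecMap M).range) ↔
    (Monoid.exponent (K ≃ₐ[k] K) = p ∨ Monoid.exponent (K ≃ₐ[k] K) = p ^ 2) ∧
      x ∈ (BrauerTheory.relBrModDecMap
        (IntermediateField.fixedField (powSubgroup (K ≃ₐ[k] K) p))).range := by
  constructor
  · rintro ⟨M, hM, hM', hx⟩
    have h1 := intermediateField_pow_eq_one hp h hM
    have h2 := fixingSubgroup_pow_eq_one hp h hM'
    have h3 : ∀ σ : K ≃ₐ[k] K, σ ^ p ∈ M.fixingSubgroup := fun σ =>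
      (pow_mem_fixingSubgroup_iff M σ p).2 (h1 _)
    have h4 : Monoid.exponent (K ≃ₐ[k] K) ∣ p ^ 2 :=
      Monoid.exponent_dvd_of_forall_pow_eq_one fun σ => by
        rw [pow_two, pow_mul, h2 _ (h3 σ)]
    refine ⟨?_, mem_range_of_le ?_ hx⟩
    · obtain ⟨j, hj, hj'⟩ := (Nat.dvd_prime_pow hp).1 h4
      interval_cases j
      -- Exponent `1` would make `G` trivial, against `n ≠ 0`.
      · rw [pow_zero, Monoid.exp_eq_one_iff] at hj'
        have h5 : Nat.card (K ≃ₐ[k] K) = 1 := Nat.card_unique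
        rw [IsGalois.card_aut_eq_finrank, h] at h5
        exact absurd h5 (Nat.one_lt_pow hn hp.one_lt).ne'
      · exact Or.inl (by rw [hj', pow_one])
      · exact Or.inr hj'
    · rw [IntermediateField.le_iff_le, powSubgroup, Subgroup.closure_le]
      rintro _ ⟨σ, rfl⟩
      exact h3 σ
  · rintro ⟨he, hx⟩
    have h1 : ∀ σ : K ≃ₐ[k] K, (σ ^ p) ^ p = 1 := by
      intro σ
      rw [← pow_mul, ← pow_two]
      refine orderOf_dvd_iff_pow_eq_one.1 ((Monoid.order_dvd_exponent σ).trans ?_)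
      rcases he with he | he
      · rw [he, pow_two]
        exact Dvd.intro _ rfl
      · rw [he]
    refine ⟨_, isElementaryAbelianExtension_of_forall_pow_eq_one hp fun σ => ?_,
      isElementaryAbelianExtension_of_fixingSubgroup hp _ fun σ hσ => ?_, hx⟩
    · obtain ⟨σ, rfl⟩ := AlgEquiv.restrictNormalHom_surjective K σ
      rw [← pow_mem_fixingSubgroup_iff, IntermediateField.fixingSubgroup_fixedField]
      exact Subgroup.subset_closure ⟨σ, rfl⟩
    · rw [IntermediateField.fixingSubgroup_fixedField] at hσ
      induction hσ using Subgroup.closure_induction with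
      | mem σ hσ =>
        obtain ⟨σ, rfl⟩ := hσ
        exact h1 σ
      | one => exact one_pow p
      | mul σ τ _ _ hσ hτ => rw [Commute.mul_pow (mul_comm' σ τ), hσ, hτ, one_mul]
      | inv σ _ hσ => rw [inv_pow, hσ, inv_one]

end Brauer

end GradedDivision

/-! ### Leading components in graded division rings -/

namespace GradedDivision

variable {Γ : Type v} [AddCommGroup Γ] [LinearOrder Γ]

section Ring

variable {A : Type*} [Ring A] (𝒜 : Γ → AddSubgroup A) [GradedRing 𝒜]

lemma exists_decompose_ne_zero {a : A} (ha : a ≠ 0) :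
    ∃ γ, (DirectSum.decompose 𝒜 a γ : A) ≠ 0 := by
  by_contra! h
  apply ha
  apply (DirectSum.decompose 𝒜).injective
  rw [DirectSum.decompose_zero]
  exact DFinsupp.ext fun γ => Subtype.ext (h γ)

lemma exists_top {a : A} (ha : a ≠ 0) :
    ∃ γ, (DirectSum.decompose 𝒜 a γ : A) ≠ 0 ∧
      ∀ i, γ < i → (DirectSum.decompose 𝒜 a i : A) = 0 := by
  classical
  obtain ⟨γ, hγ⟩ := exists_decompose_ne_zero 𝒜 ha
  have hmem : ∀ i, i ∈ (DirectSum.decompose 𝒜 a).support ↔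
      (DirectSum.decompose 𝒜 a i : A) ≠ 0 := fun i => by
    rw [DFinsupp.mem_support_iff, Ne, Ne, ZeroMemClass.coe_eq_zero]
  have hne : (DirectSum.decompose 𝒜 a).support.Nonempty := ⟨γ, (hmem γ).2 hγ⟩
  refine ⟨_, (hmem _).1 (Finset.max'_mem _ hne), fun i hi => ?_⟩
  by_contra h
  exact (Finset.le_max' _ i ((hmem i).2 h)).not_gt hi

section Ordered

variable [IsOrderedAddMonoid Γ]

/-- In an ordered group, `i ≤ γ`, `j ≤ δ` and `i + j = γ + δ` force `i = γ` and `j = δ`, so a single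
product contributes in the top degree. The components at `γ` and `δ` may vanish, which allows the
lemma to be iterated. -/
lemma decompose_mul_top {a b : A} {γ δ : Γ}
    (ha : ∀ i, γ < i → (DirectSum.decompose 𝒜 a i : A) = 0)
    (hb : ∀ i, δ < i → (DirectSum.decompose 𝒜 b i : A) = 0) :
    (DirectSum.decompose 𝒜 (a * b) (γ + δ) : A) =
        DirectSum.decompose 𝒜 a γ * DirectSum.decompose 𝒜 b δ ∧
      ∀ i, γ + δ < i → (DirectSum.decompose 𝒜 (a * b) i : A) = 0 := by
  classical
  have hle : ∀ {c : A} {ε : Γ}, (∀ i, ε < i → (DirectSum.decompose 𝒜 c i : A) = 0) →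
      ∀ i ∈ (DirectSum.decompose 𝒜 c).support, i ≤ ε := by
    intro c ε hc i hi
    by_contra h
    rw [DFinsupp.mem_support_iff] at hi
    exact hi (Subtype.ext (hc i (not_le.1 h)))
  refine ⟨?_, fun i hi => ?_⟩
  · rw [DirectSum.decompose_mul, DirectSum.coe_mul_apply, Finset.sum_eq_single (γ, δ)]
    · rintro ⟨i, j⟩ hij hne
      rw [Finset.mem_filter, Finset.mem_product] at hij
      have h1 := hle ha i hij.1.1
      have h2 := hle hb j hij.1.2
      have h3 : i + j = γ + δ := hij.2
      have h4 : i = γ := by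
        refine h1.antisymm (not_lt.1 fun h => ?_)
        exact (add_lt_add_of_lt_of_le h h2).ne h3
      subst h4
      exact absurd (by rw [add_left_cancel h3]) hne
    · intro h
      simp only [Finset.mem_filter, Finset.mem_product, DFinsupp.mem_support_iff, and_true,
        not_and_or, not_not] at h
      rcases h with h | h <;> simp [h]
  · rw [DirectSum.decompose_mul, DirectSum.coe_mul_apply]
    refine Finset.sum_eq_zero ?_
    rintro ⟨j, l⟩ hjl
    rw [Finset.mem_filter, Finset.mem_product] at hjl
    have h3 : j + l = i := hjl.2
    exact absurd (h3 ▸ add_le_add (hle ha j hjl.1.1) (hle hb l hjl.1.2)) hi.not_ge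

lemma decompose_pow_top {a : A} {γ : Γ}
    (ha : ∀ i, γ < i → (DirectSum.decompose 𝒜 a i : A) = 0) (n : ℕ) :
    (DirectSum.decompose 𝒜 (a ^ n) (n • γ) : A) = (DirectSum.decompose 𝒜 a γ : A) ^ n ∧
      ∀ i, n • γ < i → (DirectSum.decompose 𝒜 (a ^ n) i : A) = 0 := by
  induction n with
  | zero =>
    rw [pow_zero, pow_zero, zero_nsmul]
    refine ⟨DirectSum.decompose_of_mem_same 𝒜 (SetLike.one_mem_graded 𝒜), fun i hi => ?_⟩
    exact DirectSum.decompose_of_mem_ne 𝒜 (SetLike.one_mem_graded 𝒜) hi.ne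
  | succ n ih =>
    have h := decompose_mul_top 𝒜 ih.2 ha
    rw [ih.1] at h
    rwa [pow_succ, pow_succ, succ_nsmul]

/-- Leading components of nonzero elements are units, so their product, the leading component of the
product, is nonzero. -/
lemma isDomain_of_isGradedDivisionRing [IsGradedDivisionRing 𝒜] : IsDomain A := by
  have := nontrivial_of_isGradedDivisionRing 𝒜
  have : NoZeroDivisors A := ⟨fun {a b} hab => by
    by_contra! h
    obtain ⟨γ, hγ, hγ'⟩ := exists_top 𝒜 h.1
    obtain ⟨δ, hδ, hδ'⟩ := exists_top 𝒜 h.2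
    have h1 := (decompose_mul_top 𝒜 hγ' hδ').1
    have h2 := IsGradedDivisionRing.isUnit_of_mem γ _ (SetLike.coe_mem _) hγ
    rw [hab, DirectSum.decompose_zero, eq_comm] at h1
    exact hδ (h2.mul_right_eq_zero.1 h1)⟩
  exact NoZeroDivisors.to_isDomain A

/-- If the quotient of two commuting elements has a power of degree `0`, then it has
degree `0`. -/
lemma exists_eq_mul_of_pow_eq [IsGradedDivisionRing 𝒜] (P : Subring A)
    (hdec : ∀ a ∈ P, ∀ γ, (DirectSum.decompose 𝒜 a γ : A) ∈ P)
    (hcomm : ∀ a ∈ P, ∀ b ∈ P, a * b = b * a)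
    (hinv : ∀ a ∈ P, ∀ γ, a ∈ 𝒜 γ → a ≠ 0 → ∃ b ∈ P, a * b = 1)
    {a b m : A} (ha : a ∈ P) (hb : b ∈ P) (hm0 : m ∈ 𝒜 0) (ha0 : a ≠ 0) (hb0 : b ≠ 0) {N : ℕ}
    (hN : (N : A) ≠ 0) (h : a ^ N = m * b ^ N) :
    ∃ u ∈ P, u ∈ 𝒜 0 ∧ a = u * b := by
  have := isDomain_of_isGradedDivisionRing 𝒜
  have hN0 : N ≠ 0 := by
    rintro rfl
    exact hN Nat.cast_zero
  have hmne : m ≠ 0 := by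
    rintro rfl
    rw [zero_mul] at h
    exact pow_ne_zero N ha0 h
  obtain ⟨γ, hγ, hγ'⟩ := exists_top 𝒜 ha0
  obtain ⟨δ, hδ, hδ'⟩ := exists_top 𝒜 hb0
  obtain ⟨t, htP, ht⟩ := hinv _ (hdec b hb δ) δ (SetLike.coe_mem _) hδ
  have ht' : (DirectSum.decompose 𝒜 b δ : A) * t = 1 := ht
  have hm' : ∀ i, 0 < i → (DirectSum.decompose 𝒜 m i : A) = 0 := fun i hi =>
    DirectSum.decompose_of_mem_ne 𝒜 hm0 hi.ne
  have h1 := decompose_pow_top 𝒜 hγ' N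
  have h2 := decompose_mul_top 𝒜 hm' (decompose_pow_top 𝒜 hδ' N).2
  rw [(decompose_pow_top 𝒜 hδ' N).1, DirectSum.decompose_of_mem_same 𝒜 hm0, zero_add, ← h] at h2
  -- Comparing leading degrees in `a ^ N = m * b ^ N` gives `N • γ = N • δ`, and an ordered group
  -- has no torsion.
  have hdeg : γ = δ := by
    have h3 : N • γ = N • δ := by
      rcases lt_trichotomy (N • γ) (N • δ) with h3 | h3 | h3
      · have h4 := h2.1
        rw [h1.2 _ h3] at h4
        exact absurd h4.symm (mul_ne_zero hmne (pow_ne_zero N hδ))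
      · exact h3
      · have h4 := h1.1
        rw [h2.2 _ h3] at h4
        exact absurd h4.symm (pow_ne_zero N hγ)
    exact nsmul_right_injective hN0 h3
  subst hdeg
  set s : A := (DirectSum.decompose 𝒜 a γ : A) with hs
  set r : A := (DirectSum.decompose 𝒜 b γ : A) with hr
  have hsP : s ∈ P := hdec a ha γ
  have hrP : r ∈ P := hdec b hb γ
  have hsr : s ^ N = m * r ^ N := h1.1.symm.trans h2.1
  have hur : s * t * r = s := by rw [mul_assoc, hcomm t htP r hrP, ht', mul_one]
  have htγ : t ∈ 𝒜 (-γ) := by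
    obtain ⟨v, hv⟩ := IsGradedDivisionRing.isUnit_of_mem γ r (SetLike.coe_mem _) hδ
    have h5 := inv_mem 𝒜 v (hv ▸ SetLike.coe_mem (DirectSum.decompose 𝒜 b γ) : (v : A) ∈ 𝒜 γ)
    rwa [Units.inv_eq_of_mul_eq_one_right (by rw [hv, ht'])] at h5
  have hu0 : s * t ∈ 𝒜 0 := by
    have h5 := SetLike.mul_mem_graded (SetLike.coe_mem (DirectSum.decompose 𝒜 a γ)) htγ
    rwa [add_neg_cancel] at h5
  have huP : s * t ∈ P := P.mul_mem hsP htP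
  -- The candidate `u` is the quotient `s / r` of the leading components.
  refine ⟨s * t, huP, hu0, ?_⟩
  have hpow : (s * t) ^ N = m := by
    have h6 : (s * t) ^ N * r ^ N = m * r ^ N := by
      rw [← (show Commute (s * t) r from hcomm _ huP _ hrP).mul_pow, hur, hsr]
    exact mul_right_cancel₀ (pow_ne_zero N hδ) h6
  have hc : (s * t * b) ^ N = a ^ N := by
    rw [(show Commute (s * t) b from hcomm _ huP _ hb).mul_pow, hpow, h]
  have hac : Commute a (s * t * b) := hcomm _ ha _ (P.mul_mem huP hb)
  -- `a ^ N - (u b) ^ N` is `a - u b` times a sum of `N` terms, each with leading component `s ^ (N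
  -- - 1)`. The sum has leading component `N s ^ (N - 1) ≠ 0`, so it is nonzero and `a = u b`.
  have h7 := hac.mul_geom_sum₂ N
  rw [hc, sub_self] at h7
  refine sub_eq_zero.1 ((mul_eq_zero.1 h7).resolve_right fun h8 => ?_)
  have htop : (DirectSum.decompose 𝒜 (s * t * b) γ : A) = s ∧
      ∀ i, γ < i → (DirectSum.decompose 𝒜 (s * t * b) i : A) = 0 := by
    have h9 := decompose_mul_top 𝒜 (γ := 0)
      (fun i hi => DirectSum.decompose_of_mem_ne 𝒜 hu0 hi.ne) hδ'
    rwa [zero_add, DirectSum.decompose_of_mem_same 𝒜 hu0, ← hr, hur] at h9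
  have h10 := congrArg (fun c : A => (DirectSum.decompose 𝒜 c ((N - 1) • γ) : A)) h8
  simp only [DirectSum.decompose_sum, DirectSum.decompose_zero, DirectSum.sum_apply,
    AddSubmonoidClass.coe_finsetSum] at h10
  have h11 : ∀ i ∈ Finset.range N,
      (DirectSum.decompose 𝒜 (a ^ i * (s * t * b) ^ (N - 1 - i)) ((N - 1) • γ) : A) =
        s ^ (N - 1) := by
    intro i hi
    rw [Finset.mem_range] at hi
    have h12 := (decompose_mul_top 𝒜 (decompose_pow_top 𝒜 hγ' i).2
      (decompose_pow_top 𝒜 htop.2 (N - 1 - i)).2).1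
    rwa [(decompose_pow_top 𝒜 hγ' i).1, (decompose_pow_top 𝒜 htop.2 (N - 1 - i)).1, htop.1,
      ← hs, ← pow_add, ← add_nsmul, show i + (N - 1 - i) = N - 1 by omega] at h12
  rw [Finset.sum_congr rfl h11, Finset.sum_const, Finset.card_range, nsmul_eq_mul] at h10
  exact mul_ne_zero hN (pow_ne_zero _ hγ) h10

end Ordered

end Ring

/-! ### Centralizers and maximal graded subfields -/

section Centralizer

variable {F D : Type u} [CommRing F] [Ring D] [Algebra F D]
variable (𝒟 : Γ → AddSubgroup D) [GradedRing 𝒟]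

/-- Commuting with a homogeneous element can be tested degree by degree, and `X` contains the
components of its elements. -/
lemma decompose_mem_centralizer {X : Set D}
    (hX : ∀ a ∈ X, ∀ γ, (DirectSum.decompose 𝒟 a γ : D) ∈ X) {w : D}
    (hw : w ∈ Subalgebra.centralizer F X) (γ : Γ) :
    (DirectSum.decompose 𝒟 w γ : D) ∈ Subalgebra.centralizer F X := by
  classical
  rw [Subalgebra.mem_centralizer_iff] at hw ⊢
  intro x hx
  have h1 : ∀ δ, (DirectSum.decompose 𝒟 x δ : D) * DirectSum.decompose 𝒟 w γ =
      DirectSum.decompose 𝒟 w γ * DirectSum.decompose 𝒟 x δ := by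
    intro δ
    have h2 := hw _ (hX x hx δ)
    have h3 := DirectSum.coe_decompose_mul_add_of_left_mem 𝒟 (j := γ) (b := w)
      (SetLike.coe_mem (DirectSum.decompose 𝒟 x δ))
    have h4 := DirectSum.coe_decompose_mul_add_of_right_mem 𝒟 (i := γ) (a := w)
      (SetLike.coe_mem (DirectSum.decompose 𝒟 x δ))
    rw [← h3, ← h4, h2, add_comm]
  rw [← DirectSum.sum_support_decompose 𝒟 x, Finset.sum_mul, Finset.mul_sum]
  exact Finset.sum_congr rfl fun δ _ => h1 δ

lemma isGradedSubfield_centralizer [IsGradedDivisionRing 𝒟] {X : Set D}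
    (hX : ∀ a ∈ X, ∀ γ, (DirectSum.decompose 𝒟 a γ : D) ∈ X)
    (hcomm : ∀ a ∈ Subalgebra.centralizer F X, ∀ b ∈ Subalgebra.centralizer F X, a * b = b * a) :
    IsGradedSubfield 𝒟 (Subalgebra.centralizer F X) where
  decompose_mem a ha γ := decompose_mem_centralizer 𝒟 hX ha γ
  isMulCommutative := ⟨⟨fun a b => Subtype.ext (hcomm a a.2 b b.2)⟩⟩
  inv_mem a ha γ haγ ha0 := by
    obtain ⟨u, rfl⟩ := IsGradedDivisionRing.isUnit_of_mem γ a haγ ha0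
    refine ⟨(u⁻¹ : Dˣ), ?_, u.mul_inv⟩
    rw [Subalgebra.mem_centralizer_iff] at ha ⊢
    intro x hx
    exact (Commute.units_inv_right (show Commute x u from ha x hx)).eq

variable {𝒟}

lemma IsGradedSubfield.mul_comm {P : Subalgebra F D} (hP : IsGradedSubfield 𝒟 P) {a b : D}
    (ha : a ∈ P) (hb : b ∈ P) : a * b = b * a := by
  have := hP.isMulCommutative
  exact congrArg Subtype.val (mul_comm' (⟨a, ha⟩ : P) ⟨b, hb⟩)

/-- A maximal graded subfield contains every homogeneous element that commutes with it. -/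
lemma mem_of_maximal [IsGradedDivisionRing 𝒟] {P : Subalgebra F D}
    (hP : Maximal (IsGradedSubfield 𝒟) P) {a : D} {γ : Γ} (ha : a ∈ 𝒟 γ) (hcomm : ∀ b ∈ P, b * a = a * b) : a ∈ P := by
  let X : Set D := insert a P
  have hX : ∀ b ∈ X, ∀ δ, (DirectSum.decompose 𝒟 b δ : D) ∈ X := by
    rintro b (rfl | hb) δ
    · by_cases h : γ = δ
      · subst h
        rw [DirectSum.decompose_of_mem_same 𝒟 ha]
        exact Set.mem_insert _ _
      · rw [DirectSum.decompose_of_mem_ne 𝒟 ha h]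
        exact Set.mem_insert_of_mem _ P.zero_mem
    · exact Set.mem_insert_of_mem _ (hP.prop.decompose_mem b hb δ)
  have hXX : ∀ b ∈ X, ∀ c ∈ X, b * c = c * b := by
    rintro b (rfl | hb) c (rfl | hc)
    · rfl
    · exact (hcomm c hc).symm
    · exact hcomm b hb
    · exact hP.prop.mul_comm hb hc
  have hXC : X ⊆ Subalgebra.centralizer F X := fun b hb =>
    (Subalgebra.mem_centralizer_iff F).2 fun c hc => hXX c hc b hb
  have hle : ∀ b ∈ Subalgebra.centralizer F (Subalgebra.centralizer F X : Set D),
      b ∈ Subalgebra.centralizer F X := fun b hb =>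
    (Subalgebra.mem_centralizer_iff F).2 fun c hc => (Subalgebra.mem_centralizer_iff F).1 hb c (hXC hc)
  -- The double centralizer of `P ∪ {a}` is commutative because `P ∪ {a}` is, and as a centralizer
  -- it is closed under components and inverses. By maximality of `P` it is contained in `P`.
  have hsub := isGradedSubfield_centralizer (F := F) 𝒟
    (X := (Subalgebra.centralizer F X : Set D))
    (fun b hb δ => decompose_mem_centralizer 𝒟 hX hb δ)
    (fun b hb c hc => ((Subalgebra.mem_centralizer_iff F).1 hc b (hle b hb)))
  have hXCC : X ⊆ Subalgebra.centralizer F (Subalgebra.centralizer F X : Set D) := fun b hb =>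
    (Subalgebra.mem_centralizer_iff F).2 fun c hc => ((Subalgebra.mem_centralizer_iff F).1 hc b hb).symm
  exact hP.le_of_ge hsub (fun b hb => hXCC (Set.mem_insert_of_mem _ hb))
    (hXCC (Set.mem_insert _ _))

end Centralizer

end GradedDivision

/-! ### Homogeneous elements of `D` and the crossed product -/

namespace GradedDivision

variable {Γ : Type v} [AddCommGroup Γ] [LinearOrder Γ]
variable {F D : Type u} [CommRing F] [Ring D] [Algebra F D]
variable {ℱ : Γ → AddSubgroup F} {𝒟 : Γ → AddSubgroup D} [GradedRing ℱ] [GradedRing 𝒟]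
variable [IsGradedDivisionRing 𝒟] [IsMulCommutative (𝒟 0)] [IsGradedAlgebra ℱ 𝒟]

lemma exists_algebraMap_eq_of_mem_range (a : 𝒟 0)
    (h : (a : D) ∈ Set.range (algebraMap F D)) : ∃ c : ℱ 0, algebraMap (ℱ 0) (𝒟 0) c = a := by
  obtain ⟨f, hf⟩ := h
  refine ⟨DirectSum.decompose ℱ f 0, Subtype.ext ?_⟩
  rw [coe_algebraMap_zero, ← decompose_algebraMap ℱ 𝒟, hf]
  exact DirectSum.decompose_of_mem_same 𝒟 a.2

variable [IsGradedDivisionRing ℱ]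

/-- The group is the image under `theta` of the abelian group `gradeGroup 𝒟`. -/
lemma gal_mul_comm [Module.Finite F D] [IsSemiramified ℱ 𝒟] [Algebra.IsCentral F D]
    (σ τ : 𝒟 0 ≃ₐ[ℱ 0] 𝒟 0) : σ * τ = τ * σ := by
  obtain ⟨γ, hγ⟩ := theta_surjective ℱ 𝒟 (Additive.ofMul σ)
  obtain ⟨δ, hδ⟩ := theta_surjective ℱ 𝒟 (Additive.ofMul τ)
  refine Additive.ofMul.injective ?_
  rw [ofMul_mul, ofMul_mul, ← hγ, ← hδ, ← map_add, ← map_add, add_comm]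

namespace CocycleData

variable [Module.Finite F D] [IsSemiramified ℱ 𝒟] [Algebra.IsCentral F D] (S : CocycleData ℱ 𝒟)

/-- The homogeneous element `a z^{m(σ)}` of `D`, which corresponds to the element `a u_σ` of the
crossed product. -/
noncomputable def homog (σ : 𝒟 0 ≃ₐ[ℱ 0] 𝒟 0) (a : 𝒟 0) : D := a * S.zPow (S.exponents σ)

lemma homog_mem (σ : 𝒟 0 ≃ₐ[ℱ 0] 𝒟 0) (a : 𝒟 0) :
    S.homog σ a ∈ 𝒟 (∑ i, S.exponents σ i • S.δ i) := by
  have h := SetLike.mul_mem_graded a.2 (S.zPow_mem (S.exponents σ))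
  rwa [zero_add] at h

lemma zPow_mul (σ : 𝒟 0 ≃ₐ[ℱ 0] 𝒟 0) (b : 𝒟 0) :
    (S.zPow (S.exponents σ) : D) * b = (σ b : 𝒟 0) * S.zPow (S.exponents σ) := by
  have h := congrArg (fun ρ : 𝒟 0 ≃ₐ[ℱ 0] 𝒟 0 => ((ρ b : 𝒟 0) : D)) (S.conj_exponents σ)
  simp only [coe_conj] at h
  rw [← h, Units.inv_mul_cancel_right]

lemma homog_mul_coe (σ : 𝒟 0 ≃ₐ[ℱ 0] 𝒟 0) (a b : 𝒟 0) :
    S.homog σ a * b = (σ b : 𝒟 0) * S.homog σ a := by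
  rw [homog, mul_assoc, S.zPow_mul, ← mul_assoc, ← mul_assoc]
  exact congrArg (· * (S.zPow (S.exponents σ) : D)) (congrArg Subtype.val (mul_comm a (σ b)))

lemma coe_mul_homog (σ : 𝒟 0 ≃ₐ[ℱ 0] 𝒟 0) (a b : 𝒟 0) :
    (b : D) * S.homog σ a = S.homog σ (b * a) := (mul_assoc _ _ _).symm

lemma zPow_mul_zPow (σ τ : 𝒟 0 ≃ₐ[ℱ 0] 𝒟 0) :
    (S.zPow (S.exponents σ) : D) * S.zPow (S.exponents τ) =
      ((S.d (σ, τ) : 𝒟 0) : D) * S.zPow (S.exponents (σ * τ)) *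
        algebraMap F D (S.hCocycle σ τ) := by
  have h : S.zPow (S.exponents σ) * S.zPow (S.exponents τ) =
      S.dUnit σ τ * Units.map (algebraMap F D).toMonoidHom (S.hCocycle σ τ) *
        S.zPow (S.exponents (σ * τ)) := by
    rw [dUnit]
    group
  rw [coe_d, ← Units.val_mul, h, Units.val_mul, Units.val_mul, mul_assoc, mul_assoc]
  exact congrArg _ (Algebra.commutes _ _)

/-- This is the multiplication rule of the crossed product, up to a central factor that is symmetric
in `σ` and `τ`; relations between homogeneous elements of `D` and between elements `a u_σ` are
translated through it. -/
lemma homog_mul_homog (σ τ : 𝒟 0 ≃ₐ[ℱ 0] 𝒟 0) (a b : 𝒟 0) :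
    S.homog σ a * S.homog τ b =
      S.homog (σ * τ) (a * σ b * S.d (σ, τ)) * algebraMap F D (S.hCocycle σ τ) := by
  rw [homog, homog, mul_assoc, ← mul_assoc (S.zPow (S.exponents σ) : D), S.zPow_mul,
    mul_assoc _ _ (S.zPow (S.exponents τ) : D), S.zPow_mul_zPow, homog]
  simp only [← mul_assoc]
  rfl

lemma hCocycle_comm (σ τ : 𝒟 0 ≃ₐ[ℱ 0] 𝒟 0) : S.hCocycle σ τ = S.hCocycle τ σ := by
  simp only [hCocycle, carry, add_comm]

lemma homog_injective (σ : 𝒟 0 ≃ₐ[ℱ 0] 𝒟 0) : Function.Injective (S.homog σ) := fun _ _ h =>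
  Subtype.ext ((S.zPow (S.exponents σ)).isUnit.mul_left_injective h)

/-- Cancelling one factor in the relation for `z^{m(1)} z^{m(1)}` evaluates `z^{m(1)}` without
computing `m(1)`. -/
lemma homog_one (a : 𝒟 0) :
    S.homog 1 a = (a * S.d (1, 1) : 𝒟 0) * algebraMap F D (S.hCocycle 1 1) := by
  have h := S.zPow_mul_zPow 1 1
  rw [mul_one, mul_assoc, ← Algebra.commutes, ← mul_assoc] at h
  have h1 := (S.zPow (S.exponents 1)).isUnit.mul_left_injective h
  rw [homog, h1, ← mul_assoc]
  rfl

lemma isUnit_homog (σ : 𝒟 0 ≃ₐ[ℱ 0] 𝒟 0) {a : 𝒟 0} (ha : a ≠ 0) : IsUnit (S.homog σ a) :=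
  (IsGradedDivisionRing.isUnit_of_mem 0 (a : D) a.2 fun h => ha (Subtype.ext h)).mul
    (S.zPow (S.exponents σ)).isUnit

/-- Every homogeneous unit of `D` is a product of a unit of `D₀`, an element `z^{m(σ)}`, and a
homogeneous unit of `F`. -/
lemma exists_eq_homog {γ : Γ} (w : Dˣ) (hw : (w : D) ∈ 𝒟 γ) :
    ∃ (e : 𝒟 0) (φ : Fˣ), e ≠ 0 ∧
      (w : D) = S.homog (conj ℱ 𝒟 w hw) e * algebraMap F D φ := by
  set σ := conj ℱ 𝒟 w hw with hσ
  let ε : Γ := ∑ i, S.exponents σ i • S.δ i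
  have hε : ε ∈ gradeGroup 𝒟 := ⟨_, S.zPow_mem (S.exponents σ)⟩
  have hγ : γ ∈ gradeGroup 𝒟 := ⟨w, hw⟩
  -- `w` and `z^{m(σ)}` induce the same automorphism of `D₀`, so their degrees differ by an element
  -- of `Γ_F`, which a unit `φ` of `F` makes up for.
  have h0 : theta ℱ 𝒟 (⟨γ, hγ⟩ - ⟨ε, hε⟩) = 0 := by
    rw [map_sub, theta_eq_conj ℱ 𝒟 ⟨γ, hγ⟩ w hw,
      theta_eq_conj ℱ 𝒟 ⟨ε, hε⟩ _ (S.zPow_mem (S.exponents σ)), S.conj_exponents, ← hσ, sub_self]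
  rw [theta_eq_zero_iff] at h0
  obtain ⟨φ, hφ⟩ := h0
  let φ' : Dˣ := Units.map (algebraMap F D).toMonoidHom φ
  have he : ((w * φ'⁻¹ * (S.zPow (S.exponents σ))⁻¹ : Dˣ) : D) ∈ 𝒟 0 := by
    have h1 := SetLike.mul_mem_graded (SetLike.mul_mem_graded hw
      (inv_mem 𝒟 _ (unitsMap_mem ℱ 𝒟 φ hφ))) (inv_mem 𝒟 _ (S.zPow_mem (S.exponents σ)))
    have h2 : γ + -((⟨γ, hγ⟩ - ⟨ε, hε⟩ : gradeGroup 𝒟) : Γ) + -ε = 0 := by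
      rw [AddSubgroup.coe_sub]
      abel
    change _ ∈ 𝒟 (γ + -((⟨γ, hγ⟩ - ⟨ε, hε⟩ : gradeGroup 𝒟) : Γ) + -ε) at h1
    rwa [h2] at h1
  have := nontrivial_of_isGradedDivisionRing 𝒟
  refine ⟨⟨_, he⟩, φ, fun h =>
    (w * φ'⁻¹ * (S.zPow (S.exponents σ))⁻¹).ne_zero (congrArg Subtype.val h), ?_⟩
  change (w : D) = ((w * φ'⁻¹ * (S.zPow (S.exponents σ))⁻¹ : Dˣ) : D) *
    (S.zPow (S.exponents σ) : D) * (φ' : Dˣ)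
  rw [← Units.val_mul, ← Units.val_mul]
  congr 1
  group

/-- The point is that the same coefficient `b` occurs on both sides. Exponents start at `1`, where
the coefficient is `a` itself. -/
lemma exists_homog_pow (σ : 𝒟 0 ≃ₐ[ℱ 0] 𝒟 0) (a : 𝒟 0) (j : ℕ) :
    ∃ (b : 𝒟 0) (φ : Fˣ), S.homog σ a ^ (j + 1) = S.homog (σ ^ (j + 1)) b * algebraMap F D φ ∧
      BrauerTheory.CrossedProduct.single S.isMulCocycle σ a ^ (j + 1) =
        BrauerTheory.CrossedProduct.single S.isMulCocycle (σ ^ (j + 1)) b := by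
  induction j with
  | zero => exact ⟨a, 1, by simp, by simp⟩
  | succ j ih =>
    obtain ⟨b, φ, h1, h2⟩ := ih
    refine ⟨b * (σ ^ (j + 1)) a * S.d (σ ^ (j + 1), σ), S.hCocycle (σ ^ (j + 1)) σ * φ, ?_, ?_⟩
    · rw [pow_succ, h1, mul_assoc, Algebra.commutes, ← mul_assoc, homog_mul_homog, ← pow_succ,
        Units.val_mul, map_mul, mul_assoc]
    · rw [pow_succ, h2, BrauerTheory.CrossedProduct.single_mul_single, ← pow_succ]

/-- The factors `h(σ, τ) = h(τ, σ)` on the two sides cancel. -/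
lemma commute_single {σ τ : 𝒟 0 ≃ₐ[ℱ 0] 𝒟 0} {a b : 𝒟 0}
    (h : S.homog σ a * S.homog τ b = S.homog τ b * S.homog σ a) :
    Commute (BrauerTheory.CrossedProduct.single S.isMulCocycle σ a)
      (BrauerTheory.CrossedProduct.single S.isMulCocycle τ b) := by
  rw [homog_mul_homog, homog_mul_homog, S.hCocycle_comm τ σ, gal_mul_comm τ σ] at h
  have h1 := S.homog_injective _
    ((Units.map (algebraMap F D).toMonoidHom (S.hCocycle σ τ)).isUnit.mul_left_injective h)
  rw [commute_iff_eq, BrauerTheory.CrossedProduct.single_mul_single,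
    BrauerTheory.CrossedProduct.single_mul_single, h1, gal_mul_comm τ σ]

/-- Both `p`-th powers have degree `1` in `G` and the same coefficient `b`. In `D` the power is `b
d(1, 1)` times a unit of `F`, so `b d(1, 1)` lies in `F` and in degree `0`; in the crossed product
it is the scalar itself. -/
lemma exists_single_pow_eq_algebraMap {p : ℕ} (hp : p ≠ 0) {σ : 𝒟 0 ≃ₐ[ℱ 0] 𝒟 0} (hσ : σ ^ p = 1)
    {a : 𝒟 0} (ha : a ≠ 0) (h : S.homog σ a ^ p ∈ Set.range (algebraMap F D)) :
    ∃ c : (ℱ 0)ˣ, BrauerTheory.CrossedProduct.single S.isMulCocycle σ a ^ p =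
      algebraMap (ℱ 0) _ (c : ℱ 0) := by
  obtain ⟨j, rfl⟩ := Nat.exists_eq_succ_of_ne_zero hp
  obtain ⟨b, φ, h1, h2⟩ := S.exists_homog_pow σ a j
  rw [Nat.succ_eq_add_one] at hσ h ⊢
  rw [hσ] at h1 h2
  have hb0 : b ≠ 0 := by
    rintro rfl
    have := nontrivial_of_isGradedDivisionRing 𝒟
    refine ((S.isUnit_homog σ ha).pow (j + 1)).ne_zero ?_
    rw [h1, homog, ZeroMemClass.coe_zero, zero_mul, zero_mul]
  obtain ⟨f, hf⟩ := h
  rw [h1, homog_one, mul_assoc, ← map_mul, ← Units.val_mul] at hf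
  obtain ⟨c, hc⟩ := exists_algebraMap_eq_of_mem_range (ℱ := ℱ)
    (b * (S.d (1, 1) : 𝒟 0))
    ⟨f * ((S.hCocycle 1 1 * φ)⁻¹ : Fˣ), by
      rw [map_mul, hf, mul_assoc, ← map_mul, Units.mul_inv, map_one, mul_one]⟩
  have hc0 : c ≠ 0 := by
    rintro rfl
    rw [map_zero] at hc
    exact mul_ne_zero hb0 (S.d (1, 1)).ne_zero hc.symm
  refine ⟨Units.mk0 c hc0, ?_⟩
  rw [h2, Algebra.algebraMap_eq_smul_one, Units.val_mk0, BrauerTheory.CrossedProduct.one_def]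
  refine BrauerTheory.CrossedProduct.ext' fun τ => ?_
  rw [BrauerTheory.CrossedProduct.smul_apply]
  simp only [BrauerTheory.CrossedProduct.single]
  split_ifs
  · rw [Algebra.smul_def, hc, mul_assoc, mul_inv_cancel₀ (Units.ne_zero _), mul_one]
  · rw [Algebra.smul_def, mul_zero]

end CocycleData

end GradedDivision

/-! ### A maximal graded subfield from commuting homogeneous elements -/

namespace GradedDivision

/-- If `S` is generated over `R` by `p`-th roots of elements of `R`, then the extension of fraction
fields is a Kummer extension. -/
lemma isFracElementaryAbelian_of_adjoin {R S : Type u} [CommRing R] [CommRing S] [IsDomain R]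
    [IsDomain S] [Algebra R S] (hinj : Function.Injective (algebraMap R S)) {p : ℕ} (hp : p.Prime)
    {ζ : R} (hζ : IsPrimitiveRoot ζ p) {Y : Set S} (hY : Algebra.adjoin R Y = ⊤)
    (hpow : ∀ y ∈ Y, y ^ p ∈ Set.range (algebraMap R S)) : IsFracElementaryAbelian R S := by
  have : FaithfulSMul R S := (faithfulSMul_iff_algebraMap_injective R S).2 hinj
  let E := FractionRing R
  let L := FractionRing S
  let _ : Algebra E L := FractionRing.liftAlgebra R L
  have hT : IsScalarTower R E L := inferInstance
  refine ⟨E, L, inferInstance, inferInstance, inferInstance, inferInstance, inferInstance,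
    inferInstance, inferInstance, inferInstance, inferInstance, hT, ?_⟩
  refine isElementaryAbelianExtension_of_adjoin hp
    (hζ.map_of_injective (IsFractionRing.injective R E)) (S := algebraMap S L '' Y) ?_ ?_
  · rw [eq_top_iff]
    intro x _
    have hle : Algebra.adjoin R Y ≤ ((IntermediateField.adjoin E
        (algebraMap S L '' Y)).toSubalgebra.restrictScalars R).comap
          (IsScalarTower.toAlgHom R S L) :=
      Algebra.adjoin_le fun y hy => IntermediateField.subset_adjoin E _ ⟨y, hy, rfl⟩
    have hmem : ∀ s : S, algebraMap S L s ∈ IntermediateField.adjoin E (algebraMap S L '' Y) :=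
      fun s => hle (hY ▸ Algebra.mem_top)
    obtain ⟨a, b, -, rfl⟩ := IsFractionRing.div_surjective (A := S) x
    exact div_mem (hmem a) (hmem b)
  · rintro _ ⟨y, hy, rfl⟩
    obtain ⟨r, hr⟩ := hpow y hy
    refine ⟨algebraMap R E r, ?_⟩
    rw [← map_pow, ← hr, ← IsScalarTower.algebraMap_apply, ← IsScalarTower.algebraMap_apply]

variable {Γ : Type v} [AddCommGroup Γ] [LinearOrder Γ]
variable {F D : Type u} [CommRing F] [Ring D] [Algebra F D]
variable {ℱ : Γ → AddSubgroup F} {𝒟 : Γ → AddSubgroup D} [GradedRing ℱ] [GradedRing 𝒟]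

lemma decompose_eq_or_eq_zero {a : D} {γ : Γ} (ha : a ∈ 𝒟 γ) (δ : Γ) :
    (DirectSum.decompose 𝒟 a δ : D) = a ∨ (DirectSum.decompose 𝒟 a δ : D) = 0 := by
  by_cases h : γ = δ
  · subst h
    exact Or.inl (DirectSum.decompose_of_mem_same 𝒟 ha)
  · exact Or.inr (DirectSum.decompose_of_mem_ne 𝒟 ha h)

lemma isPrimitiveRoot_coe {p : ℕ} {ζ : ℱ 0} (hζ : IsPrimitiveRoot ζ p) :
    IsPrimitiveRoot (ζ : F) p where
  pow_eq_one := congrArg Subtype.val hζ.pow_eq_one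
  dvd_of_pow_eq_one l hl := hζ.dvd_of_pow_eq_one l (Subtype.ext hl)

variable [IsGradedDivisionRing 𝒟] [IsMulCommutative (𝒟 0)] [IsGradedAlgebra ℱ 𝒟]
variable [IsGradedDivisionRing ℱ]
variable [Module.Finite F D] [IsSemiramified ℱ 𝒟] [Algebra.IsCentral F D] (S : CocycleData ℱ 𝒟)

namespace CocycleData

section Commuting

variable (M : IntermediateField (ℱ 0) (𝒟 0)) (a : (𝒟 0 ≃ₐ[ℱ 0] 𝒟 0) → 𝒟 0)

/-- The elements of `M` and the elements `a_σ z^{m(σ)}`, where `σ` fixes `M`. -/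
def generators : Set D := {x | ∃ m ∈ M, x = (m : D)} ∪
  {x | ∃ σ ∈ M.fixingSubgroup, x = S.homog σ (a σ)}

variable (F) in
/-- The centralizer of `M` and of the elements `a_σ z^{m(σ)}`, where `σ` fixes `M`. -/
def gradedSubfield : Subalgebra F D := Subalgebra.centralizer F (S.generators M a)

lemma decompose_mem_generators : ∀ x ∈ S.generators M a, ∀ γ,
    (DirectSum.decompose 𝒟 x γ : D) ∈ S.generators M a := by
  have h0 : (0 : D) ∈ S.generators M a := Or.inl ⟨0, M.zero_mem, rfl⟩
  rintro _ (⟨m, hm, rfl⟩ | ⟨σ, hσ, rfl⟩) γ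
  · rcases decompose_eq_or_eq_zero m.2 γ with h | h <;> rw [h]
    · exact Or.inl ⟨m, hm, rfl⟩
    · exact h0
  · rcases decompose_eq_or_eq_zero (S.homog_mem σ (a σ)) γ with h | h <;> rw [h]
    · exact Or.inr ⟨σ, hσ, rfl⟩
    · exact h0

variable {M a}

lemma homog_mul_coe_of_mem {σ : 𝒟 0 ≃ₐ[ℱ 0] 𝒟 0} (hσ : σ ∈ M.fixingSubgroup) {m : 𝒟 0}
    (hm : m ∈ M) (b : 𝒟 0) : S.homog σ b * m = m * S.homog σ b := by
  rw [homog_mul_coe, (IntermediateField.mem_fixingSubgroup_iff M σ).1 hσ m hm]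

lemma generators_mul_comm (hcomm : ∀ σ ∈ M.fixingSubgroup, ∀ τ ∈ M.fixingSubgroup,
    S.homog σ (a σ) * S.homog τ (a τ) = S.homog τ (a τ) * S.homog σ (a σ)) :
    ∀ x ∈ S.generators M a, ∀ y ∈ S.generators M a, x * y = y * x := by
  rintro _ (⟨m, hm, rfl⟩ | ⟨σ, hσ, rfl⟩) _ (⟨l, hl, rfl⟩ | ⟨τ, hτ, rfl⟩)
  · exact congrArg Subtype.val (mul_comm m l)
  · exact (S.homog_mul_coe_of_mem hτ hm _).symm
  · exact S.homog_mul_coe_of_mem hσ hl _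
  · exact hcomm σ hσ τ hτ

/-- Homogeneous elements of the centralizer are products of elements of `M`, of `F`, and of the
given elements. -/
lemma exists_eq_of_mem_gradedSubfield (ha : ∀ σ ∈ M.fixingSubgroup, a σ ≠ 0)
    (hcomm : ∀ σ ∈ M.fixingSubgroup, ∀ τ ∈ M.fixingSubgroup,
      S.homog σ (a σ) * S.homog τ (a τ) = S.homog τ (a τ) * S.homog σ (a σ))
    {w : D} (hw : w ∈ S.gradedSubfield F M a) {γ : Γ} (hγ : w ∈ 𝒟 γ) :
    ∃ e ∈ M, ∃ σ ∈ M.fixingSubgroup, ∃ φ : F,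
      w = e * S.homog σ (a σ) * algebraMap F D φ := by
  by_cases hw0 : w = 0
  · exact ⟨0, M.zero_mem, 1, one_mem _, 0, by rw [hw0, map_zero, mul_zero]⟩
  obtain ⟨w, rfl⟩ := IsGradedDivisionRing.isUnit_of_mem γ w hγ hw0
  have hw' := (Subalgebra.mem_centralizer_iff F).1 hw
  obtain ⟨e₀, φ, -, h⟩ := S.exists_eq_homog w hγ
  set σ := conj ℱ 𝒟 w hγ with hσdef
  -- `w` commutes with `M`, so conjugation by `w` is trivial on `M`.
  have hσ : σ ∈ M.fixingSubgroup := by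
    rw [IntermediateField.mem_fixingSubgroup_iff]
    intro m hm
    refine Subtype.ext ?_
    rw [hσdef, coe_conj, Units.mul_inv_eq_iff_eq_mul]
    exact (hw' m (Or.inl ⟨m, hm, rfl⟩)).symm
  have he : e₀ = e₀ * (a σ)⁻¹ * a σ := by rw [inv_mul_cancel_right₀ (ha σ hσ)]
  generalize e₀ * (a σ)⁻¹ = e at he
  rw [he, ← coe_mul_homog] at h
  refine ⟨e, ?_, σ, hσ, φ, h⟩
  -- `w` and `a_σ z^{m(σ)}` both commute with every `a_τ z^{m(τ)}`, `τ` fixing `M`; hence so does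
  -- `e`, which means `τ e = e`.
  rw [← IsGalois.fixedField_fixingSubgroup M, IntermediateField.mem_fixedField_iff]
  intro τ hτ
  have h1 := hw' _ (Or.inr ⟨τ, hτ, rfl⟩)
  have h2 := ((S.isUnit_homog τ (ha τ hτ)).mul (S.isUnit_homog σ (ha σ hσ))).mul
    (φ.isUnit.map (algebraMap F D))
  refine Subtype.ext (h2.mul_left_injective ?_)
  change ((τ e : 𝒟 0) : D) * (S.homog τ (a τ) * S.homog σ (a σ) * algebraMap F D φ) =
    e * (S.homog τ (a τ) * S.homog σ (a σ) * algebraMap F D φ)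
  calc ((τ e : 𝒟 0) : D) * (S.homog τ (a τ) * S.homog σ (a σ) * algebraMap F D φ)
      = S.homog τ (a τ) * (e * S.homog σ (a σ) * algebraMap F D φ) := by
        rw [← mul_assoc, ← mul_assoc, ← S.homog_mul_coe, mul_assoc, mul_assoc, mul_assoc]
    _ = e * S.homog σ (a σ) * algebraMap F D φ * S.homog τ (a τ) := by rw [← h, h1]
    _ = e * (S.homog τ (a τ) * S.homog σ (a σ) * algebraMap F D φ) := by
        rw [hcomm τ hτ σ hσ, mul_assoc, Algebra.commutes, mul_assoc, mul_assoc]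

/-- Each component of `y` is a product of generators and an element of `F`, and `x` commutes with
all of these. -/
lemma mul_comm_of_mem_gradedSubfield (ha : ∀ σ ∈ M.fixingSubgroup, a σ ≠ 0)
    (hcomm : ∀ σ ∈ M.fixingSubgroup, ∀ τ ∈ M.fixingSubgroup,
      S.homog σ (a σ) * S.homog τ (a τ) = S.homog τ (a τ) * S.homog σ (a σ)) :
    ∀ x ∈ S.gradedSubfield F M a, ∀ y ∈ S.gradedSubfield F M a, x * y = y * x := by
  classical
  have h1 : ∀ x ∈ S.gradedSubfield F M a, ∀ c ∈ S.generators M a, Commute x c := fun x hx c hc =>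
    ((Subalgebra.mem_centralizer_iff F).1 hx c hc).symm
  intro x hx y hy
  rw [← DirectSum.sum_support_decompose 𝒟 y, Finset.mul_sum, Finset.sum_mul]
  refine Finset.sum_congr rfl fun γ _ => ?_
  obtain ⟨e, he, σ, hσ, φ, h⟩ := S.exists_eq_of_mem_gradedSubfield ha hcomm
    (decompose_mem_centralizer 𝒟 (S.decompose_mem_generators M a) hy γ) (SetLike.coe_mem _)
  rw [h]
  exact ((h1 x hx _ (Or.inl ⟨e, he, rfl⟩)).mul_right (h1 x hx _ (Or.inr ⟨σ, hσ, rfl⟩))).mul_right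
    (Algebra.commutes φ x).symm

/-- The generators commute with each other and so lie in their centralizer. A larger graded subfield
contains them and is commutative, hence is contained in the centralizer. -/
lemma maximal_gradedSubfield (ha : ∀ σ ∈ M.fixingSubgroup, a σ ≠ 0)
    (hcomm : ∀ σ ∈ M.fixingSubgroup, ∀ τ ∈ M.fixingSubgroup,
      S.homog σ (a σ) * S.homog τ (a τ) = S.homog τ (a τ) * S.homog σ (a σ)) :
    Maximal (IsGradedSubfield 𝒟) (S.gradedSubfield F M a) := by
  refine ⟨isGradedSubfield_centralizer 𝒟 (S.decompose_mem_generators M a)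
    (S.mul_comm_of_mem_gradedSubfield ha hcomm), fun P hP hle x hx => ?_⟩
  refine (Subalgebra.mem_centralizer_iff F).2 fun c hc => hP.mul_comm (hle ?_) hx
  exact (Subalgebra.mem_centralizer_iff F).2 fun b hb => S.generators_mul_comm hcomm b hb c hc

open scoped IsMulCommutative in
-- The maximal graded subfield is generated over `F` by `p`-th roots of elements of `F`: those that
-- span `M`, by `hM`, and the `a_σ z^{m(σ)}`, by `hpow`.
lemma isElementaryAbelianGradedCrossedProduct_of_commute [IsOrderedAddMonoid Γ]
    (ha : ∀ σ ∈ M.fixingSubgroup, a σ ≠ 0)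
    (hcomm : ∀ σ ∈ M.fixingSubgroup, ∀ τ ∈ M.fixingSubgroup,
      S.homog σ (a σ) * S.homog τ (a τ) = S.homog τ (a τ) * S.homog σ (a σ))
    {p : ℕ} (hp : p.Prime) {ζ : ℱ 0} (hζ : IsPrimitiveRoot ζ p)
    (hpow : ∀ σ ∈ M.fixingSubgroup, S.homog σ (a σ) ^ p ∈ Set.range (algebraMap F D))
    (hM : ∀ m ∈ M, m ∈ AddSubgroup.closure
      {b | b ∈ M ∧ b ^ p ∈ Set.range (algebraMap (ℱ 0) (𝒟 0))}) :
    IsElementaryAbelianGradedCrossedProduct F 𝒟 := by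
  classical
  have hmax := S.maximal_gradedSubfield ha hcomm
  have := hmax.prop.isMulCommutative
  refine ⟨_, hmax, this, ?_⟩
  have hF := isDomain_of_isGradedDivisionRing ℱ
  have hD := isDomain_of_isGradedDivisionRing 𝒟
  set P := S.gradedSubfield F M a with hPdef
  have hP : IsDomain P := inferInstance
  have hgen : S.generators M a ⊆ P := fun c hc =>
    (Subalgebra.mem_centralizer_iff F).2 fun b hb => S.generators_mul_comm hcomm b hb c hc
  let Y : Set P := {y | (y : D) ^ p ∈ Set.range (algebraMap F D)}
  have hYM : ∀ m ∈ M, ∃ y ∈ Algebra.adjoin F Y, (y : D) = (m : D) := by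
    intro m hm
    have h := hM m hm
    clear hm
    induction h using AddSubgroup.closure_induction with
    | mem b hb =>
      obtain ⟨c, hc⟩ := hb.2
      exact ⟨⟨b, hgen (Or.inl ⟨b, hb.1, rfl⟩)⟩, Algebra.subset_adjoin
        ⟨c, congrArg Subtype.val hc⟩, rfl⟩
    | zero => exact ⟨0, zero_mem _, rfl⟩
    | add b c _ _ hb hc =>
      obtain ⟨y, hy, h⟩ := hb
      obtain ⟨y', hy', h'⟩ := hc
      exact ⟨y + y', add_mem hy hy', congrArg₂ (· + ·) h h'⟩
    | neg b _ hb =>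
      obtain ⟨y, hy, h⟩ := hb
      exact ⟨-y, neg_mem hy, congrArg Neg.neg h⟩
  refine isFracElementaryAbelian_of_adjoin (Y := Y) ?_ hp (isPrimitiveRoot_coe hζ) ?_ ?_
  · exact fun x y h => algebraMap_injective ℱ 𝒟 (congrArg Subtype.val h)
  · rw [eq_top_iff]
    rintro ⟨x, hx⟩ -
    have h : ∀ γ, ∃ y ∈ Algebra.adjoin F Y, (y : D) = DirectSum.decompose 𝒟 x γ := by
      intro γ
      obtain ⟨e, he, σ, hσ, φ, h⟩ := S.exists_eq_of_mem_gradedSubfield ha hcomm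
        (hmax.prop.decompose_mem x hx γ) (SetLike.coe_mem _)
      obtain ⟨y, hy, hye⟩ := hYM e he
      refine ⟨y * ⟨S.homog σ (a σ), hgen (Or.inr ⟨σ, hσ, rfl⟩)⟩ * algebraMap F P φ,
        mul_mem (mul_mem hy (Algebra.subset_adjoin (hpow σ hσ))) (Subalgebra.algebraMap_mem _ φ),
        ?_⟩
      rw [h, ← hye]
      rfl
    choose y hy hyx using h
    have hsum : (⟨x, hx⟩ : P) = ∑ γ ∈ (DirectSum.decompose 𝒟 x).support, y γ := by
      refine Subtype.ext ?_
      rw [AddSubmonoidClass.coe_finsetSum]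
      simp only [hyx]
      exact (DirectSum.sum_support_decompose 𝒟 x).symm
    rw [hsum]
    exact sum_mem fun γ _ => hy γ
  · rintro y ⟨f, hf⟩
    exact ⟨f, Subtype.ext hf⟩

end Commuting

end CocycleData

end GradedDivision

/-! ### From the Brauer condition to a graded crossed product -/

namespace GradedDivision

variable {Γ : Type v} [AddCommGroup Γ] [LinearOrder Γ]
variable {F D : Type u} [CommRing F] [Ring D] [Algebra F D]
variable {ℱ : Γ → AddSubgroup F} {𝒟 : Γ → AddSubgroup D} [GradedRing ℱ] [GradedRing 𝒟]
variable [IsGradedDivisionRing 𝒟] [IsMulCommutative (𝒟 0)] [IsGradedAlgebra ℱ 𝒟]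
variable [IsGradedDivisionRing ℱ]
variable [Module.Finite F D] [IsSemiramified ℱ 𝒟] [Algebra.IsCentral F D] (S : CocycleData ℱ 𝒟)

lemma isAbelianGalois_zero : IsAbelianGalois (ℱ 0) (𝒟 0) :=
  isAbelianGalois_of_forall_mul_comm gal_mul_comm

lemma mem_closure_of_isElementaryAbelianExtension {k K : Type*} [Field k] [Field K] [Algebra k K]
    [FiniteDimensional k K] {M : IntermediateField k K} {p : ℕ} (hp : p.Prime) {ζ : k}
    (hζ : IsPrimitiveRoot ζ p) (hM : IsElementaryAbelianExtension k M)
    (hpow : ∀ σ : M ≃ₐ[k] M, σ ^ p = 1) :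
    ∀ m ∈ M, m ∈ AddSubgroup.closure {b | b ∈ M ∧ b ^ p ∈ Set.range (algebraMap k K)} := by
  intro m hm
  have := hM.1
  have h := mem_closure_of_elementaryAbelian hp hζ hM.2.1 hpow ⊤ (Subfield.mem_top ζ) ⊤
    (fun _ _ _ _ => AddSubgroup.mem_top _) (fun _ _ _ => AddSubgroup.mem_top _)
    (AddSubgroup.mem_top (⟨m, hm⟩ : M))
  have h1 := AddSubgroup.mem_map_of_mem (M.val : M →+ K) h
  rw [AddMonoidHom.map_closure] at h1
  refine AddSubgroup.closure_mono ?_ h1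
  rintro _ ⟨b, ⟨-, c, hc⟩, rfl⟩
  exact ⟨b.2, c, congrArg Subtype.val hc⟩

namespace CocycleData

/-- The cochain `a` that makes `d` symmetric with values in `F₀` on `Gal(D₀/M)` also provides the
commuting elements `a_σ z^{m(σ)}`: their products are taken up to factors `f h ∈ F`, symmetric in
`σ` and `τ`. -/
lemma isElementaryAbelianGradedCrossedProduct_of_mem_range [IsOrderedAddMonoid Γ]
    {M : IntermediateField (ℱ 0) (𝒟 0)}
    {p n : ℕ} (hp : p.Prime) (hcard : Module.finrank (ℱ 0) (𝒟 0) = p ^ n) {ζ : ℱ 0}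
    (hζ : IsPrimitiveRoot ζ p) (hM : IsElementaryAbelianExtension (ℱ 0) M)
    (hM' : IsElementaryAbelianExtension M (𝒟 0))
    (h : S.crossedProductClass ∈ (BrauerTheory.relBrModDecMap M).range) :
    IsElementaryAbelianGradedCrossedProduct F 𝒟 := by
  have : IsAbelianGalois (ℱ 0) (𝒟 0) := isAbelianGalois_zero
  obtain ⟨a, f, hf0, hf, ha, haf⟩ := BrauerTheory.exists_symmetric_of_mem_range _ M h
  have hmul : ∀ σ ∈ M.fixingSubgroup, ∀ τ ∈ M.fixingSubgroup,
      S.homog σ (a σ) * S.homog τ (a τ) =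
        algebraMap F D (f σ τ * S.hCocycle σ τ) * S.homog (σ * τ) (a (σ * τ)) := by
    intro σ hσ τ hτ
    rw [homog_mul_homog, haf σ hσ τ hτ, ← coe_mul_homog, ← Algebra.commutes, ← mul_assoc,
      coe_algebraMap_zero, ← map_mul, mul_comm (f σ τ : F)]
  have hpow : ∀ σ ∈ M.fixingSubgroup, ∀ j : ℕ, ∃ c : F,
      S.homog σ (a σ) ^ (j + 1) = algebraMap F D c * S.homog (σ ^ (j + 1)) (a (σ ^ (j + 1))) := by
    intro σ hσ j
    induction j with
    | zero => exact ⟨1, by simp⟩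
    | succ j ih =>
      obtain ⟨c, hc⟩ := ih
      refine ⟨c * (f (σ ^ (j + 1)) σ * S.hCocycle (σ ^ (j + 1)) σ), ?_⟩
      rw [pow_succ, hc, mul_assoc, hmul _ (pow_mem hσ _) _ hσ, ← mul_assoc, ← map_mul, ← pow_succ]
  -- The square of this unit is an element of `F` times itself. Since `σ ^ p = 1`, the `p`-th powers
  -- of all `a_σ z^{m(σ)}` are then in `F`.
  have hone : S.homog 1 (a 1) ∈ Set.range (algebraMap F D) := by
    have h1 := hmul 1 (one_mem _) 1 (one_mem _)
    rw [one_mul] at h1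
    exact ⟨_, ((S.isUnit_homog 1 (ha 1 (one_mem _))).mul_left_injective h1).symm⟩
  refine S.isElementaryAbelianGradedCrossedProduct_of_commute ha (fun σ hσ τ hτ => ?_) hp hζ
    (fun σ hσ => ?_) (mem_closure_of_isElementaryAbelianExtension hp hζ hM
      (intermediateField_pow_eq_one hp hcard hM))
  · rw [hmul σ hσ τ hτ, hmul τ hτ σ hσ, hf, S.hCocycle_comm, gal_mul_comm]
  · obtain ⟨c, hc⟩ := hpow σ hσ (p - 1)
    rw [Nat.sub_add_cancel hp.one_le, fixingSubgroup_pow_eq_one hp hcard hM' σ hσ] at hc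
    obtain ⟨b, hb⟩ := hone
    exact ⟨c * b, by rw [hc, ← hb, map_mul]⟩

end CocycleData

end GradedDivision

/-! ### Automorphisms of the fraction field of a graded subfield -/

section Fraction

variable {R S E L : Type*} [CommRing R] [CommRing S] [Field E] [Field L] [Algebra R S]
  [Algebra R E] [Algebra S L] [Algebra R L] [Algebra E L] [IsFractionRing R E]
  [IsFractionRing S L] [IsScalarTower R S L] [IsScalarTower R E L]

lemma algEquiv_eq_one_of_forall_algebraMap {τ : L ≃ₐ[E] L}
    (h : ∀ s : S, τ (algebraMap S L s) = algebraMap S L s) : τ = 1 := by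
  ext x
  obtain ⟨a, b, -, rfl⟩ := IsFractionRing.div_surjective (A := S) x
  rw [map_div₀, h, h, AlgEquiv.one_apply]

/-- If `M / k` is normal, then automorphisms of a field that fix the image of `k` preserve the image
of `M`. -/
lemma exists_algEquiv_of_normal {k M L : Type*} [Field k] [Field M] [Field L] [Algebra k M]
    [Normal k M] (j : M →+* L) (τ : L ≃+* L)
    (h : ∀ c : k, τ (j (algebraMap k M c)) = j (algebraMap k M c)) :
    ∃ ρ : M ≃ₐ[k] M, ∀ m, τ (j m) = j (ρ m) := by
  let _ : Algebra M L := j.toAlgebra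
  let _ : Algebra k L := (j.comp (algebraMap k M)).toAlgebra
  have : IsScalarTower k M L := .of_algebraMap_eq fun _ => rfl
  let τ' : L ≃ₐ[k] L := AlgEquiv.ofRingEquiv (f := τ) h
  exact ⟨τ'.restrictNormal M, fun m => (τ'.restrictNormal_commutes M m).symm⟩

end Fraction

/-- For an algebraic extension of domains the rank does not change on passing to fraction fields. A
bound on the rank is inherited by subalgebras of `D`, which makes it the convenient hypothesis. -/
lemma finiteDimensional_of_isFractionRing {R S E L : Type u} [CommRing R] [CommRing S]
    [Field E] [Field L] [Algebra R S] [Algebra R E] [Algebra S L] [Algebra R L] [Algebra E L]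
    [IsFractionRing R E] [IsFractionRing S L] [IsScalarTower R S L] [IsScalarTower R E L]
    [IsDomain S] (hinj : Function.Injective (algebraMap R S)) [Algebra.IsAlgebraic R S]
    (h : Module.rank R S < Cardinal.aleph0) : FiniteDimensional E L := by
  have : FaithfulSMul R S := (faithfulSMul_iff_algebraMap_injective R S).2 hinj
  have h1 := Algebra.IsAlgebraic.rank_of_isFractionRing R E S L
  rw [← h1] at h
  exact Module.rank_lt_aleph0_iff.1 h

namespace GradedDivision

variable {Γ : Type v} [AddCommGroup Γ] [LinearOrder Γ]
variable {F D : Type u} [CommRing F] [Ring D] [Algebra F D]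
variable {ℱ : Γ → AddSubgroup F} {𝒟 : Γ → AddSubgroup D} [GradedRing ℱ] [GradedRing 𝒟]
/-- A quotient of homogeneous elements of `D` and `F` that lies in the image of the fraction field
of `F` lies in `F`. -/
lemma mem_range_of_mul_eq (ℱ : Γ → AddSubgroup F) [GradedRing ℱ] [IsGradedDivisionRing ℱ]
    [IsGradedAlgebra ℱ 𝒟] {f g : F} (hg : g ≠ 0) {b : D} {γ : Γ} (hb : b ∈ 𝒟 γ) (h : algebraMap F D g * b = algebraMap F D f) : b ∈ Set.range (algebraMap F D) := by
  obtain ⟨δ, hδ⟩ := exists_decompose_ne_zero ℱ hg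
  obtain ⟨u, hu⟩ := IsGradedDivisionRing.isUnit_of_mem δ _ (SetLike.coe_mem _) hδ
  -- Since `b` is homogeneous, the component of `g b = f` in degree `δ + γ` is `g_δ b`, and `g_δ` is
  -- a unit of `F`.
  have h1 := DirectSum.coe_decompose_mul_add_of_right_mem 𝒟 (i := δ) (a := algebraMap F D g) hb
  rw [h, decompose_algebraMap ℱ 𝒟, decompose_algebraMap ℱ 𝒟, ← hu] at h1
  exact ⟨(u⁻¹ : Fˣ) * DirectSum.decompose ℱ f (δ + γ), by
    rw [map_mul, h1, ← mul_assoc, ← map_mul, Units.inv_mul, map_one, one_mul]⟩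

variable [IsGradedDivisionRing 𝒟] [IsMulCommutative (𝒟 0)] [IsGradedAlgebra ℱ 𝒟]
variable [IsGradedDivisionRing ℱ]

variable (ℱ) in
/-- The component of degree `0` of a graded subfield, as a field between `F₀` and `D₀`. -/
def IsGradedSubfield.degreeZero {P : Subalgebra F D} (hP : IsGradedSubfield 𝒟 P) :
    IntermediateField (ℱ 0) (𝒟 0) where
  carrier := {a | (a : D) ∈ P}
  mul_mem' ha hb := P.mul_mem ha hb
  add_mem' ha hb := P.add_mem ha hb
  algebraMap_mem' c := P.algebraMap_mem (c : F)
  inv_mem' a ha := by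
    by_cases h0 : a = 0
    · rw [h0, inv_zero]
      exact P.zero_mem
    · obtain ⟨b, hb, hab⟩ := hP.inv_mem _ ha 0 a.2 fun h => h0 (Subtype.ext h)
      obtain ⟨u, hu⟩ := IsGradedDivisionRing.isUnit_of_mem 0 (a : D) a.2
        fun h => h0 (Subtype.ext h)
      have h1 : (a : D) * (a⁻¹ : 𝒟 0) = a * b :=
        (congrArg Subtype.val (mul_inv_cancel₀ h0)).trans hab.symm
      rw [← hu] at h1
      change ((a⁻¹ : 𝒟 0) : D) ∈ P
      rwa [u.isUnit.mul_right_injective h1]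

variable [Module.Finite F D] [IsSemiramified ℱ 𝒟] [Algebra.IsCentral F D]

/-- The degree of `D` kills `Γ_D / Γ_F`. -/
lemma finrank_nsmul_mem {γ : Γ} {w : D} (hw : w ∈ 𝒟 γ) (hw0 : w ≠ 0) :
    Module.finrank (ℱ 0) (𝒟 0) • γ ∈ gradeGroup ℱ := by
  obtain ⟨u, rfl⟩ := IsGradedDivisionRing.isUnit_of_mem γ w hw hw0
  have h := theta_eq_zero_iff ℱ 𝒟 (Module.finrank (ℱ 0) (𝒟 0) • ⟨γ, u, hw⟩)
  rw [map_nsmul] at h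
  refine h.1 (Additive.toMul.injective ?_)
  rw [toMul_nsmul, ← IsGalois.card_aut_eq_finrank]
  exact pow_card_eq_one'

end GradedDivision

namespace GradedDivision

variable {Γ : Type v} [AddCommGroup Γ] [LinearOrder Γ]
variable {F D : Type u} [CommRing F] [Ring D] [Algebra F D]
variable {ℱ : Γ → AddSubgroup F} {𝒟 : Γ → AddSubgroup D} [GradedRing ℱ] [GradedRing 𝒟]
variable [IsGradedDivisionRing 𝒟] [IsMulCommutative (𝒟 0)] [IsGradedAlgebra ℱ 𝒟]
variable [IsGradedDivisionRing ℱ]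
variable [Module.Finite F D] [IsSemiramified ℱ 𝒟] [Algebra.IsCentral F D]

/-- The degree of `y ^ N`, `N = [D₀ : F₀]`, lies in `Γ_F`, so dividing by a homogeneous unit of `F`
brings it to degree `0`. -/
lemma exists_pow_eq_mul {P : Subalgebra F D} (hP : IsGradedSubfield 𝒟 P) {y : P} {γ : Γ} (hy : (y : D) ∈ 𝒟 γ)
    (hy0 : y ≠ 0) : ∃ (m : hP.degreeZero ℱ) (φ : F), m ≠ 0 ∧
      y ^ Module.finrank (ℱ 0) (𝒟 0) = ⟨(m : 𝒟 0), m.2⟩ * algebraMap F P φ := by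
  obtain ⟨φ, hφ⟩ := finrank_nsmul_mem (ℱ := ℱ) hy fun h => hy0 (Subtype.ext h)
  set N := Module.finrank (ℱ 0) (𝒟 0)
  have hd : (y : D) ^ N * algebraMap F D (φ⁻¹ : Fˣ) ∈ 𝒟 0 := by
    have h := SetLike.mul_mem_graded (SetLike.pow_mem_graded N hy)
      (IsGradedAlgebra.algebraMap_mem (𝒟 := 𝒟) _ _ (inv_mem ℱ φ hφ))
    rwa [add_neg_cancel] at h
  have hdP : (y : D) ^ N * algebraMap F D (φ⁻¹ : Fˣ) ∈ P :=
    P.mul_mem (P.pow_mem y.2 N) (P.algebraMap_mem _)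
  have h1 : (y : D) ^ N = (y : D) ^ N * algebraMap F D (φ⁻¹ : Fˣ) * algebraMap F D φ := by
    rw [mul_assoc, ← map_mul, Units.inv_mul, map_one, mul_one]
  refine ⟨⟨⟨_, hd⟩, hdP⟩, φ, fun h => ?_, Subtype.ext h1⟩
  have h2 : (y : D) ^ N * algebraMap F D (φ⁻¹ : Fˣ) = 0 :=
    congrArg (fun m : hP.degreeZero ℱ => ((m : 𝒟 0) : D)) h
  rw [h2, zero_mul] at h1
  obtain ⟨u, hu⟩ := IsGradedDivisionRing.isUnit_of_mem γ _ hy fun h => hy0 (Subtype.ext h)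
  rw [← hu, ← Units.val_pow_eq_pow_val] at h1
  have := nontrivial_of_isGradedDivisionRing 𝒟
  exact Units.ne_zero _ h1

section FracField

open scoped IsMulCommutative

variable {P : Subalgebra F D} [IsMulCommutative P] {E L : Type u} [Field E] [Field L]
  [Algebra F E] [Algebra P L] [Algebra F L] [Algebra E L]
  [IsScalarTower F P L] [IsScalarTower F E L]

/-- `P₀ / F₀` is normal because `D₀ / F₀` is abelian, so its image in `L` is stable under `τ`, which
fixes the image of `F₀`. -/
lemma exists_apply_degreeZero (hP : IsGradedSubfield 𝒟 P) (τ : L ≃ₐ[E] L) :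
    ∃ ρ : hP.degreeZero ℱ ≃ₐ[ℱ 0] hP.degreeZero ℱ, ∀ m : hP.degreeZero ℱ,
      τ (algebraMap P L ⟨(m : 𝒟 0), m.2⟩) = algebraMap P L ⟨(ρ m : 𝒟 0), (ρ m).2⟩ := by
  have : IsAbelianGalois (ℱ 0) (𝒟 0) := isAbelianGalois_zero
  let i : hP.degreeZero ℱ →+* P :=
    { toFun := fun m => ⟨(m : 𝒟 0), m.2⟩
      map_one' := rfl
      map_mul' := fun _ _ => rfl
      map_zero' := rfl
      map_add' := fun _ _ => rfl }
  refine exists_algEquiv_of_normal (k := ℱ 0) ((algebraMap P L).comp i) τ.toRingEquiv fun c => ?_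
  have h : i (algebraMap (ℱ 0) (hP.degreeZero ℱ) c) = algebraMap F P c := rfl
  change τ (algebraMap P L (i _)) = algebraMap P L (i _)
  rw [h, ← IsScalarTower.algebraMap_apply, IsScalarTower.algebraMap_apply F E L, τ.commutes]

variable [IsOrderedAddMonoid Γ] [IsFractionRing P L]

/-- Automorphisms of the fraction field of a graded subfield multiply homogeneous elements by
elements of degree `0`. -/
lemma exists_apply_eq_mul (hP : IsGradedSubfield 𝒟 P) (hN : (Module.finrank (ℱ 0) (𝒟 0) : D) ≠ 0)
    (τ : L ≃ₐ[E] L) {y : P} {γ : Γ} (hy : (y : D) ∈ 𝒟 γ) :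
    ∃ u : hP.degreeZero ℱ, τ (algebraMap P L y) = algebraMap P L (⟨(u : 𝒟 0), u.2⟩ * y) := by
  have hD := isDomain_of_isGradedDivisionRing 𝒟
  have hinj : Function.Injective (algebraMap P L) := IsFractionRing.injective P L
  by_cases hy0 : y = 0
  · exact ⟨0, by rw [hy0, mul_zero, map_zero, map_zero]⟩
  obtain ⟨m, φ, hm0, hm⟩ := exists_pow_eq_mul (ℱ := ℱ) hP hy hy0
  obtain ⟨ρ, hρ⟩ := exists_apply_degreeZero (ℱ := ℱ) hP τ
  set N := Module.finrank (ℱ 0) (𝒟 0)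
  obtain ⟨a, b, hb, hab⟩ := IsFractionRing.div_surjective (A := P) (τ (algebraMap P L y))
  have hb0 : b ≠ 0 := nonZeroDivisors.ne_zero hb
  have hjb : algebraMap P L b ≠ 0 := fun h => hb0 (hinj (h.trans (map_zero _).symm))
  have ha0 : a ≠ 0 := by
    rintro rfl
    rw [map_zero, zero_div, eq_comm, map_eq_zero_iff _ τ.injective] at hab
    exact hy0 (hinj (hab.trans (map_zero _).symm))
  let i : hP.degreeZero ℱ → P := fun m => ⟨(m : 𝒟 0), m.2⟩
  have hφ : τ (algebraMap P L (algebraMap F P φ)) = algebraMap P L (algebraMap F P φ) := by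
    rw [← IsScalarTower.algebraMap_apply, IsScalarTower.algebraMap_apply F E L, τ.commutes]
  have h1 : algebraMap P L a ^ N = algebraMap P L (i (ρ m) * algebraMap F P φ * b ^ N) := by
    have h2 := congrArg (fun t => τ (algebraMap P L t)) hm
    simp only [map_pow, map_mul, hφ, hρ, ← hab] at h2
    rw [div_pow, div_eq_iff (pow_ne_zero N hjb)] at h2
    rw [h2, map_mul, map_mul, map_pow]
  rw [← map_pow] at h1
  -- Here `τ(y) = a / b` and `y ^ N = m φ`, so the `N`-th power of `a / (b y) = τ(y) / y` is `ρ(m) /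
  -- m`, of degree `0`. The leading term argument then puts the quotient itself in `P₀`.
  have h2 : a ^ N = i (ρ m * m⁻¹) * (b * y) ^ N := by
    have h3 : i (ρ m) = i (ρ m * m⁻¹) * i m := by
      have h4 : ρ m = ρ m * m⁻¹ * m := (inv_mul_cancel_right₀ hm0 _).symm
      exact Subtype.ext (congrArg (fun t : hP.degreeZero ℱ => ((t : 𝒟 0) : D)) h4)
    rw [hinj h1, h3, mul_pow, hm]
    ring
  obtain ⟨u, huP, hu0, hu⟩ := exists_eq_mul_of_pow_eq 𝒟 P.toSubring hP.decompose_mem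
    (fun a ha b hb => hP.mul_comm ha hb) hP.inv_mem a.2 (b * y).2 (ρ m * m⁻¹ : hP.degreeZero ℱ).1.2
    (fun h => ha0 (Subtype.ext h)) (fun h => mul_ne_zero hb0 hy0 (Subtype.ext h)) hN
    (congrArg Subtype.val h2)
  refine ⟨⟨⟨u, hu0⟩, huP⟩, ?_⟩
  have h4 : a = ⟨u, huP⟩ * y * b := by
    refine Subtype.ext (hu.trans ?_)
    rw [mul_comm b y, mul_assoc]
    rfl
  rw [← hab, h4, map_mul _ _ b, mul_div_cancel_right₀ _ hjb]

/-- A `p`-power of `τ` is trivial on `P₀`, since `Gal(P₀/F₀)` is a `p`-group. That power multiplies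
a homogeneous `y` by some `u ∈ P₀`, and `u ^ p ^ n = 1` because `y ^ p ^ n ∈ P₀ F` is fixed; so its
`p ^ n`-th power is trivial. This identifies the prime of the elementary abelian group of `Frac(P)`
with `p`. -/
lemma isPGroup_gal (hP : IsGradedSubfield 𝒟 P) {p n : ℕ}
    (hcard : Module.finrank (ℱ 0) (𝒟 0) = p ^ n) (hN : (Module.finrank (ℱ 0) (𝒟 0) : D) ≠ 0) :
    IsPGroup p (L ≃ₐ[E] L) := by
  classical
  have hD := isDomain_of_isGradedDivisionRing 𝒟
  have : IsAbelianGalois (ℱ 0) (𝒟 0) := isAbelianGalois_zero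
  have hinj : Function.Injective (algebraMap P L) := IsFractionRing.injective P L
  intro τ
  obtain ⟨ρ, hρ⟩ := exists_apply_degreeZero (ℱ := ℱ) hP τ
  obtain ⟨j, hj⟩ := ((isPGroup_of_finrank hcard).of_surjective
    (AlgEquiv.restrictNormalHom (hP.degreeZero ℱ)) (AlgEquiv.restrictNormalHom_surjective (𝒟 0))) ρ
  let i : hP.degreeZero ℱ → P := fun m => ⟨(m : 𝒟 0), m.2⟩
  have h1 : ∀ l m, (τ ^ l) (algebraMap P L (i m)) = algebraMap P L (i ((ρ ^ l) m)) := by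
    intro l
    induction l with
    | zero => exact fun m => rfl
    | succ l ih =>
      intro m
      rw [pow_succ, AlgEquiv.mul_apply, hρ m, pow_succ, AlgEquiv.mul_apply]
      exact ih _
  refine ⟨j + n, ?_⟩
  rw [pow_add, pow_mul]
  set τ' := τ ^ p ^ j with hτ'
  have h2 : ∀ m, τ' (algebraMap P L (i m)) = algebraMap P L (i m) := fun m => by
    rw [hτ', h1, hj, AlgEquiv.one_apply]
  have h3 : ∀ (y : P) γ, (y : D) ∈ 𝒟 γ →
      (τ' ^ p ^ n) (algebraMap P L y) = algebraMap P L y := by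
    intro y γ hy
    by_cases hy0 : y = 0
    · rw [hy0, map_zero, map_zero]
    obtain ⟨u, hu⟩ := exists_apply_eq_mul (ℱ := ℱ) hP hN τ' hy
    obtain ⟨m, φ, -, hm⟩ := exists_pow_eq_mul (ℱ := ℱ) hP hy hy0
    have hφ : τ' (algebraMap P L (algebraMap F P φ)) = algebraMap P L (algebraMap F P φ) := by
      rw [← IsScalarTower.algebraMap_apply, IsScalarTower.algebraMap_apply F E L, τ'.commutes]
    have h4 : ∀ l : ℕ, (τ' ^ l) (algebraMap P L y) = algebraMap P L (i u) ^ l *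
        algebraMap P L y := by
      intro l
      induction l with
      | zero => simp
      | succ l ih =>
        rw [pow_succ', AlgEquiv.mul_apply, ih, map_mul, hu, map_pow, h2, map_mul, pow_succ,
          mul_assoc]
    have h5 : algebraMap P L (i u) ^ p ^ n = 1 := by
      have hjy : algebraMap P L y ^ p ^ n ≠ 0 :=
        pow_ne_zero _ fun h => hy0 (hinj (h.trans (map_zero _).symm))
      have h6 : τ' (algebraMap P L y ^ p ^ n) = algebraMap P L y ^ p ^ n := by
        rw [← map_pow (algebraMap P L), ← hcard, hm, map_mul, map_mul, hφ]
        exact congrArg (· * _) (h2 m)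
      rw [map_pow, hu, map_mul, mul_pow] at h6
      exact mul_right_cancel₀ hjy (h6.trans (one_mul _).symm)
    rw [h4, h5, one_mul]
  refine algEquiv_eq_one_of_forall_algebraMap (S := P) fun s => ?_
  have hs : s = ∑ γ ∈ (DirectSum.decompose 𝒟 (s : D)).support,
      ⟨DirectSum.decompose 𝒟 (s : D) γ, hP.decompose_mem s s.2 γ⟩ := by
    refine Subtype.ext ?_
    rw [AddSubmonoidClass.coe_finsetSum]
    exact (DirectSum.sum_support_decompose 𝒟 (s : D)).symm
  rw [hs, map_sum, map_sum]
  exact Finset.sum_congr rfl fun γ _ => h3 _ γ (SetLike.coe_mem _)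

end FracField

end GradedDivision

/-! ### From a graded crossed product to the Brauer condition -/

namespace GradedDivision

variable {Γ : Type v} [AddCommGroup Γ] [LinearOrder Γ]
variable {F D : Type u} [CommRing F] [Ring D] [Algebra F D]
variable {ℱ : Γ → AddSubgroup F} {𝒟 : Γ → AddSubgroup D} [GradedRing ℱ] [GradedRing 𝒟]
variable [IsGradedDivisionRing 𝒟] [IsMulCommutative (𝒟 0)] [IsGradedAlgebra ℱ 𝒟]
variable [IsGradedDivisionRing ℱ]
variable [Module.Finite F D] [IsSemiramified ℱ 𝒟]

/-- Every automorphism of `D₀` that fixes the degree `0` component of a maximal graded subfield is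
the conjugation by a homogeneous element of this graded subfield. -/
lemma exists_conj_eq_of_mem_fixingSubgroup {P : Subalgebra F D}
    (hP : Maximal (IsGradedSubfield 𝒟) P) {σ : 𝒟 0 ≃ₐ[ℱ 0] 𝒟 0}
    (hσ : σ ∈ (hP.prop.degreeZero ℱ).fixingSubgroup) :
    ∃ (γ : Γ) (w : Dˣ) (hw : (w : D) ∈ 𝒟 γ), (w : D) ∈ P ∧ conj ℱ 𝒟 w hw = σ := by
  classical
  let H : Subgroup (𝒟 0 ≃ₐ[ℱ 0] 𝒟 0) :=
    { carrier := {σ | ∃ (γ : Γ) (w : Dˣ) (hw : (w : D) ∈ 𝒟 γ), (w : D) ∈ P ∧ conj ℱ 𝒟 w hw = σ}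
      one_mem' := ⟨0, 1, SetLike.one_mem_graded 𝒟, P.one_mem, by
        ext a
        rw [coe_conj]
        simp⟩
      mul_mem' := by
        rintro _ _ ⟨γ, w, hw, hwP, rfl⟩ ⟨δ, v, hv, hvP, rfl⟩
        refine ⟨γ + δ, w * v, SetLike.mul_mem_graded hw hv, P.mul_mem hwP hvP, ?_⟩
        ext a
        rw [AlgEquiv.mul_apply, coe_conj, coe_conj, coe_conj]
        simp [mul_assoc]
      inv_mem' := by
        rintro _ ⟨γ, w, hw, hwP, rfl⟩
        have := nontrivial_of_isGradedDivisionRing 𝒟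
        obtain ⟨v, hvP, hv⟩ := hP.prop.inv_mem _ hwP γ hw w.ne_zero
        refine ⟨-γ, w⁻¹, inv_mem 𝒟 w hw, by rwa [Units.inv_eq_of_mul_eq_one_right hv], ?_⟩
        rw [eq_inv_iff_mul_eq_one]
        ext a
        rw [AlgEquiv.mul_apply, coe_conj, coe_conj]
        simp [mul_assoc] }
  -- An element of `D₀` fixed by all these conjugations commutes with `P`, so it belongs to `P` by
  -- maximality. The assertion follows by the Galois correspondence.
  have hle : IntermediateField.fixedField H ≤ hP.prop.degreeZero ℱ := by
    intro a ha
    rw [IntermediateField.mem_fixedField_iff] at ha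
    refine mem_of_maximal hP a.2 fun b hb => ?_
    rw [← DirectSum.sum_support_decompose 𝒟 b, Finset.sum_mul, Finset.mul_sum]
    refine Finset.sum_congr rfl fun γ _ => ?_
    by_cases h0 : (DirectSum.decompose 𝒟 b γ : D) = 0
    · rw [h0, zero_mul, mul_zero]
    obtain ⟨w, hw⟩ := IsGradedDivisionRing.isUnit_of_mem γ _ (SetLike.coe_mem _) h0
    have hwγ : (w : D) ∈ 𝒟 γ := hw ▸ SetLike.coe_mem (DirectSum.decompose 𝒟 b γ)
    have h1 := congrArg Subtype.val (ha _ ⟨γ, w, hwγ, hw ▸ hP.prop.decompose_mem b hb γ, rfl⟩)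
    rw [coe_conj, Units.mul_inv_eq_iff_eq_mul] at h1
    rw [← hw, h1]
  have h1 := IntermediateField.fixingSubgroup_le hle hσ
  rw [IntermediateField.fixingSubgroup_fixedField] at h1
  exact h1

variable [Algebra.IsCentral F D]

open scoped IsMulCommutative in
/-- The homogeneous components of a graded subfield whose fraction field is an elementary abelian
extension are generated by `p`-th roots of elements of `F`. -/
lemma mem_closure_of_isFracElementaryAbelian [IsOrderedAddMonoid Γ] {P : Subalgebra F D}
    [IsMulCommutative P] (hP : IsGradedSubfield 𝒟 P) (hEA : IsFracElementaryAbelian F P) {p n : ℕ}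
    (hp : p.Prime) {ζ : ℱ 0} (hζ : IsPrimitiveRoot ζ p)
    (hcard : Module.finrank (ℱ 0) (𝒟 0) = p ^ n) {y : D} (hy : y ∈ P) {γ : Γ} (hγ : y ∈ 𝒟 γ) :
    y ∈ AddSubgroup.closure {b | b ∈ P ∧ b ∈ 𝒟 γ ∧ b ^ p ∈ Set.range (algebraMap F D)} := by
  have hF := isDomain_of_isGradedDivisionRing ℱ
  have hD := isDomain_of_isGradedDivisionRing 𝒟
  have hinjF := algebraMap_injective ℱ 𝒟
  have hN : (Module.finrank (ℱ 0) (𝒟 0) : D) ≠ 0 := by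
    have : NeZero p := ⟨hp.ne_zero⟩
    have hpF : (p : F) ≠ 0 := (isPrimitiveRoot_coe hζ).neZero'.out
    rw [hcard, Nat.cast_pow, ← map_natCast (algebraMap F D)]
    exact pow_ne_zero n fun h => hpF (hinjF (h.trans (map_zero _).symm))
  obtain ⟨E, L, _, _, _, _, _, _, _, _, _, _, hGal, hab⟩ := hEA
  have hinj : Function.Injective (algebraMap P L) := IsFractionRing.injective P L
  have hinjP : Function.Injective (algebraMap F P) := fun x y h =>
    hinjF (congrArg Subtype.val h)
  have : Algebra.IsIntegral F P := ⟨fun x =>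
    (isIntegral_algHom_iff P.val Subtype.val_injective).1 (Algebra.IsIntegral.isIntegral (x : D))⟩
  have : FiniteDimensional E L := by
    refine finiteDimensional_of_isFractionRing (R := F) (S := P) hinjP ?_
    exact (LinearMap.rank_le_of_injective P.val.toLinearMap Subtype.val_injective).trans_lt
      (Module.rank_lt_aleph0 F D)
  let r : ℱ 0 →+* E := (algebraMap F E).comp
    { toFun := Subtype.val
      map_one' := rfl
      map_mul' := fun _ _ => rfl
      map_zero' := rfl
      map_add' := fun _ _ => rfl }
  -- The image of `P_γ`, a vector space over the image of `F₀`. It is Galois stable because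
  -- automorphisms multiply homogeneous elements by elements of `P₀`, so the eigencomponents of `y`
  -- stay homogeneous of degree `γ`.
  let V : AddSubgroup L := ((𝒟 γ).comap P.val.toAddMonoidHom).map
    (algebraMap P L).toAddMonoidHom
  have h := mem_closure_of_elementaryAbelian hp
    ((isPrimitiveRoot_coe hζ).map_of_injective (IsFractionRing.injective F E)) hab.1
    (hab.pow_eq_one hp (isPGroup_gal (ℱ := ℱ) hP hcard hN)) r.fieldRange ⟨ζ, rfl⟩ V ?_ ?_
    (a := algebraMap P L ⟨y, hy⟩) ⟨⟨y, hy⟩, hγ, rfl⟩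
  -- The `p`-th power of an eigencomponent is homogeneous and a fraction of elements of `F`, hence
  -- an element of `F`.
  · have hsub : {b | b ∈ V ∧ b ^ p ∈ Set.range (algebraMap E L)} ⊆
        (algebraMap P L).toAddMonoidHom '' {b : P | (b : D) ∈ 𝒟 γ ∧
          (b : D) ^ p ∈ Set.range (algebraMap F D)} := by
      rintro _ ⟨⟨b, hb, rfl⟩, e, he⟩
      change _ = algebraMap P L b ^ p at he
      refine ⟨b, ⟨hb, ?_⟩, rfl⟩
      obtain ⟨f, g, hg, rfl⟩ := IsFractionRing.div_surjective (A := F) e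
      have hg0 : g ≠ 0 := nonZeroDivisors.ne_zero hg
      refine mem_range_of_mul_eq ℱ (f := f) hg0 (SetLike.pow_mem_graded p hb) ?_
      have hg1 : algebraMap E L (algebraMap F E g) ≠ 0 := by
        rw [map_ne_zero]
        exact fun h => hg0 (IsFractionRing.injective F E (h.trans (map_zero _).symm))
      rw [map_div₀, div_eq_iff hg1, ← IsScalarTower.algebraMap_apply,
        ← IsScalarTower.algebraMap_apply, IsScalarTower.algebraMap_apply F P L,
        IsScalarTower.algebraMap_apply F P L, ← map_pow, ← map_mul] at he
      have h1 := congrArg Subtype.val (hinj he)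
      exact (Algebra.commutes g _).trans h1.symm
    have h1 := AddSubgroup.closure_mono hsub h
    rw [← AddMonoidHom.map_closure] at h1
    obtain ⟨z, hz, hzy⟩ := h1
    have hzy' : z = ⟨y, hy⟩ := hinj hzy
    have h2 := AddSubgroup.mem_map_of_mem P.val.toAddMonoidHom hz
    rw [AddMonoidHom.map_closure, hzy'] at h2
    refine AddSubgroup.closure_mono ?_ h2
    rintro _ ⟨b, hb, rfl⟩
    exact ⟨b.2, hb.1, hb.2⟩
  · rintro _ ⟨c, rfl⟩ _ ⟨b, hb, rfl⟩
    refine ⟨algebraMap F P (c : F) * b, ?_, ?_⟩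
    · have h1 := SetLike.mul_mem_graded (IsGradedAlgebra.algebraMap_mem (𝒟 := 𝒟) 0 (c : F) c.2) hb
      rw [zero_add] at h1
      exact h1
    · change algebraMap P L (algebraMap F P (c : F) * b) =
        algebraMap E L (algebraMap F E (c : F)) * algebraMap P L b
      rw [map_mul, ← IsScalarTower.algebraMap_apply, ← IsScalarTower.algebraMap_apply]
  · rintro τ _ ⟨b, hb, rfl⟩
    obtain ⟨u, hu⟩ := exists_apply_eq_mul (ℱ := ℱ) hP hN τ hb
    refine ⟨⟨(u : 𝒟 0), u.2⟩ * b, ?_, hu.symm⟩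
    have h1 := SetLike.mul_mem_graded (u : 𝒟 0).2 hb
    rw [zero_add] at h1
    exact h1

namespace CocycleData

variable (S : CocycleData ℱ 𝒟)

open scoped IsMulCommutative in
-- The field is `M = P₀`. Homogeneous `p`-th roots in degree `0` generate `M` over `F₀`; those in
-- the other degrees realise `Gal(D₀/M)` by conjugation and give the commuting elements of the
-- crossed product.
lemma exists_mem_range_of_isElementaryAbelianGradedCrossedProduct [IsOrderedAddMonoid Γ]
    (h : IsElementaryAbelianGradedCrossedProduct F 𝒟) {p n : ℕ} (hp : p.Prime) {ζ : ℱ 0}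
    (hζ : IsPrimitiveRoot ζ p) (hcard : Module.finrank (ℱ 0) (𝒟 0) = p ^ n) :
    ∃ M : IntermediateField (ℱ 0) (𝒟 0), IsElementaryAbelianExtension (ℱ 0) M ∧
      IsElementaryAbelianExtension M (𝒟 0) ∧
      S.crossedProductClass ∈ (BrauerTheory.relBrModDecMap M).range := by
  have : IsAbelianGalois (ℱ 0) (𝒟 0) := isAbelianGalois_zero
  obtain ⟨P, hP, hPc, hEA⟩ := h
  have hcl := fun (y : D) (hy : y ∈ P) (γ : Γ) (hγ : y ∈ 𝒟 γ) =>
    mem_closure_of_isFracElementaryAbelian hP.prop hEA hp hζ hcard hy hγ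
  set M := hP.prop.degreeZero ℱ with hMdef
  have hH : ∀ σ ∈ M.fixingSubgroup, ∃ a : 𝒟 0, a ≠ 0 ∧ S.homog σ a ∈ P ∧
      S.homog σ a ^ p ∈ Set.range (algebraMap F D) := by
    intro σ hσ
    obtain ⟨γ, w, hw, hwP, rfl⟩ := exists_conj_eq_of_mem_fixingSubgroup hP hσ
    -- `w ≠ 0` is a sum of `p`-th roots of elements of `F` in `P_γ`, so one of them is nonzero. It
    -- has the degree of `w` and therefore induces the same automorphism of `D₀`.
    obtain ⟨b, ⟨hbP, hbγ, f, hf⟩, hb0⟩ : ∃ b ∈ {b | b ∈ P ∧ b ∈ 𝒟 γ ∧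
        b ^ p ∈ Set.range (algebraMap F D)}, b ≠ 0 := by
      by_contra! h0
      have := nontrivial_of_isGradedDivisionRing 𝒟
      exact w.ne_zero ((AddSubgroup.closure_le ⊥).2 (fun b hb => AddSubgroup.mem_bot.2 (h0 b hb))
        (hcl w hwP γ hw))
    obtain ⟨b, rfl⟩ := IsGradedDivisionRing.isUnit_of_mem γ b hbγ hb0
    rw [conj_eq_conj ℱ 𝒟 w b hw hbγ]
    obtain ⟨e, φ, he0, he⟩ := S.exists_eq_homog b hbγ
    have he' : S.homog (conj ℱ 𝒟 b hbγ) e = b * algebraMap F D (φ⁻¹ : Fˣ) := by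
      rw [he, mul_assoc, ← map_mul, Units.mul_inv, map_one, mul_one]
    refine ⟨e, he0, ?_, ?_⟩
    · rw [he']
      exact P.mul_mem hbP (P.algebraMap_mem _)
    · refine ⟨f * (φ⁻¹ : Fˣ) ^ p, ?_⟩
      rw [he', (show Commute (b : D) (algebraMap F D (φ⁻¹ : Fˣ)) from
        (Algebra.commutes _ _).symm).mul_pow, ← hf, map_mul, map_pow]
  have hHp : ∀ σ ∈ M.fixingSubgroup, σ ^ p = 1 := by
    intro σ hσ
    obtain ⟨a, ha0, -, f, hf⟩ := hH σ hσ
    obtain ⟨b, φ, hb, -⟩ := S.exists_homog_pow σ a (p - 1)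
    rw [Nat.sub_add_cancel hp.one_le, ← hf] at hb
    have hf' : algebraMap F D (f * (φ⁻¹ : Fˣ)) = S.homog (σ ^ p) b := by
      rw [map_mul, hb, mul_assoc, ← map_mul, Units.mul_inv, map_one, mul_one]
    have hb0 : b ≠ 0 := by
      rintro rfl
      have := nontrivial_of_isGradedDivisionRing 𝒟
      refine ((S.isUnit_homog σ ha0).pow p).ne_zero ?_
      rw [← hf, hb, homog, ZeroMemClass.coe_zero, zero_mul, zero_mul]
    -- `S.homog (σ ^ p) b` is central, as it lies in `F`, whereas moving it past `c` replaces `c` by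
    -- `(σ ^ p) c`.
    ext c
    have h1 := S.homog_mul_coe (σ ^ p) b c
    rw [← hf', Algebra.commutes, hf'] at h1
    exact ((S.isUnit_homog (σ ^ p) hb0).mul_left_injective h1).symm
  refine ⟨M, ?_, isElementaryAbelianExtension_of_fixingSubgroup hp M hHp, ?_⟩
  · refine isElementaryAbelianExtension_of_adjoin hp hζ
      (S := {x : M | x ^ p ∈ Set.range (algebraMap (ℱ 0) M)}) ?_ fun x hx => hx
    rw [eq_top_iff]
    rintro m -
    have hm := hcl ((m : 𝒟 0) : D) m.2 0 (m : 𝒟 0).2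
    have h1 : ∀ y ∈ AddSubgroup.closure {b | b ∈ P ∧ b ∈ 𝒟 0 ∧
        b ^ p ∈ Set.range (algebraMap F D)}, ∃ x ∈ IntermediateField.adjoin (ℱ 0)
          {x : M | x ^ p ∈ Set.range (algebraMap (ℱ 0) M)}, ((x : 𝒟 0) : D) = y := by
      intro y hy
      induction hy using AddSubgroup.closure_induction with
      | mem b hb =>
        obtain ⟨hbP, hb0, hbp⟩ := hb
        obtain ⟨c, hc⟩ := exists_algebraMap_eq_of_mem_range (ℱ := ℱ) ((⟨b, hb0⟩ : 𝒟 0) ^ p) hbp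
        exact ⟨⟨⟨b, hb0⟩, hbP⟩, IntermediateField.subset_adjoin _ _ ⟨c, Subtype.ext hc⟩, rfl⟩
      | zero => exact ⟨0, zero_mem _, rfl⟩
      | add b c _ _ hb hc =>
        obtain ⟨y, hy, h⟩ := hb
        obtain ⟨y', hy', h'⟩ := hc
        exact ⟨y + y', add_mem hy hy', congrArg₂ (· + ·) h h'⟩
      | neg b _ hb =>
        obtain ⟨y, hy, h⟩ := hb
        exact ⟨-y, neg_mem hy, congrArg Neg.neg h⟩
    obtain ⟨x, hx, hxm⟩ := h1 _ hm
    rwa [← (Subtype.ext (Subtype.ext hxm) : x = m)]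
  · choose! a ha0 haP hap using hH
    refine BrauerTheory.mem_range_of_commute _ M gal_mul_comm hp hHp a (fun σ hσ τ hτ => ?_)
      fun σ hσ => ?_
    · exact S.commute_single (hP.prop.mul_comm (haP σ hσ) (haP τ hτ))
    · exact S.exists_single_pow_eq_algebraMap hp.ne_zero (hHp σ hσ) (ha0 σ hσ) (hap σ hσ)

end CocycleData

end GradedDivision

theorem theorem2p15 {Γ : Type v} [AddCommGroup Γ] [LinearOrder Γ] [IsOrderedAddMonoid Γ]
    {F D : Type u} [CommRing F] [Ring D] [Algebra F D]
    (ℱ : Γ → AddSubgroup F) (𝒟 : Γ → AddSubgroup D) [GradedRing ℱ] [GradedRing 𝒟]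
    [GradedDivision.IsGradedDivisionRing ℱ] [GradedDivision.IsGradedDivisionRing 𝒟]
    [GradedDivision.IsGradedAlgebra ℱ 𝒟] [Module.Finite F D] [Algebra.IsCentral F D]
    [IsMulCommutative (𝒟 0)] [GradedDivision.IsSemiramified ℱ 𝒟]
    (S : GradedDivision.CocycleData ℱ 𝒟)
    (p n : ℕ) (hp : p.Prime) (hn : n ≠ 0) (hdeg : Module.finrank F D = (p ^ n) ^ 2)
    (ζ : ℱ 0) (hζ : IsPrimitiveRoot ζ p) :
    List.TFAE
      [GradedDivision.IsElementaryAbelianGradedCrossedProduct F 𝒟,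
        ∃ M : IntermediateField (ℱ 0) (𝒟 0),
          GradedDivision.IsElementaryAbelianExtension (ℱ 0) M ∧
          GradedDivision.IsElementaryAbelianExtension M (𝒟 0) ∧
          S.crossedProductClass ∈ (BrauerTheory.relBrModDecMap M).range,
        (Monoid.exponent (𝒟 0 ≃ₐ[ℱ 0] 𝒟 0) = p ∨
          Monoid.exponent (𝒟 0 ≃ₐ[ℱ 0] 𝒟 0) = p ^ 2) ∧
        S.crossedProductClass ∈ (BrauerTheory.relBrModDecMap
          (IntermediateField.fixedField
            (GradedDivision.powSubgroup (𝒟 0 ≃ₐ[ℱ 0] 𝒟 0) p))).range] ∧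
    (Monoid.exponent (𝒟 0 ≃ₐ[ℱ 0] 𝒟 0) = p →
      IntermediateField.fixedField (GradedDivision.powSubgroup (𝒟 0 ≃ₐ[ℱ 0] 𝒟 0) p) = ⊤ ∧
      S.crossedProductClass ∈ (BrauerTheory.relBrModDecMap
        (IntermediateField.fixedField
          (GradedDivision.powSubgroup (𝒟 0 ≃ₐ[ℱ 0] 𝒟 0) p))).range) := by
  have : IsAbelianGalois (ℱ 0) (𝒟 0) := GradedDivision.isAbelianGalois_zero
  have hcard : Module.finrank (ℱ 0) (𝒟 0) = p ^ n := by
    have h := GradedDivision.IsSemiramified.finrank_eq_sq (ℱ := ℱ) (𝒟 := 𝒟)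
    rw [hdeg] at h
    exact (Nat.pow_left_injective two_ne_zero h).symm
  refine ⟨?_, fun h => ?_⟩
  · tfae_have 1 → 2 := fun h =>
      S.exists_mem_range_of_isElementaryAbelianGradedCrossedProduct h hp hζ hcard
    tfae_have 2 → 1 := fun ⟨_, hM, hM', h⟩ =>
      S.isElementaryAbelianGradedCrossedProduct_of_mem_range hp hcard hζ hM hM' h
    tfae_have 2 ↔ 3 := GradedDivision.exists_intermediateField_iff_exponent hp hn hcard _
    tfae_finish
  · have h1 := GradedDivision.fixedField_powSubgroup_eq_top h
    refine ⟨h1, ?_⟩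
    rw [h1]
    exact GradedDivision.mem_range_top _
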